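/- Work in $\mathbb R^3$ with coordinates $x,y,z$, and let $R_\theta$ be the rotation by $\theta$ about the $z$-axis. Let $D$ be the closed unit disc with centre $(\sqrt2,0,0)$ in the $zx$-plane, with angle $\phi$ measured about its centre from the $+x$-direction towards the $+z$-direction. Revolve $D$ about the $z$-axis while rotating it about its own centre, so that after revolving by $\psi$ it has been rotated by $\psi/2$; this screw motion sweeps out the solid donut $SD$ (with boundary a torus). The two points $(\sqrt2\pm1,0,0)$ sweep out a $(2,-1)$ torus knot $K_0\subset\partial SD$. For $0<|\phi|<\pi$ let $\alpha_\phi\subset D$ be the arc, orthogonal to $\partial D$, of a circle with centre on the $x$-axis that has its endpoints on $\partial D$ at the angles $\pm\phi$ (for $|\phi|=\pi/2$ it is the vertical diameter), and let $A_\phi$ be the surface swept out by $\alpha_\phi\cup\alpha_{\pi-\phi}$ under the screw motion. For $0<|\phi|<\pi/2$ it is an embedded annulus with boundary $R_{2\phi}(K_0)\cup R_{-2\phi}(K_0)$. Let $\rho:D^2\to\mathbb R^3$ be a $C^\infty$ immersion of the closed unit disc, with image $D_0$, which maps $\partial D^2$ bijectively onto $K_0$, is orthogonal to $\partial SD$ along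 its boundary, and meets $\partial SD$ from the outside (a collar of $\partial D^2$ is mapped into the complement of the interior of $SD$). Put $D_\theta=R_\theta(D_0)$, parametrized by $R_\theta\circ\rho$. For nonzero $\theta\in(-\pi,\pi)$ let $S_\theta=D_{-\theta}\cup A_{\theta/2}\cup D_\theta$. A parametrization of $S_\theta$ is a $C^1$ immersion $f:S^2\to\mathbb R^3$ for which $S^2$ is divided into two disjoint closed discs, homeomorphic images of $D^2$ on which $f$ is $R_\theta\circ\rho$ and $R_{-\theta}\circ\rho$ respectively, and the closed annulus between them, which $f$ maps bijectively onto $A_{\theta/2}$. Proposition. For every such $\rho$ and every nonzero $\theta\in(-\pi,\pi)$, $S_\theta$ is an immersed sphere, that is, it has a parametrization, and it is regularly homotopic to an embedded sphere: for every parametrization $f$ of $S_\theta$ there are a $C^\infty$ embedding $g:S^2\to\mathbb R^3$ and a homotopy $H_t$ $(0\le t\le1)$ from $f$ to $g$ through $C^1$ immersions such that the induced map $[0,1]\times TS^2\to T\mathbb R^3$, $(t,v)\mapsto dH_t(v)$, is continuous. -/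

import Mathlib

open Set Metric
open scoped Manifold ContDiff Topology

noncomputable section

/-- The `uv`-plane, in which the closed unit disc lives. -/
abbrev Plane : Type := EuclideanSpace ℝ (Fin 2)

/-- Euclidean 3-space, with coordinates `p 0 = x`, `p 1 = y`, `p 2 = z`. -/
abbrev Space : Type := EuclideanSpace ℝ (Fin 3)

/-- The unit 2-sphere with its standard smooth structure. -/
abbrev Sphere2 : Type := sphere (0 : Space) 1

/-! ### Immersed spheres and regular homotopy -/

/-- `f : S² → ℝ³` is a `C^n` immersion: it is `C^n` and its differential is injective everywhere. -/
structure IsSphereImmersion (n : ℕ∞ω) (f : Sphere2 → Space) : Prop where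
  contMDiff : ContMDiff (𝓡 2) 𝓘(ℝ, Space) n f
  injective_mfderiv : ∀ q, Function.Injective (mfderiv (𝓡 2) 𝓘(ℝ, Space) f q)

/-- A smoothly embedded sphere: a `C^∞` immersion that is a homeomorphism onto its image. -/
structure IsSmoothSphereEmbedding (f : Sphere2 → Space) : Prop where
  isImmersion : IsSphereImmersion ∞ f
  isEmbedding : Topology.IsEmbedding f

/-- Regular homotopy: a homotopy through `C^1` immersions for which the induced
homotopy `T S² → T ℝ³` of tangent bundles is (jointly) continuous. -/
def RegularlyHomotopic (f g : Sphere2 → Space) : Prop :=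
  ∃ H : unitInterval → Sphere2 → Space,
    H 0 = f ∧ H 1 = g ∧
    (∀ t, IsSphereImmersion 1 (H t)) ∧
    Continuous (fun p : unitInterval × TangentBundle (𝓡 2) Sphere2 =>
      tangentMap (𝓡 2) 𝓘(ℝ, Space) (H p.1) p.2)

/-! ### The solid donut, the knot and the annuli -/

/-- Rotation of `ℝ³` about the `z`-axis by the angle `θ`. -/
def rotZ (θ : ℝ) (p : Space) : Space :=
  !₂[Real.cos θ * p 0 - Real.sin θ * p 1, Real.sin θ * p 0 + Real.cos θ * p 1, p 2]

/-- The screw motion that sweeps out the solid donut. A point of the unit disc of the `zx`-plane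
with centre `(√2, 0, 0)` is written `(√2 + u.1, 0, u.2)`; it is rotated about the centre of the
disc by `ψ / 2` (from the `x`-direction to the `z`-direction) while the disc is
revolved about the `z`-axis by `ψ`. -/
def screw (ψ : ℝ) (u : ℝ × ℝ) : Space :=
  rotZ ψ !₂[√2 + (Real.cos (ψ / 2) * u.1 - Real.sin (ψ / 2) * u.2), 0,
    Real.sin (ψ / 2) * u.1 + Real.cos (ψ / 2) * u.2]

/-- The solid donut obtained by revolving the unit disc with centre `(√2, 0, 0)` in the
`zx`-plane about the `z`-axis. -/
def solidDonut : Set Space :=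
  {p | (√(p 0 ^ 2 + p 1 ^ 2) - √2) ^ 2 + p 2 ^ 2 ≤ 1}

/-- The outward unit normal of the boundary torus of the solid donut, at a point `p` of the torus:
`p` minus the nearest point of the core circle. -/
def torusNormal (p : Space) : Space :=
  p - (√2 / √(p 0 ^ 2 + p 1 ^ 2)) • !₂[p 0, p 1, 0]

/-- The `(2,-1)` torus knot `K₀` swept out by the two points `(√2 ± 1, 0, 0)`. -/
def knotZero : Set Space :=
  {p | ∃ ψ : ℝ, p = screw ψ (1, 0) ∨ p = screw ψ (-1, 0)}

/-- The arc `α_φ` in the closed unit disc (coordinates relative to its centre) of the circle that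
is orthogonal to the unit circle, has its centre on the horizontal axis, and meets the unit circle
at the angles `±φ`; see `mem_arc_iff`. For `φ = π / 2` it is the vertical diameter.
The equation is even in `φ`. -/
def arc (φ : ℝ) : Set (ℝ × ℝ) :=
  {u | u.1 ^ 2 + u.2 ^ 2 ≤ 1 ∧ (u.1 ^ 2 + u.2 ^ 2 + 1) * Real.cos φ = 2 * u.1}

/-- If `cos φ ≠ 0` then `arc φ` is cut out of the unit disc by the circle of radius `|tan φ|`
with centre `(1 / cos φ, 0)`. -/
theorem mem_arc_iff {φ : ℝ} (h : Real.cos φ ≠ 0) (u : ℝ × ℝ) :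
    u ∈ arc φ ↔ u.1 ^ 2 + u.2 ^ 2 ≤ 1 ∧
      (u.1 - 1 / Real.cos φ) ^ 2 + u.2 ^ 2 = Real.tan φ ^ 2 := by
  have hs : Real.sin φ ^ 2 = 1 - Real.cos φ ^ 2 := Real.sin_sq φ
  simp only [arc, mem_ofPred_eq, Real.tan_eq_sin_div_cos, div_pow, hs]
  refine and_congr_right fun _ => ?_
  field_simp
  constructor <;> intro H
  · linear_combination Real.cos φ * H
  · refine mul_left_cancel₀ h ?_
    linear_combination H

/-- The annulus `A_φ` swept out by `α_φ ∪ α_{π - φ}` under the screw motion (for `φ` in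
`(-π, π)`, nonzero; `A_{-φ} = A_φ`). -/
def annulus (φ : ℝ) : Set Space :=
  {p | ∃ ψ : ℝ, ∃ u ∈ arc φ ∪ arc (Real.pi - φ), p = screw ψ u}

/-! ### The disc `D₀` and the spheres `S_θ` -/

/-- `ρ`, restricted to the closed unit disc, is a smoothly immersed disc `D₀` in `ℝ³` bounded by
`K₀`, orthogonal to the boundary torus of the solid donut and meeting it from the outside. -/
structure IsSpanningDisc (ρ : Plane → Space) : Prop where
  contDiffOn : ContDiffOn ℝ ∞ ρ (closedBall 0 1)
  injective_fderivWithin : ∀ x ∈ closedBall (0 : Plane) 1,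
    Function.Injective (fderivWithin ℝ ρ (closedBall 0 1) x)
  /-- The boundary circle is mapped bijectively onto `K₀`. -/
  bijOn_boundary : BijOn ρ (sphere 0 1) knotZero
  /-- Along the boundary, the tangent plane of the disc contains the normal of the torus, that
  is, the two surfaces meet at a right angle. -/
  orthogonal : ∀ x ∈ sphere (0 : Plane) 1,
    torusNormal (ρ x) ∈ Set.range (fderivWithin ℝ ρ (closedBall 0 1) x)
  /-- A collar of the boundary lies outside the interior of the solid donut. -/
  outside : ∃ δ > 0, ∀ x ∈ closedBall (0 : Plane) 1, 1 - δ < ‖x‖ →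
    ρ x ∉ interior solidDonut

/-- `f : S² → ℝ³` is a parametrization, as an immersed sphere, of
`S_θ = D_{-θ} ∪ A_{θ/2} ∪ D_θ`, where `D_{±θ}` is the image of the disc `ρ` under the rotation by
`±θ` about the `z`-axis: the sphere is divided into two disjoint closed discs, parametrized by
`c₁` and `c₂`, on which `f` is `D_θ` and `D_{-θ}`, and the closed annulus left between them, which
`f` maps bijectively (hence homeomorphically) onto the embedded annulus `A_{θ/2}`. -/
def IsSphereS (ρ : Plane → Space) (θ : ℝ) (f : Sphere2 → Space) : Prop :=
  IsSphereImmersion 1 f ∧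
  ∃ c₁ c₂ : Plane → Sphere2,
    ContinuousOn c₁ (closedBall 0 1) ∧ InjOn c₁ (closedBall 0 1) ∧
    ContinuousOn c₂ (closedBall 0 1) ∧ InjOn c₂ (closedBall 0 1) ∧
    Disjoint (c₁ '' closedBall 0 1) (c₂ '' closedBall 0 1) ∧
    (∀ x ∈ closedBall (0 : Plane) 1, f (c₁ x) = rotZ θ (ρ x)) ∧
    (∀ x ∈ closedBall (0 : Plane) 1, f (c₂ x) = rotZ (-θ) (ρ x)) ∧
    BijOn f (c₁ '' ball 0 1 ∪ c₂ '' ball 0 1)ᶜ (annulus (θ / 2))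

end

noncomputable section

/-! The sphere $S_\theta$ is the double of an immersed disc whose two sheets are pulled apart by
rotations about the $z$-axis. Put $\varphi=\theta/2$ and take $\theta>0$; the other sign exchanges
the two discs. Revolving by $2o$ carries the horizontal radius of one slice of the donut to the
radius at angle $-o$ of another slice (`rotZ_screw`). So $A_\varphi$ arises from the strip that runs
radially from $K_0$ into the donut, by rotating each point by $\pm2o$, where $o$ depends on the
distance $b$ to the core through the equation of the arc, $(b^2+1)\cos\varphi=2b\cos o$. If $r$ is
$D_0$ continued by this strip (`pillowDisc`), then $S_\theta$ is parametrized by $q=(x,z)\mapsto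
R_{2\,\mathrm{tilt}(z)}(r(x))$ on the unit sphere (`pillowSphere`), where `tilt` is $\pm\varphi$ on
the two caps and runs from $-\varphi$ to $\varphi$ in between.

This map is an immersion because `tilt` is constant on the caps, while the rotation field is
transverse to the strip (`eq_zero_of_fderiv_outer`). Both facts survive multiplication of the angle
by any positive constant, so the angle may be made small (`IsPillow.scale`). A slightly sheared
double is regularly homotopic to the thickening $r(x)+e\,z\,w(x)$, with $w$ transverse to the disc
(`homotopic_thickening`). Replacing $r(x)$ by its rescalings $r(ux)/u$, up to constants, and letting
$u\to0$ contracts the disc to its derivative at the centre (`thickening_homotopic`). The result is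
an injective linear image of the round sphere (`exists_linear`). Self-intersections of $\rho$ play
no role, since only the disc as an immersion is used.

The $C^1$ match between $D_0$ and the strip needs care. Orthogonality gives the right tangent plane,
but the speed at which $D_0$ leaves the torus varies along $K_0$. A reparametrization of the disc
that fixes the boundary makes this speed constant and its direction normal (`exists_reparam`,
`exists_normalized`), and the radii of the neck are chosen to fit it (`exists_isNeck`).

An arbitrary parametrization of $S_\theta$ differs from the explicit one by a $C^1$ diffeomorphism
$h$ of the sphere (`IsGlued.exists_diffeo`), so it is regularly homotopic to $L\circ h$ with $L$
linear and injective. Mollifying $h$ with a derivative error that is small against the Lipschitz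
constant of $h^{-1}$ gives a smooth embedding (`exists_smoothSphereEmbedding`). -/

/-! ### Differentials of maps on the unit sphere. -/

instance finrank_space_fact : Fact (Module.finrank ℝ Space = 2 + 1) := ⟨by simp⟩

theorem norm_coe_sphere2 (q : Sphere2) : ‖(q : Space)‖ = 1 := by simp

theorem coe_sphere2_ne_zero (q : Sphere2) : (q : Space) ≠ 0 := ne_zero_of_mem_unit_sphere q

/-- The differential of the inclusion of the unit sphere, with values in `Space`. -/
def sphereIncl (q : Sphere2) : TangentSpace (𝓡 2) q →L[ℝ] Space :=
  mfderiv (𝓡 2) 𝓘(ℝ, Space) ((↑) : Sphere2 → Space) q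

theorem sphereIncl_injective (q : Sphere2) : Function.Injective (sphereIncl q) :=
  injective_mvfderiv_subtypeVal_sphere q

theorem range_sphereIncl (q : Sphere2) (d : Space) :
    d ∈ Set.range (sphereIncl q) ↔ inner ℝ (q : Space) d = 0 := by
  have h := range_mvfderiv_subtypeVal (n := 2) q
  rw [← Submodule.mem_orthogonal_singleton_iff_inner_right, ← h]
  rfl

theorem inner_sphereIncl (q : Sphere2) (v : TangentSpace (𝓡 2) q) :
    inner ℝ (q : Space) (sphereIncl q v) = 0 := (range_sphereIncl q _).1 ⟨v, rfl⟩

theorem mdifferentiableAt_coe_sphere2 (q : Sphere2) :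
    MDifferentiableAt (𝓡 2) 𝓘(ℝ, Space) ((↑) : Sphere2 → Space) q :=
  (contMDiff_coe_sphere (m := 1) q).mdifferentiableAt one_ne_zero

theorem contMDiff_comp_coe {n : ℕ∞ω} {F : Space → Space} (hF : ContDiff ℝ n F) :
    ContMDiff (𝓡 2) 𝓘(ℝ, Space) n (fun q : Sphere2 => F q) :=
  hF.comp_contMDiff contMDiff_coe_sphere

theorem mfderiv_comp_coe {F : Space → Space} {q : Sphere2} (hF : DifferentiableAt ℝ F q)
    (v : TangentSpace (𝓡 2) q) :
    mfderiv (𝓡 2) 𝓘(ℝ, Space) (fun q : Sphere2 => F q) q v =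
      fderiv ℝ F q (sphereIncl q v) := by
  have h := mfderiv_comp (I := 𝓡 2) (I' := 𝓘(ℝ, Space)) (I'' := 𝓘(ℝ, Space)) q
    (g := F) (f := ((↑) : Sphere2 → Space)) hF.mdifferentiableAt (mdifferentiableAt_coe_sphere2 q)
  have h2 : mfderiv (𝓡 2) 𝓘(ℝ, Space) (fun q : Sphere2 => F q) q =
    (mfderiv 𝓘(ℝ, Space) 𝓘(ℝ, Space) F q).comp
      (mfderiv (𝓡 2) 𝓘(ℝ, Space) ((↑) : Sphere2 → Space) q) := h
  rw [h2, mfderiv_eq_fderiv]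
  rfl

/-- `F` is injective on the tangent planes of the unit sphere. -/
def InjOnTangents (F' : Space → Space →L[ℝ] Space) : Prop :=
  ∀ q ∈ sphere (0 : Space) 1, ∀ d : Space, inner ℝ q d = 0 → F' q d = 0 → d = 0

theorem isSphereImmersion_comp_coe {n : ℕ∞ω} {F : Space → Space} (hF : ContDiff ℝ n F)
    (hn : n ≠ 0) (hinj : InjOnTangents (fderiv ℝ F)) :
    IsSphereImmersion n (fun q : Sphere2 => F q) := by
  refine ⟨contMDiff_comp_coe hF, fun q => ?_⟩
  rw [injective_iff_map_eq_zero]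
  intro v hv
  rw [mfderiv_comp_coe ((hF.differentiable hn) _)] at hv
  have := hinj q q.2 _ (inner_sphereIncl q v) hv
  exact (injective_iff_map_eq_zero _).1 (sphereIncl_injective q) v this

/-- Tangent vectors of the sphere become pairs (point, vector) in `Space`. This reduces the joint
continuity required of a regular homotopy to continuity of a family and of its derivative. -/
theorem continuous_tangent_pair :
    Continuous fun v : TangentBundle (𝓡 2) Sphere2 => ((v.1 : Space), (sphereIncl v.1 v.2 : Space)) := by
  have h := (contMDiff_coe_sphere (E := Space) (n := 2) (m := 1)).continuous_tangentMap le_rfl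
  exact (tangentBundleModelSpaceHomeomorph 𝓘(ℝ, Space)).continuous.comp h

theorem continuous_into_tangentBundle {X : Type*} [TopologicalSpace X]
    {f : X → TangentBundle 𝓘(ℝ, Space) Space}
    (h : Continuous fun x => (((f x).1 : Space), ((f x).2 : Space))) : Continuous f := by
  have := (tangentBundleModelSpaceHomeomorph 𝓘(ℝ, Space)).symm.continuous.comp
    (show Continuous fun x => (((f x).1, (f x).2) : ModelProd Space Space) from h)
  exact this

/-! ### Building and combining regular homotopies. -/

/-- A family of maps `Space → Space` that restricts to a regular homotopy of the unit sphere. -/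
structure IsImmersionFamily (F : ℝ → Space → Space) (F' : ℝ → Space → Space →L[ℝ] Space) :
    Prop where
  hasFDerivAt : ∀ t ∈ Icc (0 : ℝ) 1, ∀ p, HasFDerivAt (F t) (F' t p) p
  continuous : ∀ t ∈ Icc (0 : ℝ) 1, Continuous (F' t)
  continuousOn : ContinuousOn (Function.uncurry F) (Icc (0 : ℝ) 1 ×ˢ sphere 0 1)
  continuousOn_deriv : ContinuousOn (Function.uncurry F') (Icc (0 : ℝ) 1 ×ˢ sphere 0 1)
  inj : ∀ t ∈ Icc (0 : ℝ) 1, InjOnTangents (F' t)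

theorem IsImmersionFamily.contDiff {F : ℝ → Space → Space} {F' : ℝ → Space → Space →L[ℝ] Space}
    (h : IsImmersionFamily F F') {t : ℝ} (ht : t ∈ Icc (0 : ℝ) 1) : ContDiff ℝ 1 (F t) :=
  contDiff_one_iff_hasFDerivAt.2 ⟨F' t, h.continuous t ht, h.hasFDerivAt t ht⟩

theorem IsImmersionFamily.regularlyHomotopic {F : ℝ → Space → Space}
    {F' : ℝ → Space → Space →L[ℝ] Space} (h : IsImmersionFamily F F') :
    RegularlyHomotopic (fun q => F 0 q) (fun q => F 1 q) := by
  have hF' : ∀ t ∈ Icc (0 : ℝ) 1, fderiv ℝ (F t) = F' t :=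
    fun t ht => funext fun p => (h.hasFDerivAt t ht p).fderiv
  refine ⟨fun t q => F t q, by simp, by simp, fun t => ?_, ?_⟩
  · refine isSphereImmersion_comp_coe (h.contDiff t.2) one_ne_zero ?_
    rw [hF' t t.2]
    exact h.inj t t.2
  · apply continuous_into_tangentBundle
    have e : ∀ p : unitInterval × TangentBundle (𝓡 2) Sphere2,
        (((tangentMap (𝓡 2) 𝓘(ℝ, Space) (fun q : Sphere2 => F p.1 q) p.2).1 : Space),
          ((tangentMap (𝓡 2) 𝓘(ℝ, Space) (fun q : Sphere2 => F p.1 q) p.2).2 : Space)) =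
        (F p.1 p.2.1, F' p.1 p.2.1 (sphereIncl p.2.1 p.2.2)) := by
      intro p
      refine Prod.ext rfl ?_
      change mfderiv (𝓡 2) 𝓘(ℝ, Space) (fun q : Sphere2 => F p.1 q) p.2.1 p.2.2 = _
      rw [mfderiv_comp_coe (h.hasFDerivAt p.1 p.1.2 _).differentiableAt, hF' p.1 p.1.2]
    refine Continuous.congr ?_ fun p => (e p).symm
    have c1 : Continuous fun p : unitInterval × TangentBundle (𝓡 2) Sphere2 =>
        ((p.1 : ℝ), (p.2.1 : Space)) :=
      (continuous_subtype_val.comp continuous_fst).prodMk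
        ((continuous_tangent_pair.fst).comp continuous_snd)
    have m : ∀ p : unitInterval × TangentBundle (𝓡 2) Sphere2,
        ((p.1 : ℝ), (p.2.1 : Space)) ∈ Icc (0 : ℝ) 1 ×ˢ sphere 0 1 := fun p => ⟨p.1.2, p.2.1.2⟩
    refine (h.continuousOn.comp_continuous c1 m).prodMk ?_
    exact (h.continuousOn_deriv.comp_continuous c1 m).clm_apply
      (continuous_tangent_pair.snd.comp continuous_snd)

/-- Only continuity in time is required, so running the two homotopies at double speed needs no
smoothing at time `1 / 2`. -/
theorem RegularlyHomotopic.trans {f g k : Sphere2 → Space} (h₁ : RegularlyHomotopic f g)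
    (h₂ : RegularlyHomotopic g k) : RegularlyHomotopic f k := by
  obtain ⟨H, H0, H1, Hi, Hc⟩ := h₁
  obtain ⟨K, K0, K1, Ki, Kc⟩ := h₂
  -- The clamped times keep both branches defined for every `t`; at `t = 1 / 2` both branches are
  -- `g`.
  let a : unitInterval → unitInterval := fun t => Set.projIcc 0 1 zero_le_one (2 * t)
  let b : unitInterval → unitInterval := fun t => Set.projIcc 0 1 zero_le_one (2 * t - 1)
  have ca : Continuous a := continuous_projIcc.comp (by fun_prop)
  have cb : Continuous b := continuous_projIcc.comp (by fun_prop)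
  refine ⟨fun t => if (t : ℝ) ≤ 1 / 2 then H (a t) else K (b t), ?_, ?_, fun t => ?_, ?_⟩
  · have : a 0 = 0 := by simp [a, Set.projIcc_left]
    simp [this, H0]
  · have : b 1 = 1 := by
      have : (2 * ((1 : unitInterval) : ℝ) - 1) = 1 := by norm_num
      simp only [b, this, Set.projIcc_right]; rfl
    have h2 : ¬ ((1 : unitInterval) : ℝ) ≤ 1 / 2 := by norm_num
    simp only [h2, if_false, this, K1]
  · dsimp only
    split_ifs
    · exact Hi _
    · exact Ki _
  · have : (fun p : unitInterval × TangentBundle (𝓡 2) Sphere2 =>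
        tangentMap (𝓡 2) 𝓘(ℝ, Space) (if (p.1 : ℝ) ≤ 1 / 2 then H (a p.1) else K (b p.1)) p.2) =
        fun p => if (p.1 : ℝ) ≤ 1 / 2 then tangentMap (𝓡 2) 𝓘(ℝ, Space) (H (a p.1)) p.2
          else tangentMap (𝓡 2) 𝓘(ℝ, Space) (K (b p.1)) p.2 := by
      funext p
      split_ifs <;> rfl
    simp only [this]
    refine Continuous.if_le ?_ ?_ (by fun_prop) continuous_const ?_
    · exact Hc.comp ((ca.comp continuous_fst).prodMk continuous_snd)
    · exact Kc.comp ((cb.comp continuous_fst).prodMk continuous_snd)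
    · intro p hp
      have e1 : a p.1 = 1 := by
        have : (2 * (p.1 : ℝ)) = 1 := by rw [hp]; norm_num
        simp only [a, this, Set.projIcc_right]; rfl
      have e2 : b p.1 = 0 := by
        have : (2 * (p.1 : ℝ) - 1) = 0 := by rw [hp]; norm_num
        simp only [b, this, Set.projIcc_left]; rfl
      rw [e1, e2, H1, K0]

/-- Regular homotopies may be precomposed with an immersion of the sphere into itself. -/
theorem RegularlyHomotopic.comp_right {f g : Sphere2 → Space} (h : RegularlyHomotopic f g)
    {k : Sphere2 → Sphere2} (hk : ContMDiff (𝓡 2) (𝓡 2) 1 k)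
    (hk' : ∀ q, Function.Injective (mfderiv (𝓡 2) (𝓡 2) k q)) :
    RegularlyHomotopic (f ∘ k) (g ∘ k) := by
  obtain ⟨H, H0, H1, Hi, Hc⟩ := h
  refine ⟨fun t => H t ∘ k, by simp [H0], by simp [H1], fun t => ⟨(Hi t).1.comp hk, fun q => ?_⟩, ?_⟩
  · rw [mfderiv_comp q ((Hi t).1.mdifferentiable one_ne_zero _) (hk.mdifferentiable one_ne_zero _)]
    exact ((Hi t).2 (k q)).comp (hk' q)
  · have : (fun p : unitInterval × TangentBundle (𝓡 2) Sphere2 =>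
        tangentMap (𝓡 2) 𝓘(ℝ, Space) (H p.1 ∘ k) p.2) =
        fun p => tangentMap (𝓡 2) 𝓘(ℝ, Space) (H p.1) (tangentMap (𝓡 2) (𝓡 2) k p.2) := by
      funext p
      rw [tangentMap_comp ((Hi p.1).1.mdifferentiable one_ne_zero)
        (hk.mdifferentiable one_ne_zero)]
      rfl
    rw [this]
    exact Hc.comp (continuous_fst.prodMk ((hk.continuous_tangentMap le_rfl).comp continuous_snd))

/-! ### Retraction, extension and smoothing of maps on the sphere. -/

theorem contMDiffAt_retract {n : ℕ∞ω} {N : Space → Sphere2} (hN : ∀ p, p ≠ 0 → (N p : Space) = ‖p‖⁻¹ • p) {p : Space}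
    (hp : p ≠ 0) : ContMDiffAt 𝓘(ℝ, Space) (𝓡 2) n N p := by
  -- The punctured space is treated as an open submanifold, on which the map is smooth everywhere
  -- and can be corestricted to the sphere.
  let U : TopologicalSpace.Opens Space := ⟨{0}ᶜ, isOpen_compl_singleton⟩
  have h1 : ContMDiff 𝓘(ℝ, Space) 𝓘(ℝ, Space) n (fun x : U => (N (x : Space) : Space)) := by
    intro x
    have hx : (x : Space) ≠ 0 := x.2
    have : ContMDiffAt 𝓘(ℝ, Space) 𝓘(ℝ, Space) n (fun x : Space => (N x : Space)) x := by
      have : ContDiffAt ℝ n (fun p : Space => ‖p‖⁻¹ • p) x :=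
        ((contDiffAt_norm ℝ hx).inv (norm_ne_zero_iff.2 hx)).smul contDiffAt_id
      refine (this.congr_of_eventuallyEq ?_).contMDiffAt
      filter_upwards [isOpen_ne.mem_nhds hx] with y hy using hN y hy
    exact contMDiffAt_subtype_iff.2 this
  have h2 : ContMDiff 𝓘(ℝ, Space) (𝓡 2) n (fun x : U => N (x : Space)) :=
    ContMDiff.codRestrict_sphere (n := 2) (E := Space) h1 (fun x => (N x).2)
  exact contMDiffAt_subtype_iff.1 (h2 (⟨p, hp⟩ : U))

/-- The radial retraction onto the unit sphere (with a junk value at the origin). -/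
def retract (p : Space) : Sphere2 :=
  if hp : p = 0 then ⟨EuclideanSpace.single 0 1, by simp⟩
  else ⟨‖p‖⁻¹ • p, by simp [norm_smul, hp]⟩

theorem coe_retract {p : Space} (hp : p ≠ 0) : (retract p : Space) = ‖p‖⁻¹ • p := by
  simp [retract, hp]

theorem retract_coe (q : Sphere2) : retract (q : Space) = q := by
  ext1; rw [coe_retract (coe_sphere2_ne_zero q), norm_coe_sphere2]; simp

theorem contMDiffAt_retract' {n : ℕ∞ω} {p : Space} (hp : p ≠ 0) :
    ContMDiffAt 𝓘(ℝ, Space) (𝓡 2) n retract p := contMDiffAt_retract (fun _ => coe_retract) hp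

open MeasureTheory in
/-- `C^1` maps with compact support are approximated by smooth maps, uniformly in the
derivative. -/
theorem exists_contDiff_fderiv_near {F : Space → Space} (hF : ContDiff ℝ 1 F)
    (hc : HasCompactSupport F) {ε : ℝ} (hε : 0 < ε) :
    ∃ G : Space → Space, ContDiff ℝ ∞ G ∧ ∀ p, ‖fderiv ℝ G p - fderiv ℝ F p‖ ≤ ε := by
  have hcont : Continuous (fderiv ℝ F) := hF.continuous_fderiv one_ne_zero
  have huc : UniformContinuous (fderiv ℝ F) :=
    (hc.fderiv ℝ).uniformContinuous_of_continuous hcont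
  obtain ⟨δ, hδ, hδ'⟩ := Metric.uniformContinuous_iff.1 huc ε hε
  -- The derivative of the mollification is the mollified derivative, an average over balls of
  -- radius `δ`, on which the derivative oscillates by less than `ε`.
  let φ : ContDiffBump (0 : Space) := ⟨δ / 2, δ, by positivity, by linarith⟩
  have hφ : LocallyIntegrable (φ.normed volume) (volume : Measure Space) :=
    φ.continuous_normed.locallyIntegrable
  refine ⟨convolution (φ.normed volume) F (ContinuousLinearMap.lsmul ℝ ℝ) volume, ?_, fun p => ?_⟩
  · exact φ.hasCompactSupport_normed.contDiff_convolution_left _ φ.contDiff_normed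
      hF.continuous.locallyIntegrable
  · have h1 := (hc.hasFDerivAt_convolution_right (ContinuousLinearMap.lsmul ℝ ℝ) hφ hF p).fderiv
    have h2 : (ContinuousLinearMap.lsmul ℝ ℝ : ℝ →L[ℝ] Space →L[ℝ] Space).precompR Space =
        (ContinuousLinearMap.lsmul ℝ ℝ : ℝ →L[ℝ] (Space →L[ℝ] Space) →L[ℝ] _) := by
      ext; simp
    rw [h1, h2, ← dist_eq_norm]
    refine φ.dist_normed_convolution_le hcont.aestronglyMeasurable fun x hx => ?_
    exact (hδ' hx).le

/-- A `C^1` map on the unit sphere extends to a compactly supported `C^1` map. -/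
theorem exists_extension {f : Sphere2 → Space} (hf : ContMDiff (𝓡 2) 𝓘(ℝ, Space) 1 f) :
    ∃ F : Space → Space, ContDiff ℝ 1 F ∧ HasCompactSupport F ∧ ∀ q : Sphere2, F q = f q := by
  -- A cutoff in the squared norm: it equals `1` on the sphere and vanishes near the origin, where
  -- `retract` has a junk value, as well as far out.
  let χ : ContDiffBump (1 : ℝ) := ⟨1 / 4, 1 / 2, by norm_num, by norm_num⟩
  have hχ : ContDiff ℝ 1 fun p : Space => χ (‖p‖ ^ 2) := χ.contDiff.comp (contDiff_norm_sq ℝ)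
  have hz : ∀ p : Space, ¬ (1 / 2 < ‖p‖ ^ 2 ∧ ‖p‖ ^ 2 < 3 / 2) → χ (‖p‖ ^ 2) = 0 := by
    intro p hp
    apply χ.zero_of_le_dist
    change 1 / 2 ≤ _
    rw [Real.dist_eq]
    by_contra! h
    rw [abs_lt] at h
    exact hp ⟨by linarith, by linarith⟩
  refine ⟨fun p => χ (‖p‖ ^ 2) • f (retract p), ?_, ?_, fun q => ?_⟩
  · rw [contDiff_iff_contDiffAt]
    intro p
    by_cases hp : p = 0
    · have : (fun p => χ (‖p‖ ^ 2) • f (retract p)) =ᶠ[𝓝 p] fun _ => 0 := by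
        have : ball (0 : Space) (1 / 2) ∈ 𝓝 p := by rw [hp]; exact ball_mem_nhds _ (by norm_num)
        filter_upwards [this] with x hx
        rw [hz x, zero_smul]
        rw [mem_ball_zero_iff] at hx
        intro h
        nlinarith [norm_nonneg x]
      exact contDiffAt_const.congr_of_eventuallyEq this
    · exact hχ.contDiffAt.smul (contMDiffAt_iff_contDiffAt.1
        ((hf _).comp p (contMDiffAt_retract' hp)))
  · refine HasCompactSupport.intro (isCompact_closedBall (0 : Space) 2) fun p hp => ?_
    rw [hz p, zero_smul]
    intro h
    rw [mem_closedBall_zero_iff] at hp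
    nlinarith
  · have : χ (‖(q : Space)‖ ^ 2) = 1 := by
      rw [norm_coe_sphere2, one_pow]
      exact χ.one_of_mem_closedBall (mem_closedBall_self χ.rIn_pos.le)
    simp only [this, one_smul, retract_coe]

theorem contMDiff_coe_comp {h : Sphere2 → Sphere2} (hh : ContMDiff (𝓡 2) (𝓡 2) 1 h) :
    ContMDiff (𝓡 2) 𝓘(ℝ, Space) 1 fun q => (h q : Space) :=
  ContMDiff.comp (contMDiff_coe_sphere (n := 2) (E := Space)) hh

/-- The composition of a `C^1` diffeomorphism of the sphere with a linear isomorphism is regularly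
homotopic to a smooth embedding. -/
theorem exists_smoothSphereEmbedding {h k : Sphere2 → Sphere2}
    (hh : ContMDiff (𝓡 2) (𝓡 2) 1 h) (hk : ContMDiff (𝓡 2) (𝓡 2) 1 k) (hkh : ∀ q, k (h q) = q)
    (L : Space →L[ℝ] Space) (hL : Function.Injective L) :
    ∃ g : Sphere2 → Space, IsSmoothSphereEmbedding g ∧
      RegularlyHomotopic (fun q => L (h q)) g := by
  obtain ⟨F, hF, hFc, hFh⟩ := exists_extension (contMDiff_coe_comp hh)
  obtain ⟨K, hK, hKc, hKk⟩ := exists_extension (contMDiff_coe_comp hk)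
  obtain ⟨C, hC⟩ := hK.lipschitzWith_of_hasCompactSupport hKc one_ne_zero
  have hKF : ∀ q : Sphere2, K (F q) = q := fun q => by rw [hFh, hKk, hkh]
  have dF := hF.differentiable one_ne_zero
  have dK := hK.differentiable one_ne_zero
  -- Since `K ∘ F` is the identity on the sphere and `K` is `C`-Lipschitz, `F` shrinks chords and
  -- tangent vectors at most by the factor `C`. A perturbation with Lipschitz constant `ε` and `C *
  -- ε < 1` keeps both estimates nondegenerate.
  set ε : ℝ := 1 / (2 * (C + 1)) with hε
  have hε0 : 0 < ε := by positivity
  have hCε : C * ε < 1 := by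
    rw [hε, mul_one_div, div_lt_one (by positivity)]
    have := C.2
    change (0 : ℝ) ≤ C at this
    linarith
  obtain ⟨G, hG, hGF⟩ := exists_contDiff_fderiv_near hF hFc hε0
  have dG : Differentiable ℝ G := hG.differentiable (by simp)
  have hC0 : (0 : ℝ) ≤ C := C.2
  have tang : ∀ q : Sphere2, ∀ d : Space, inner ℝ (q : Space) d = 0 →
      ‖d‖ ≤ C * ‖fderiv ℝ F q d‖ := by
    intro q d hd
    obtain ⟨v, rfl⟩ := (range_sphereIncl q d).2 hd
    have h1 := mfderiv_comp_coe (F := K ∘ F) (q := q) ((dK _).comp _ (dF _)) v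
    have h2 : (fun q : Sphere2 => (K ∘ F) q) = ((↑) : Sphere2 → Space) := funext hKF
    rw [h2, fderiv_comp _ (dK _) (dF _)] at h1
    have h3 : sphereIncl q v = fderiv ℝ K (F q) (fderiv ℝ F q (sphereIncl q v)) := h1
    calc ‖sphereIncl q v‖ = ‖fderiv ℝ K (F q) (fderiv ℝ F q (sphereIncl q v))‖ := by rw [← h3]
      _ ≤ _ := (fderiv ℝ K (F q)).le_of_opNorm_le (norm_fderiv_le_of_lipschitz ℝ hC) _
  have near : ∀ p q : Space, ‖(G p - F p) - (G q - F q)‖ ≤ ε * ‖p - q‖ := by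
    intro p q
    refine Convex.norm_image_sub_le_of_norm_fderiv_le (f := fun p => G p - F p) (s := univ)
      (fun x _ => (dG x).sub (dF x)) (fun x _ => ?_) convex_univ (mem_univ q) (mem_univ p)
    rw [fderiv_fun_sub (dG x) (dF x)]
    exact hGF x
  have hinj : ∀ t ∈ Icc (0 : ℝ) 1,
      InjOnTangents fun p => L.comp (fderiv ℝ F p + t • (fderiv ℝ G p - fderiv ℝ F p)) := by
    intro t ht q hq d hd h0
    have h1 := (injective_iff_map_eq_zero L).1 hL _ h0
    by_contra hne
    have hd0 : 0 < ‖d‖ := norm_pos_iff.2 hne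
    have h2 : fderiv ℝ F q d = - (t • (fderiv ℝ G q - fderiv ℝ F q) d) :=
      eq_neg_of_add_eq_zero_left h1
    have h3 := tang ⟨q, hq⟩ d hd
    have h4 : ‖fderiv ℝ F q d‖ ≤ ε * ‖d‖ := by
      rw [h2, norm_neg, norm_smul, Real.norm_of_nonneg ht.1]
      have := (fderiv ℝ G q - fderiv ℝ F q).le_of_opNorm_le (hGF q) d
      nlinarith [ht.2, norm_nonneg ((fderiv ℝ G q - fderiv ℝ F q) d)]
    have h5 : C * ‖fderiv ℝ F q d‖ ≤ C * (ε * ‖d‖) := mul_le_mul_of_nonneg_left h4 hC0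
    have h6 : C * (ε * ‖d‖) < ‖d‖ := by nlinarith
    exact absurd (h3.trans h5) (not_le.2 h6)
  have hfam : IsImmersionFamily (fun t p => L (F p + t • (G p - F p)))
      (fun t p => L.comp (fderiv ℝ F p + t • (fderiv ℝ G p - fderiv ℝ F p))) := by
    have cF := hF.continuous_fderiv one_ne_zero
    have cG := hG.continuous_fderiv (by simp)
    have cF0 := hF.continuous
    have cG0 := hG.continuous
    refine ⟨fun t _ p => ?_, fun t _ => ?_, ?_, ?_, hinj⟩
    · exact L.hasFDerivAt.comp p ((dF p).hasFDerivAt.add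
        (((dG p).hasFDerivAt.sub (dF p).hasFDerivAt).const_smul t))
    · fun_prop
    · apply Continuous.continuousOn
      simp only [Function.uncurry_def]
      fun_prop
    · apply Continuous.continuousOn
      simp only [Function.uncurry_def]
      fun_prop
  have e1 : ∀ p, F p + (1 : ℝ) • (G p - F p) = G p := fun p => by simp
  have e0 : ∀ p, F p + (0 : ℝ) • (G p - F p) = F p := fun p => by simp
  have hhom := hfam.regularlyHomotopic
  have hhom' : RegularlyHomotopic (fun q => L (h q)) fun q => L (G q) := by
    convert hhom using 2 with q q
    · rw [e0, hFh]
    · rw [e1]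
  have hLG : ContDiff ℝ ∞ fun p => L (G p) := L.contDiff.comp hG
  refine ⟨fun q => L (G q), ⟨isSphereImmersion_comp_coe hLG (by simp) ?_, ?_⟩, hhom'⟩
  · have := hinj 1 (by simp)
    have e : (fun p => L.comp (fderiv ℝ F p + (1 : ℝ) • (fderiv ℝ G p - fderiv ℝ F p))) =
        fderiv ℝ fun p => L (G p) := by
      funext p
      have hd : HasFDerivAt (fun p => L (G p)) _ p := L.hasFDerivAt.comp p (dG p).hasFDerivAt
      rw [hd.fderiv, one_smul, add_sub_cancel]
    rwa [e] at this
  -- If `G p = G q`, then `F p - F q` has norm at most `ε * ‖p - q‖`, while the Lipschitz bound for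
  -- `K` gives `‖p - q‖ ≤ C * ‖F p - F q‖`.
  · refine (Continuous.isClosedEmbedding (hLG.continuous.comp continuous_subtype_val)
      fun p q hpq => ?_).isEmbedding
    have h1 : G p = G q := hL hpq
    have h2 := near p q
    have h3 : ‖(p : Space) - q‖ ≤ C * ‖F p - F q‖ := by
      have := hC.norm_sub_le (F p) (F q)
      rwa [hKF, hKF] at this
    have h4 : ‖F p - F q‖ ≤ ε * ‖(p : Space) - q‖ := by
      rw [h1] at h2
      have : G q - F p - (G q - F q) = -(F p - F q) := by abel
      rwa [this, norm_neg] at h2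
    have h5 : ‖(p : Space) - q‖ ≤ (C * ε) * ‖(p : Space) - q‖ := by
      rw [mul_assoc]; exact h3.trans (mul_le_mul_of_nonneg_left h4 hC0)
    have h6 : ‖(p : Space) - q‖ = 0 := by nlinarith [norm_nonneg ((p : Space) - q)]
    exact Subtype.ext (sub_eq_zero.1 (norm_eq_zero.1 h6))

/-! ### Local inverses and regularity of reparametrizations. -/

/-- A `C^1` immersion of the sphere has local `C^1` left inverses. -/
theorem IsSphereImmersion.exists_local_leftInverse {f : Sphere2 → Space}
    (hf : IsSphereImmersion 1 f) (q₀ : Sphere2) :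
    ∃ Ψ : Space → Space, ContDiffAt ℝ 1 Ψ (f q₀) ∧ ∀ᶠ q in 𝓝 q₀, Ψ (f q) = q := by
  obtain ⟨F, hF, -, hFf⟩ := exists_extension hf.1
  have dF := hF.differentiable one_ne_zero
  have hinj : ∀ d : Space, inner ℝ (q₀ : Space) d = 0 → fderiv ℝ F q₀ d = 0 → d = 0 := by
    intro d hd h0
    obtain ⟨v, rfl⟩ := (range_sphereIncl q₀ d).2 hd
    rw [← mfderiv_comp_coe (dF _)] at h0
    have h1 : (fun q : Sphere2 => F q) = f := funext hFf
    rw [h1] at h0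
    rw [(injective_iff_map_eq_zero _).1 (hf.2 q₀) v h0, map_zero]
  -- The image of the tangent plane has dimension at most two, so some vector `u` lies outside it.
  let W : Submodule ℝ Space := ((ℝ ∙ (q₀ : Space))ᗮ).map (fderiv ℝ F q₀ : Space →ₗ[ℝ] Space)
  have hW : W ≠ ⊤ := by
    intro h
    have h1 : Module.finrank ℝ W ≤ Module.finrank ℝ ((ℝ ∙ (q₀ : Space))ᗮ : Submodule ℝ Space) :=
      Submodule.finrank_map_le _ _
    rw [h, finrank_top, Submodule.finrank_orthogonal_span_singleton (n := 2)
      (coe_sphere2_ne_zero q₀)] at h1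
    simp at h1
  obtain ⟨u, -, hu⟩ := SetLike.exists_of_lt (lt_top_iff_ne_top.2 hW)
  -- The factor `‖p‖ ^ 2 - 1` vanishes on the sphere and has derivative `2` along `q₀`; this `v`
  -- makes the derivative of `E` send `q₀` to `u`. So `E` extends `f` and has an invertible
  -- derivative at `q₀`.
  let v : Space := (1 / 2 : ℝ) • (u - fderiv ℝ F q₀ q₀)
  let E : Space → Space := fun p => F p + (‖p‖ ^ 2 - 1) • v
  have hE : ContDiff ℝ 1 E := hF.add (((contDiff_norm_sq ℝ).sub contDiff_const).smul contDiff_const)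
  have hE' : HasFDerivAt E (fderiv ℝ F q₀ + (2 • innerSL ℝ (q₀ : Space)).smulRight v) q₀ :=
    (dF _).hasFDerivAt.add
      (((hasStrictFDerivAt_norm_sq (q₀ : Space)).hasFDerivAt.sub_const 1).smul_const v)
  set E' := fderiv ℝ F q₀ + (2 • innerSL ℝ (q₀ : Space)).smulRight v with hE'def
  have hE'inj : Function.Injective E' := by
    rw [injective_iff_map_eq_zero]
    intro d hd
    set a := inner ℝ (q₀ : Space) d with ha
    have hqq : inner ℝ (q₀ : Space) (q₀ : Space) = (1 : ℝ) := by
      rw [real_inner_self_eq_norm_sq, norm_coe_sphere2, one_pow]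
    have hperp : inner ℝ (q₀ : Space) (d - a • (q₀ : Space)) = 0 := by
      rw [inner_sub_right, inner_smul_right, hqq, ← ha]; ring
    have h1 : a • u + fderiv ℝ F q₀ (d - a • (q₀ : Space)) = 0 := by
      refine Eq.trans ?_ hd
      simp only [hE'def, v, add_apply, ContinuousLinearMap.smulRight_apply,
        smul_apply, innerSL_apply_apply, map_sub, map_smul, ← ha]
      module
    have ha0 : a = 0 := by
      by_contra hne
      apply hu
      have h2 : u = fderiv ℝ F q₀ (-(a⁻¹ • (d - a • (q₀ : Space)))) := by
        rw [map_neg, map_smul, eq_neg_of_add_eq_zero_right h1, smul_neg, neg_neg, smul_smul,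
          inv_mul_cancel₀ hne, one_smul]
      rw [h2]
      exact Submodule.mem_map_of_mem (Submodule.mem_orthogonal_singleton_iff_inner_right.2 (by
        rw [inner_neg_right, inner_smul_right, hperp]; simp))
    rw [ha0, zero_smul, zero_smul, zero_add, sub_zero] at h1
    exact hinj d (ha0 ▸ ha.symm) h1
  let e : Space ≃L[ℝ] Space := (LinearEquiv.ofInjectiveEndo (E' : Space →ₗ[ℝ] Space)
    hE'inj).toContinuousLinearEquiv
  have he : HasFDerivAt E (e : Space →L[ℝ] Space) q₀ := hE'
  have hEq : E q₀ = f q₀ := by simp [E, hFf]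
  refine ⟨hE.contDiffAt.localInverse he one_ne_zero, ?_, ?_⟩
  · rw [← hEq]
    exact hE.contDiffAt.to_localInverse he one_ne_zero
  · have := (hE.contDiffAt.hasStrictFDerivAt' he one_ne_zero).eventually_left_inverse
    have h2 := (continuous_subtype_val.tendsto q₀).eventually this
    filter_upwards [h2] with q hq
    have : E q = f q := by simp [E, hFf]
    rw [← this]
    exact hq

theorem contMDiff_sphere_of_coe {h : Sphere2 → Sphere2}
    (hh : ContMDiff (𝓡 2) 𝓘(ℝ, Space) 1 fun q => (h q : Space)) : ContMDiff (𝓡 2) (𝓡 2) 1 h :=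
  ContMDiff.codRestrict_sphere (n := 2) (E := Space) hh (fun x => (h x).2)

/-- A continuous reparametrization between two `C^1` immersed spheres is `C^1`. -/
theorem contMDiff_of_comp_eq {f f' : Sphere2 → Space} (hf : IsSphereImmersion 1 f)
    (hf' : IsSphereImmersion 1 f') {h : Sphere2 → Sphere2} (hc : Continuous h)
    (hh : ∀ q, f' (h q) = f q) : ContMDiff (𝓡 2) (𝓡 2) 1 h := by
  apply contMDiff_sphere_of_coe
  intro q
  obtain ⟨Ψ, hΨ, hl⟩ := hf'.exists_local_leftInverse (h q)
  rw [hh] at hΨ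
  refine (hΨ.comp_contMDiffAt (hf.1 q)).congr_of_eventuallyEq ?_
  filter_upwards [hc.continuousAt.eventually hl] with p hp
  rw [Function.comp_apply, ← hh p, hp]

/-- If `f ∘ c` is an immersion of an open disc, then the continuous map `c` into the sphere is
open. -/
theorem isOpen_image_ball {f : Sphere2 → Space} (hf : IsSphereImmersion 1 f) {c : Plane → Sphere2}
    {g : Plane → Space} (hc : ContinuousOn c (ball 0 1))
    (hg : ContDiffOn ℝ 1 g (ball 0 1)) (hg' : ∀ x ∈ ball (0 : Plane) 1,
      Function.Injective (fderiv ℝ g x)) (hfc : ∀ x ∈ ball (0 : Plane) 1, f (c x) = g x) :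
    IsOpen (c '' ball 0 1) := by
  rw [isOpen_iff_mem_nhds]
  rintro _ ⟨x, hx, rfl⟩
  have hB : ball (0 : Plane) 1 ∈ 𝓝 x := isOpen_ball.mem_nhds hx
  have hcx : ContinuousAt c x := hc.continuousAt hB
  obtain ⟨Ψ, hΨ, hl⟩ := hf.exists_local_leftInverse (c x)
  -- Near `x` the map `c` equals `Ψ ∘ g`, which upgrades its continuity to `C^1`.
  have hcoe : ContMDiffAt 𝓘(ℝ, Plane) 𝓘(ℝ, Space) 1 (fun y => (c y : Space)) x := by
    rw [hfc x hx] at hΨ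
    refine ((hΨ.comp x (hg.contDiffAt hB)).congr_of_eventuallyEq ?_).contMDiffAt
    filter_upwards [hcx.eventually hl, hB] with y hy hyB
    rw [Function.comp_apply, ← hfc y hyB, hy]
  have hcM : ContMDiffAt 𝓘(ℝ, Plane) (𝓡 2) 1 c x := by
    have h1 := (contMDiffAt_retract' (n := 1) (coe_sphere2_ne_zero (c x))).comp x hcoe
    refine h1.congr_of_eventuallyEq (Filter.Eventually.of_forall fun y => ?_)
    rw [Function.comp_apply, retract_coe]
  let φ := chartAt (EuclideanSpace ℝ (Fin 2)) (c x)
  have hφ : ContMDiffAt (𝓡 2) 𝓘(ℝ, Plane) 1 φ (c x) :=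
    contMDiffAt_of_mem_maximalAtlas (IsManifold.chart_mem_maximalAtlas _) (mem_chart_source _ _)
  have hφs : ContMDiffAt 𝓘(ℝ, Plane) (𝓡 2) 1 φ.symm (φ (c x)) :=
    contMDiffAt_symm_of_mem_maximalAtlas (IsManifold.chart_mem_maximalAtlas _) (mem_chart_target _ _)
  have h1 : ContDiffAt ℝ 1 (φ ∘ c) x := contMDiffAt_iff_contDiffAt.1 (hφ.comp x hcM)
  have hsrc : ∀ᶠ y in 𝓝 x, c y ∈ φ.source :=
    hcx.eventually (φ.open_source.mem_nhds (mem_chart_source _ _))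
  have hleft : φ.symm (φ (c x)) = c x := φ.left_inv (mem_chart_source _ _)
  have h2 : ContDiffAt ℝ 1 (f ∘ φ.symm) (φ (c x)) := by
    apply contMDiffAt_iff_contDiffAt.1
    exact ContMDiffAt.comp _ (hf.1 _) hφs
  have h3 : (f ∘ φ.symm) ∘ (φ ∘ c) =ᶠ[𝓝 x] g := by
    filter_upwards [hsrc, hB] with y hy hyB
    simp only [Function.comp_apply, φ.left_inv hy, hfc y hyB]
  -- The injective derivative of `g` factors through that of `c` in a chart. The latter is then
  -- injective between planes, hence invertible, and the inverse function theorem applies.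
  have h4 : fderiv ℝ g x = (fderiv ℝ (f ∘ φ.symm) (φ (c x))).comp (fderiv ℝ (φ ∘ c) x) := by
    rw [← h3.fderiv_eq]
    exact fderiv_comp x (h2.differentiableAt one_ne_zero) (h1.differentiableAt one_ne_zero)
  have h5 : Function.Injective (fderiv ℝ (φ ∘ c) x) := by
    have := hg' x hx
    rw [h4] at this
    exact Function.Injective.of_comp this
  let e : Plane ≃L[ℝ] Plane := (LinearEquiv.ofInjectiveEndo
    (fderiv ℝ (φ ∘ c) x : Plane →ₗ[ℝ] Plane) h5).toContinuousLinearEquiv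
  have h6 : HasFDerivAt (φ ∘ c) (e : Plane →L[ℝ] Plane) x :=
    (h1.differentiableAt one_ne_zero).hasFDerivAt
  have h7 := (h1.hasStrictFDerivAt' h6 one_ne_zero).map_nhds_eq_of_equiv
  have h8 : Filter.map c (𝓝 x) = 𝓝 (c x) := by
    have h9 : c =ᶠ[𝓝 x] φ.symm ∘ (φ ∘ c) := by
      filter_upwards [hsrc] with y hy
      simp only [Function.comp_apply, φ.left_inv hy]
    rw [Filter.map_congr h9, ← Filter.map_map, h7]
    exact φ.symm_map_nhds_eq (mem_chart_source _ _)
  rw [← h8]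
  exact Filter.image_mem_map hB

/-! ### Uniqueness of the parametrization of a glued sphere. -/

/-- The sphere is divided into two discs and the annulus between them, on which `f` is given by
`g₁`, by `g₂`, and is a bijection onto `N`. -/
structure IsGlued (g₁ g₂ : Plane → Space) (N : Set Space) (f : Sphere2 → Space)
    (c₁ c₂ : Plane → Sphere2) : Prop where
  immersion : IsSphereImmersion 1 f
  cont₁ : ContinuousOn c₁ (closedBall 0 1)
  inj₁ : InjOn c₁ (closedBall 0 1)
  cont₂ : ContinuousOn c₂ (closedBall 0 1)
  inj₂ : InjOn c₂ (closedBall 0 1)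
  disj : Disjoint (c₁ '' closedBall 0 1) (c₂ '' closedBall 0 1)
  eq₁ : ∀ x ∈ closedBall (0 : Plane) 1, f (c₁ x) = g₁ x
  eq₂ : ∀ x ∈ closedBall (0 : Plane) 1, f (c₂ x) = g₂ x
  bij : BijOn f (c₁ '' ball 0 1 ∪ c₂ '' ball 0 1)ᶜ N

/-- A continuous map from a compact set to a Hausdorff space is a quotient map onto its image, so
continuity can be tested upstairs. -/
theorem continuousOn_image_of_comp {X Y Z : Type*} [TopologicalSpace X] [TopologicalSpace Y]
    [T2Space Y] [TopologicalSpace Z] {c : X → Y} {h : Y → Z} {D : Set X} (hD : IsCompact D)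
    (hc : ContinuousOn c D) (hh : ContinuousOn (h ∘ c) D) : ContinuousOn h (c '' D) := by
  rw [continuousOn_iff_isClosed]
  intro t ht
  obtain ⟨u, hu, hut⟩ := continuousOn_iff_isClosed.1 hh t ht
  refine ⟨c '' (u ∩ D), ((hD.inter_left hu).image_of_continuousOn
    (hc.mono inter_subset_right)).isClosed, ?_⟩
  rw [← hut]
  ext y
  constructor
  · rintro ⟨hy, x, hx, rfl⟩
    exact ⟨⟨x, ⟨hy, hx⟩, rfl⟩, x, hx, rfl⟩
  · rintro ⟨⟨x, ⟨hx1, hx⟩, rfl⟩, -⟩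
    exact ⟨hx1, x, hx, rfl⟩

/-- On a compact set the injective map `f'` is a homeomorphism onto its image, and `h` is its
inverse composed with `f`. -/
theorem continuousOn_of_comp_eq {X Y Z : Type*} [TopologicalSpace X] [TopologicalSpace Y]
    [TopologicalSpace Z] [T2Space Z] {f : X → Z} {f' : Y → Z} {h : X → Y} {A : Set X} {A' : Set Y}
    (hA' : IsCompact A') (hf : ContinuousOn f A) (hf' : ContinuousOn f' A') (hinj : InjOn f' A')
    (hm : MapsTo h A A') (heq : ∀ x ∈ A, f' (h x) = f x) : ContinuousOn h A := by
  rw [continuousOn_iff_isClosed]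
  intro t ht
  have h1 : IsClosed (f' '' (A' ∩ t)) :=
    ((hA'.inter_right ht).image_of_continuousOn (hf'.mono inter_subset_left)).isClosed
  obtain ⟨u, hu, hut⟩ := continuousOn_iff_isClosed.1 hf _ h1
  refine ⟨u, hu, ?_⟩
  rw [← hut]
  ext x
  constructor
  · rintro ⟨hx, hxA⟩
    exact ⟨⟨h x, ⟨hm hxA, hx⟩, heq x hxA⟩, hxA⟩
  · rintro ⟨⟨y, ⟨hy, hyt⟩, hyx⟩, hxA⟩
    have : y = h x := hinj hy (hm hxA) (by rw [hyx, heq x hxA])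
    exact ⟨show h x ∈ t from this ▸ hyt, hxA⟩

namespace IsGlued

variable {g₁ g₂ : Plane → Space} {N : Set Space} {f f' : Sphere2 → Space}
  {c₁ c₂ c₁' c₂' : Plane → Sphere2}

theorem mem_annulus₁ (H : IsGlued g₁ g₂ N f c₁ c₂) {x : Plane} (hx : x ∈ closedBall (0 : Plane) 1)
    (hx' : x ∉ ball (0 : Plane) 1) : c₁ x ∈ (c₁ '' ball 0 1 ∪ c₂ '' ball 0 1)ᶜ := by
  rintro (⟨y, hy, hyx⟩ | ⟨y, hy, hyx⟩)
  · exact hx' (H.inj₁ (ball_subset_closedBall hy) hx hyx ▸ hy)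
  · exact H.disj.ne_of_mem ⟨x, hx, rfl⟩ ⟨y, ball_subset_closedBall hy, rfl⟩ hyx.symm

theorem mem_annulus₂ (H : IsGlued g₁ g₂ N f c₁ c₂) {x : Plane} (hx : x ∈ closedBall (0 : Plane) 1)
    (hx' : x ∉ ball (0 : Plane) 1) : c₂ x ∈ (c₁ '' ball 0 1 ∪ c₂ '' ball 0 1)ᶜ := by
  rintro (⟨y, hy, hyx⟩ | ⟨y, hy, hyx⟩)
  · exact H.disj.ne_of_mem ⟨y, ball_subset_closedBall hy, rfl⟩ ⟨x, hx, rfl⟩ hyx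
  · exact hx' (H.inj₂ (ball_subset_closedBall hy) hx hyx ▸ hy)

/-- The transition map between two parametrizations of the same glued sphere. -/
theorem exists_map (H : IsGlued g₁ g₂ N f c₁ c₂) (H' : IsGlued g₁ g₂ N f' c₁' c₂') :
    ∃ h : Sphere2 → Sphere2, (∀ x ∈ closedBall (0 : Plane) 1, h (c₁ x) = c₁' x) ∧
      (∀ x ∈ closedBall (0 : Plane) 1, h (c₂ x) = c₂' x) ∧
      ∀ q ∈ (c₁ '' ball 0 1 ∪ c₂ '' ball 0 1)ᶜ,
        h q ∈ (c₁' '' ball 0 1 ∪ c₂' '' ball 0 1)ᶜ ∧ f' (h q) = f q := by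
  classical
  -- The closed discs and the closed annulus overlap in the boundary circles, so the chosen point
  -- must satisfy all prescriptions that apply to `q`. They are compatible because `f` and `f'` are
  -- given by the same maps on the discs.
  have key : ∀ q : Sphere2, ∃ p : Sphere2,
      (∀ x ∈ closedBall (0 : Plane) 1, q = c₁ x → p = c₁' x) ∧
      (∀ x ∈ closedBall (0 : Plane) 1, q = c₂ x → p = c₂' x) ∧
      (q ∈ (c₁ '' ball 0 1 ∪ c₂ '' ball 0 1)ᶜ →
        p ∈ (c₁' '' ball 0 1 ∪ c₂' '' ball 0 1)ᶜ ∧ f' p = f q) := by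
    intro q
    by_cases h1 : q ∈ c₁ '' closedBall 0 1
    · obtain ⟨x, hx, rfl⟩ := h1
      refine ⟨c₁' x, fun y hy hxy => by rw [H.inj₁ hx hy hxy], fun y hy hxy =>
        absurd hxy (H.disj.ne_of_mem ⟨x, hx, rfl⟩ ⟨y, hy, rfl⟩), fun hq =>
        ⟨H'.mem_annulus₁ hx fun hb => hq (Or.inl ⟨x, hb, rfl⟩), by rw [H.eq₁ x hx, H'.eq₁ x hx]⟩⟩
    by_cases h2 : q ∈ c₂ '' closedBall 0 1
    · obtain ⟨x, hx, rfl⟩ := h2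
      refine ⟨c₂' x, fun y hy hxy =>
        absurd hxy.symm (H.disj.ne_of_mem ⟨y, hy, rfl⟩ ⟨x, hx, rfl⟩),
        fun y hy hxy => by rw [H.inj₂ hx hy hxy], fun hq =>
        ⟨H'.mem_annulus₂ hx fun hb => hq (Or.inr ⟨x, hb, rfl⟩), by rw [H.eq₂ x hx, H'.eq₂ x hx]⟩⟩
    have hq : q ∈ (c₁ '' ball 0 1 ∪ c₂ '' ball 0 1)ᶜ := by
      rintro (h | h)
      · exact h1 (image_mono ball_subset_closedBall h)
      · exact h2 (image_mono ball_subset_closedBall h)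
    obtain ⟨p, hp, hpq⟩ := H'.bij.surjOn (H.bij.mapsTo hq)
    exact ⟨p, fun x hx hxq => absurd ⟨x, hx, hxq.symm⟩ h1,
      fun x hx hxq => absurd ⟨x, hx, hxq.symm⟩ h2, fun _ => ⟨hp, hpq⟩⟩
  choose h hh using key
  exact ⟨h, fun x hx => (hh _).1 x hx rfl, fun x hx => (hh _).2.1 x hx rfl,
    fun q hq => (hh q).2.2 hq⟩

theorem cover (q : Sphere2) (c₁ c₂ : Plane → Sphere2) : (∃ x ∈ closedBall (0 : Plane) 1, q = c₁ x) ∨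
    (∃ x ∈ closedBall (0 : Plane) 1, q = c₂ x) ∨ q ∈ (c₁ '' ball 0 1 ∪ c₂ '' ball 0 1)ᶜ := by
  by_cases h1 : q ∈ c₁ '' ball 0 1
  · obtain ⟨x, hx, rfl⟩ := h1
    exact Or.inl ⟨x, ball_subset_closedBall hx, rfl⟩
  by_cases h2 : q ∈ c₂ '' ball 0 1
  · obtain ⟨x, hx, rfl⟩ := h2
    exact Or.inr (Or.inl ⟨x, ball_subset_closedBall hx, rfl⟩)
  exact Or.inr (Or.inr (by rintro (h | h) <;> contradiction))

/-- The sphere is covered by three closed pieces on each of which the transition map is continuous.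
Closedness of the annuli is assumed here; it follows from openness of the images of the open discs.
-/
theorem continuous_map (H : IsGlued g₁ g₂ N f c₁ c₂) (H' : IsGlued g₁ g₂ N f' c₁' c₂')
    (hA : IsClosed (c₁ '' ball 0 1 ∪ c₂ '' ball 0 1)ᶜ)
    (hA' : IsClosed (c₁' '' ball 0 1 ∪ c₂' '' ball 0 1)ᶜ) {h : Sphere2 → Sphere2}
    (h1 : ∀ x ∈ closedBall (0 : Plane) 1, h (c₁ x) = c₁' x)
    (h2 : ∀ x ∈ closedBall (0 : Plane) 1, h (c₂ x) = c₂' x)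
    (h3 : ∀ q ∈ (c₁ '' ball 0 1 ∪ c₂ '' ball 0 1)ᶜ,
        h q ∈ (c₁' '' ball 0 1 ∪ c₂' '' ball 0 1)ᶜ ∧ f' (h q) = f q) : Continuous h := by
  have hD : IsCompact (closedBall (0 : Plane) 1) := isCompact_closedBall _ _
  have k1 : ContinuousOn h (c₁ '' closedBall 0 1) :=
    continuousOn_image_of_comp hD H.cont₁ (H'.cont₁.congr h1)
  have k2 : ContinuousOn h (c₂ '' closedBall 0 1) :=
    continuousOn_image_of_comp hD H.cont₂ (H'.cont₂.congr h2)
  have k3 : ContinuousOn h (c₁ '' ball 0 1 ∪ c₂ '' ball 0 1)ᶜ :=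
    continuousOn_of_comp_eq hA'.isCompact H.immersion.1.continuous.continuousOn
      H'.immersion.1.continuous.continuousOn H'.bij.injOn (fun q hq => (h3 q hq).1)
      fun q hq => (h3 q hq).2
  have e : c₁ '' closedBall 0 1 ∪ (c₂ '' closedBall 0 1 ∪ (c₁ '' ball 0 1 ∪ c₂ '' ball 0 1)ᶜ)
      = univ := by
    refine eq_univ_of_forall fun q => ?_
    rcases cover q c₁ c₂ with ⟨x, hx, rfl⟩ | ⟨x, hx, rfl⟩ | hq
    · exact Or.inl ⟨x, hx, rfl⟩
    · exact Or.inr (Or.inl ⟨x, hx, rfl⟩)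
    · exact Or.inr (Or.inr hq)
  have c1 := (hD.image_of_continuousOn H.cont₁).isClosed
  have c2 := (hD.image_of_continuousOn H.cont₂).isClosed
  rw [← continuousOn_univ, ← e]
  exact k1.union_of_isClosed (k2.union_of_isClosed k3 c2 hA) c1 (c2.union hA)

/-- Two parametrizations of the same glued sphere differ by a `C^1` diffeomorphism. -/
theorem exists_diffeo (H : IsGlued g₁ g₂ N f c₁ c₂) (H' : IsGlued g₁ g₂ N f' c₁' c₂')
    (hg₁ : ContDiffOn ℝ 1 g₁ (ball 0 1))
    (hg₁' : ∀ x ∈ ball (0 : Plane) 1, Function.Injective (fderiv ℝ g₁ x))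
    (hg₂ : ContDiffOn ℝ 1 g₂ (ball 0 1))
    (hg₂' : ∀ x ∈ ball (0 : Plane) 1, Function.Injective (fderiv ℝ g₂ x)) :
    ∃ h k : Sphere2 → Sphere2, ContMDiff (𝓡 2) (𝓡 2) 1 h ∧ ContMDiff (𝓡 2) (𝓡 2) 1 k ∧
      (∀ q, k (h q) = q) ∧ ∀ q, f' (h q) = f q := by
  have closed : ∀ {f : Sphere2 → Space} {c₁ c₂ : Plane → Sphere2}, IsGlued g₁ g₂ N f c₁ c₂ →
      IsClosed (c₁ '' ball 0 1 ∪ c₂ '' ball 0 1)ᶜ := by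
    intro f c₁ c₂ H
    rw [isClosed_compl_iff]
    exact (isOpen_image_ball H.immersion (H.cont₁.mono ball_subset_closedBall) hg₁ hg₁'
      fun x hx => H.eq₁ x (ball_subset_closedBall hx)).union
      (isOpen_image_ball H.immersion (H.cont₂.mono ball_subset_closedBall) hg₂ hg₂'
      fun x hx => H.eq₂ x (ball_subset_closedBall hx))
  obtain ⟨h, h1, h2, h3⟩ := H.exists_map H'
  obtain ⟨k, k1, k2, k3⟩ := H'.exists_map H
  have ch := H.continuous_map H' (closed H) (closed H') h1 h2 h3
  have ck := H'.continuous_map H (closed H') (closed H) k1 k2 k3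
  have eqn : ∀ {f f' : Sphere2 → Space} {c₁ c₂ c₁' c₂' : Plane → Sphere2} {h : Sphere2 → Sphere2},
      IsGlued g₁ g₂ N f c₁ c₂ → IsGlued g₁ g₂ N f' c₁' c₂' →
      (∀ x ∈ closedBall (0 : Plane) 1, h (c₁ x) = c₁' x) →
      (∀ x ∈ closedBall (0 : Plane) 1, h (c₂ x) = c₂' x) →
      (∀ q ∈ (c₁ '' ball 0 1 ∪ c₂ '' ball 0 1)ᶜ,
        h q ∈ (c₁' '' ball 0 1 ∪ c₂' '' ball 0 1)ᶜ ∧ f' (h q) = f q) → ∀ q, f' (h q) = f q := by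
    intro f f' c₁ c₂ c₁' c₂' h H H' h1 h2 h3 q
    rcases cover q c₁ c₂ with ⟨x, hx, rfl⟩ | ⟨x, hx, rfl⟩ | hq
    · rw [h1 x hx, H.eq₁ x hx, H'.eq₁ x hx]
    · rw [h2 x hx, H.eq₂ x hx, H'.eq₂ x hx]
    · exact (h3 q hq).2
  have eh := eqn H H' h1 h2 h3
  have ek := eqn H' H k1 k2 k3
  refine ⟨h, k, contMDiff_of_comp_eq H.immersion H'.immersion ch eh,
    contMDiff_of_comp_eq H'.immersion H.immersion ck ek, fun q => ?_, eh⟩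
  rcases cover q c₁ c₂ with ⟨x, hx, rfl⟩ | ⟨x, hx, rfl⟩ | hq
  · rw [h1 x hx, k1 x hx]
  · rw [h2 x hx, k2 x hx]
  · exact H.bij.injOn (k3 _ (h3 q hq).1).1 hq (by rw [ek, eh])

end IsGlued

/-! ### Coordinates, rotations and normals in space. -/

/-- The horizontal part of a point. -/
def hor : Space →L[ℝ] Plane :=
  LinearMap.toContinuousLinearMap
    { toFun := fun p => !₂[p 0, p 1]
      map_add' := fun p q => by ext i; fin_cases i <;> simp
      map_smul' := fun a p => by ext i; fin_cases i <;> simp }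

/-- The height of a point. -/
def ver : Space →L[ℝ] ℝ := EuclideanSpace.proj 2

/-- The infinitesimal rotation about the `z`-axis. -/
def infRot : Space →L[ℝ] Space :=
  LinearMap.toContinuousLinearMap
    { toFun := fun p => !₂[-p 1, p 0, 0]
      map_add' := fun p q => by ext i; fin_cases i <;> simp; ring
      map_smul' := fun a p => by ext i; fin_cases i <;> simp }

/-- The projection of `Space` to the `z`-axis. -/
def axisProj : Space →L[ℝ] Space :=
  LinearMap.toContinuousLinearMap
    { toFun := fun p => !₂[0, 0, p 2]
      map_add' := fun p q => by ext i; fin_cases i <;> simp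
      map_smul' := fun a p => by ext i; fin_cases i <;> simp }

@[simp] theorem hor_zero_apply (p : Space) : hor p 0 = p 0 := rfl
@[simp] theorem hor_one_apply (p : Space) : hor p 1 = p 1 := rfl
@[simp] theorem ver_apply (p : Space) : ver p = p 2 := rfl
@[simp] theorem infRot_apply (p : Space) : infRot p = !₂[-p 1, p 0, 0] := rfl
@[simp] theorem axisProj_apply (p : Space) : axisProj p = !₂[0, 0, p 2] := rfl

/-- Rotation about the `z`-axis as a continuous linear map. -/
def rotL (a : ℝ) : Space →L[ℝ] Space :=
  Real.cos a • (ContinuousLinearMap.id ℝ Space - axisProj) + Real.sin a • infRot + axisProj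

theorem rotL_apply (a : ℝ) (p : Space) : rotL a p = rotZ a p := by
  ext i
  fin_cases i <;> simp [rotL, rotZ] <;> ring

theorem rotZ_add (a b : ℝ) (p : Space) : rotZ (a + b) p = rotZ a (rotZ b p) := by
  ext i
  fin_cases i <;> simp [rotZ, Real.cos_add, Real.sin_add] <;> ring

theorem rotZ_zero (p : Space) : rotZ 0 p = p := by
  ext i
  fin_cases i <;> simp [rotZ]

theorem rotL_injective (a : ℝ) : Function.Injective (rotL a) := by
  intro p q h
  rw [rotL_apply, rotL_apply] at h
  have := congrArg (rotZ (-a)) h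
  simpa [← rotZ_add, rotZ_zero] using this

theorem hasDerivAt_rotL (a : ℝ) : HasDerivAt rotL ((rotL a).comp infRot) a := by
  have h := (((Real.hasDerivAt_cos a).smul_const (ContinuousLinearMap.id ℝ Space - axisProj)).add
    ((Real.hasDerivAt_sin a).smul_const infRot)).add_const axisProj
  refine h.congr_deriv ?_
  ext p i
  fin_cases i <;> simp [rotL] <;> ring

theorem continuous_rotL : Continuous rotL :=
  continuous_iff_continuousAt.2 fun a => (hasDerivAt_rotL a).continuousAt

theorem inner_eq_hor_add_ver (p q : Space) :
    inner ℝ p q = inner ℝ (hor p) (hor q) + ver p * ver q := by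
  simp [PiLp.inner_apply, Fin.sum_univ_three, Fin.sum_univ_two]
  ring

theorem norm_sq_eq_hor_add_ver (p : Space) : ‖p‖ ^ 2 = ‖hor p‖ ^ 2 + ver p ^ 2 := by
  rw [← real_inner_self_eq_norm_sq, ← real_inner_self_eq_norm_sq, inner_eq_hor_add_ver, sq]

theorem eq_zero_of_hor_ver {p : Space} (h : hor p = 0) (h' : ver p = 0) : p = 0 := by
  have := norm_sq_eq_hor_add_ver p
  rw [h, h'] at this
  simpa using this

/-- The cross product in `Space`. -/
def cross (a b : Space) : Space :=
  !₂[a 1 * b 2 - a 2 * b 1, a 2 * b 0 - a 0 * b 2, a 0 * b 1 - a 1 * b 0]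

theorem inner_cross (a b c : Space) :
    inner ℝ (cross a b) c = Matrix.det (Matrix.of ![(a : Fin 3 → ℝ), b, c]) := by
  simp [cross, PiLp.inner_apply, Fin.sum_univ_three, Matrix.det_fin_three]
  ring

/-- The (unnormalized) normal of the image of an injective linear map. -/
def normalOf (A : Plane →L[ℝ] Space) : Space :=
  cross (A (EuclideanSpace.single 0 1)) (A (EuclideanSpace.single 1 1))

theorem plane_eq (x : Plane) :
    x = x 0 • EuclideanSpace.single 0 (1 : ℝ) + x 1 • EuclideanSpace.single 1 (1 : ℝ) := by
  ext i; fin_cases i <;> simp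

theorem inner_normalOf_apply (A : Plane →L[ℝ] Space) (x : Plane) :
    inner ℝ (normalOf A) (A x) = 0 := by
  rw [plane_eq x, map_add, map_smul, map_smul]
  simp [normalOf, cross, PiLp.inner_apply, Fin.sum_univ_three]
  ring

/-- The inner product is the determinant of `v` with a basis of the range of `A`; if it vanished, a
linear dependence would put `v` in that range. -/
theorem inner_normalOf_ne_zero {A : Plane →L[ℝ] Space} (hA : Function.Injective A) {v : Space}
    (hv : v ∉ Set.range A) : inner ℝ (normalOf A) v ≠ 0 := by
  rw [normalOf, inner_cross]
  intro h
  obtain ⟨c, hc, hc0⟩ := Matrix.exists_vecMul_eq_zero_iff.2 h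
  have hsum : A (!₂[c 0, c 1]) + c 2 • v = 0 := by
    rw [plane_eq !₂[c 0, c 1], map_add, map_smul, map_smul]
    ext i
    have := congrFun hc0 i
    simpa [Matrix.vecMul, dotProduct, Fin.sum_univ_three] using this
  by_cases h2 : c 2 = 0
  · rw [h2, zero_smul, add_zero] at hsum
    have h3 := (injective_iff_map_eq_zero A).1 hA _ hsum
    apply hc
    have h0 := congrArg (fun x : Plane => x 0) h3
    have h1 := congrArg (fun x : Plane => x 1) h3
    ext i
    fin_cases i
    · simpa using h0
    · simpa using h1
    · exact h2
  · apply hv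
    refine ⟨-((c 2)⁻¹ • !₂[c 0, c 1]), ?_⟩
    rw [map_neg, map_smul, eq_neg_of_add_eq_zero_left hsum, smul_neg, neg_neg, smul_smul,
      inv_mul_cancel₀ h2, one_smul]

theorem normalOf_ne_zero {A : Plane →L[ℝ] Space} (hA : Function.Injective A) : normalOf A ≠ 0 := by
  have : ∃ v, v ∉ Set.range A := by
    by_contra! h
    have := LinearMap.finrank_le_finrank_of_injective (f := (LinearEquiv.ofBijective
      (A : Plane →ₗ[ℝ] Space) ⟨hA, h⟩).symm.toLinearMap) (LinearEquiv.injective _)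
    simp at this
  obtain ⟨v, hv⟩ := this
  intro h
  exact inner_normalOf_ne_zero hA hv (by rw [h, inner_zero_left])

theorem continuous_normalOf {X : Type*} [TopologicalSpace X] {A : X → Plane →L[ℝ] Space}
    (hA : Continuous A) : Continuous fun x => normalOf (A x) := by
  unfold normalOf cross
  fun_prop

/-! ### Perturbation criterion and transverse fields. -/

/-- Injectivity on tangent planes for small parameters, from a limit criterion. -/
theorem injOnTangents_of_small {M : ℝ → ℝ → Space → Space →L[ℝ] Space}
    {l : ℝ → ℝ → Space → Space →L[ℝ] ℝ}
    (hM : Continuous fun a : ℝ × ℝ × Space => M a.1 a.2.1 a.2.2)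
    (hl : Continuous fun a : ℝ × ℝ × Space => l a.1 a.2.1 a.2.2)
    (h : ∀ e > 0, ∀ t q d, M e t q d = 0 → l e t q d = 0)
    (h0 : ∀ t ∈ Icc (0 : ℝ) 1, ∀ q ∈ sphere (0 : Space) 1, ∀ d, inner ℝ q d = 0 →
      M 0 t q d = 0 → l 0 t q d = 0 → d = 0) :
    ∀ᶠ e in 𝓝[>] (0 : ℝ), ∀ t ∈ Icc (0 : ℝ) 1, InjOnTangents (M e t) := by
  let C : Set (ℝ × Space × Space) :=
    (Icc (0 : ℝ) 1 ×ˢ (sphere (0 : Space) 1 ×ˢ sphere (0 : Space) 1)) ∩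
      {c | inner ℝ c.2.1 c.2.2 = 0}
  have hC : IsCompact C := by
    refine (isCompact_Icc.prod ((isCompact_sphere _ _).prod (isCompact_sphere _ _))).inter_right ?_
    exact isClosed_eq (by fun_prop) continuous_const
  -- For `e > 0` the functional `l` vanishes on the kernel of `M`, so adding it costs nothing. At `e
  -- = 0`, where `M` alone may degenerate, it makes `Φ` positive on the compact set of times and
  -- unit tangent vectors, hence for all small `e`.
  let Φ : (ℝ × Space × Space) → ℝ → ℝ := fun c e =>
    ‖M e c.1 c.2.1 c.2.2‖ + ‖l e c.1 c.2.1 c.2.2‖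
  have hΦ : Continuous fun p : (ℝ × Space × Space) × ℝ => Φ p.1 p.2 := by
    have k : Continuous fun p : (ℝ × Space × Space) × ℝ => (p.2, p.1.1, p.1.2.1) := by fun_prop
    have k2 : Continuous fun p : (ℝ × Space × Space) × ℝ => p.1.2.2 := by fun_prop
    exact (((hM.comp k).clm_apply k2).norm).add (((hl.comp k).clm_apply k2).norm)
  have ev : ∀ᶠ e in 𝓝 (0 : ℝ), ∀ c ∈ C, 0 < Φ c e := by
    refine hC.eventually_forall_of_forall_eventually fun c hc => ?_
    have pos : 0 < Φ c 0 := by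
      by_contra! hle
      have h1 : M 0 c.1 c.2.1 c.2.2 = 0 := by
        have := norm_nonneg (l 0 c.1 c.2.1 c.2.2)
        exact norm_le_zero_iff.1 (by linarith)
      have h2 : l 0 c.1 c.2.1 c.2.2 = 0 := by
        have := norm_nonneg (M 0 c.1 c.2.1 c.2.2)
        exact norm_le_zero_iff.1 (by linarith)
      have h3 := h0 c.1 hc.1.1 c.2.1 hc.1.2.1 c.2.2 hc.2 h1 h2
      have h4 := hc.1.2.2
      rw [mem_sphere_zero_iff_norm, h3, norm_zero] at h4
      exact zero_ne_one h4
    exact ((hΦ.comp continuous_swap).tendsto ((0 : ℝ), c)).eventually (lt_mem_nhds pos)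
  filter_upwards [self_mem_nhdsWithin, nhdsWithin_le_nhds ev] with e he hev t ht q hq d hd hMd
  by_contra hne
  have hn : ‖d‖ ≠ 0 := norm_ne_zero_iff.2 hne
  have := hev (t, q, ‖d‖⁻¹ • d) ⟨⟨ht, hq, by simp [norm_smul, hn]⟩, by
    change inner ℝ q (‖d‖⁻¹ • d) = 0
    rw [inner_smul_right, hd, mul_zero]⟩
  simp [Φ, hMd, h e he t q d hMd] at this

/-- A smooth vector field that lies on the positive side of a field of normals on the disc. -/
theorem exists_smooth_transverse {N : Plane → Space} (hN : Continuous N)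
    (hN0 : ∀ x ∈ closedBall (0 : Plane) 1, N x ≠ 0) :
    ∃ w : Plane → Space, ContDiff ℝ ∞ w ∧
      ∀ x ∈ closedBall (0 : Plane) 1, 0 < inner ℝ (N x) (w x) := by
  -- The condition on the field is convex, and a nearby normal satisfies it locally as a constant,
  -- so a partition of unity yields a smooth solution.
  have h1 : ∀ x, Convex ℝ {v | x ∈ closedBall (0 : Plane) 1 → 0 < inner ℝ (N x) v} := by
    intro x v hv v' hv' a b ha hb hab hx
    rw [inner_add_right, inner_smul_right, inner_smul_right]
    rcases ha.eq_or_lt with rfl | ha'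
    · rw [zero_add] at hab; subst hab; simpa using hv' hx
    · have := mul_pos ha' (hv hx)
      have := mul_nonneg hb (hv' hx).le
      linarith
  have h2 : ∀ x : Plane, ∃ c : Space, ∀ᶠ y in 𝓝 x,
      c ∈ {v | y ∈ closedBall (0 : Plane) 1 → 0 < inner ℝ (N y) v} := by
    intro x
    by_cases hx : x ∈ closedBall (0 : Plane) 1
    · refine ⟨N x, ?_⟩
      have h1 : 0 < inner ℝ (N x) (N x) := by
        rw [real_inner_self_eq_norm_sq]; have := norm_pos_iff.2 (hN0 x hx); positivity
      have : Continuous fun y => inner ℝ (N y) (N x) := by fun_prop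
      filter_upwards [(this.tendsto x).eventually (lt_mem_nhds h1)] with y hy _ using hy
    · refine ⟨0, ?_⟩
      filter_upwards [isClosed_closedBall.isOpen_compl.mem_nhds hx] with y hy hy'
      exact absurd hy' hy
  obtain ⟨w, hw⟩ := exists_contMDiffMap_forall_mem_convex_of_local_const (n := (⊤ : ℕ∞))
    (I := 𝓘(ℝ, Plane)) h1 h2
  exact ⟨w, w.contMDiff.contDiff, hw⟩

/-! ### Sheared doubles of discs and their deformation to an ellipsoid. -/

/-- An immersed disc `r` together with a height function `h`, such that the double of the disc,
sheared by rotations about the `z`-axis, is an immersed sphere. -/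
structure IsPillow (r : Plane → Space) (r' : Plane → Plane →L[ℝ] Space) (h h' : ℝ → ℝ) : Prop where
  hasFDerivAt : ∀ x, HasFDerivAt r (r' x) x
  cont' : Continuous r'
  hasDerivAt : ∀ z, HasDerivAt h (h' z) z
  cont_h' : Continuous h'
  inj : ∀ x ∈ closedBall (0 : Plane) 1, Function.Injective (r' x)
  shear : ∀ e > 0, ∀ q ∈ sphere (0 : Space) 1, ∀ d, inner ℝ q d = 0 →
    r' (hor q) (hor d) + (e * h' (ver q) * ver d) • infRot (r (hor q)) = 0 → d = 0
  transverse : ∀ x ∈ sphere (0 : Plane) 1, infRot (r x) ∉ Set.range (r' x)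
  pos : 0 < h' 0

theorem norm_hor_le {q : Space} (hq : q ∈ sphere (0 : Space) 1) :
    hor q ∈ closedBall (0 : Plane) 1 := by
  have := norm_sq_eq_hor_add_ver q
  rw [mem_sphere_zero_iff_norm.1 hq] at this
  rw [mem_closedBall_zero_iff]
  nlinarith [sq_nonneg (ver q), norm_nonneg (hor q)]

theorem hor_mem_sphere {q : Space} (hq : q ∈ sphere (0 : Space) 1) (h : ver q = 0) :
    hor q ∈ sphere (0 : Plane) 1 := by
  have := norm_sq_eq_hor_add_ver q
  rw [mem_sphere_zero_iff_norm.1 hq, h] at this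
  rw [mem_sphere_zero_iff_norm]
  nlinarith [norm_nonneg (hor q)]

/-- The derivative of a map rotated by an angle that depends on the point. -/
theorem hasFDerivAt_rotL_comp {E : Type*} [NormedAddCommGroup E] [NormedSpace ℝ E]
    {a : E → ℝ} {a' : E →L[ℝ] ℝ} {s : E → Space} {s' : E →L[ℝ] Space} {p : E}
    (ha : HasFDerivAt a a' p) (hs : HasFDerivAt s s' p) :
    HasFDerivAt (fun p => rotL (a p) (s p))
      ((rotL (a p)).comp (s' + a'.smulRight (infRot (s p)))) p := by
  have h1 := (hasDerivAt_rotL (a p)).hasFDerivAt.comp p ha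
  refine (h1.clm_apply hs).congr_fderiv ?_
  ext1 d
  simp

/-- Regular homotopies made from rotations by an angle that depends on the point. -/
theorem regularlyHomotopic_rotL {a : ℝ × Space → ℝ} {a' : ℝ × Space → Space →L[ℝ] ℝ}
    {s : ℝ × Space → Space} {s' : ℝ × Space → Space →L[ℝ] Space}
    (ha : ∀ t p, HasFDerivAt (fun p => a (t, p)) (a' (t, p)) p)
    (hs : ∀ t p, HasFDerivAt (fun p => s (t, p)) (s' (t, p)) p)
    (ca : Continuous a) (ca' : Continuous a') (cs : Continuous s) (cs' : Continuous s')
    (hinj : ∀ t ∈ Icc (0 : ℝ) 1, ∀ q ∈ sphere (0 : Space) 1, ∀ d, inner ℝ q d = 0 →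
      s' (t, q) d + a' (t, q) d • infRot (s (t, q)) = 0 → d = 0) :
    RegularlyHomotopic (fun q => rotL (a (0, q)) (s (0, q)))
      (fun q => rotL (a (1, q)) (s (1, q))) := by
  have cF : Continuous fun x : ℝ × Space => rotL (a x) (s x) :=
    (continuous_rotL.comp ca).clm_apply cs
  have cF' : Continuous fun x : ℝ × Space =>
      (rotL (a x)).comp (s' x + (a' x).smulRight (infRot (s x))) := by
    refine (continuous_rotL.comp ca).clm_comp (cs'.add ?_)
    exact ((ContinuousLinearMap.smulRightL ℝ Space Space).continuous.comp ca').clm_apply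
      (infRot.continuous.comp cs)
  have key : IsImmersionFamily (fun t p => rotL (a (t, p)) (s (t, p)))
      (fun t p => (rotL (a (t, p))).comp
        (s' (t, p) + (a' (t, p)).smulRight (infRot (s (t, p))))) := by
    refine ⟨fun t _ p => hasFDerivAt_rotL_comp (ha t p) (hs t p), fun t _ => ?_,
      cF.continuousOn, cF'.continuousOn, fun t ht q hq d hd h0 => ?_⟩
    · exact cF'.comp (continuous_const.prodMk continuous_id)
    · have h1 : rotL (a (t, q)) (s' (t, q) d + a' (t, q) d • infRot (s (t, q))) =
          rotL (a (t, q)) 0 := by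
        rw [map_zero]
        exact h0
      exact hinj t ht q hq d hd (rotL_injective _ h1)
  exact key.regularlyHomotopic

namespace IsPillow

variable {r : Plane → Space} {r' : Plane → Plane →L[ℝ] Space} {h h' : ℝ → ℝ}

theorem continuous (H : IsPillow r r' h h') : Continuous r :=
  continuous_iff_continuousAt.2 fun x => (H.hasFDerivAt x).continuousAt

theorem continuous_height (H : IsPillow r r' h h') : Continuous h :=
  continuous_iff_continuousAt.2 fun x => (H.hasDerivAt x).continuousAt

theorem hasFDerivAt_height (H : IsPillow r r' h h') (c : ℝ) (p : Space) :
    HasFDerivAt (fun p : Space => c * h (ver p)) ((c * h' (ver p)) • ver) p := by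
  have := ((H.hasDerivAt (ver p)).comp_hasFDerivAt p ver.hasFDerivAt).const_mul c
  refine this.congr_fderiv ?_
  rw [smul_smul]

/-- Scaling the height function. -/
theorem scale (H : IsPillow r r' h h') {a b : ℝ} (ha : 0 < a) (hb : 0 < b) :
    RegularlyHomotopic (fun q => rotL (a * h (ver q)) (r (hor q)))
      (fun q => rotL (b * h (ver q)) (r (hor q))) := by
  have c1 := H.continuous
  have c2 := H.continuous_height
  have c3 := H.cont'
  have c4 := H.cont_h'
  have hpos : ∀ t ∈ Icc (0 : ℝ) 1, 0 < (1 - t) * a + t * b := by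
    intro t ht
    rcases ht.1.eq_or_lt with rfl | h0
    · simpa using ha
    · have := mul_nonneg (sub_nonneg.2 ht.2) ha.le
      have := mul_pos h0 hb
      linarith
  have := regularlyHomotopic_rotL (a := fun x => ((1 - x.1) * a + x.1 * b) * h (ver x.2))
    (a' := fun x => (((1 - x.1) * a + x.1 * b) * h' (ver x.2)) • ver)
    (s := fun x => r (hor x.2)) (s' := fun x => (r' (hor x.2)).comp hor)
    (fun t p => H.hasFDerivAt_height ((1 - t) * a + t * b) p)
    (fun t p => (H.hasFDerivAt _).comp p hor.hasFDerivAt)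
    (by fun_prop) (by fun_prop) (by fun_prop) (by fun_prop)
    (fun t ht q hq d hd h0 => H.shear _ (hpos t ht) q hq d hd h0)
  simpa using this

/-- A continuous field of normals pointing to the side to which the rotation moves the boundary,
and a smooth vector field on the same side. -/
theorem exists_normal (H : IsPillow r r' h h') : ∃ (N w : Plane → Space), Continuous N ∧
    ContDiff ℝ ∞ w ∧ (∀ x y, inner ℝ (N x) (r' x y) = 0) ∧
    (∀ x ∈ closedBall (0 : Plane) 1, 0 < inner ℝ (N x) (w x)) ∧
    ∀ x ∈ sphere (0 : Plane) 1, 0 < inner ℝ (N x) (infRot (r x)) := by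
  have c1 := H.continuous
  have cN := continuous_normalOf H.cont'
  -- By transversality the pairing of normal and rotation field never vanishes on the connected
  -- boundary circle; `s` corrects its constant sign.
  have main : ∃ s : ℝ, s ≠ 0 ∧ ∀ x ∈ sphere (0 : Plane) 1,
      0 < inner ℝ (s • normalOf (r' x)) (infRot (r x)) := by
    have hne : ∀ x ∈ sphere (0 : Plane) 1, inner ℝ (normalOf (r' x)) (infRot (r x)) ≠ 0 :=
      fun x hx => inner_normalOf_ne_zero (H.inj x (sphere_subset_closedBall hx)) (H.transverse x hx)
    have hcont : ContinuousOn (fun x => inner ℝ (normalOf (r' x)) (infRot (r x)))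
        (sphere (0 : Plane) 1) := by
      apply Continuous.continuousOn
      fun_prop
    have hconn : IsPreconnected (sphere (0 : Plane) 1) := by
      apply isPreconnected_sphere
      rw [← Module.finrank_eq_rank]
      simp
    by_cases hall : ∀ x ∈ sphere (0 : Plane) 1, 0 < inner ℝ (normalOf (r' x)) (infRot (r x))
    · exact ⟨1, one_ne_zero, by simpa using hall⟩
    · push Not at hall
      obtain ⟨x₀, hx₀, hle⟩ := hall
      refine ⟨-1, by norm_num, fun x hx => ?_⟩
      rw [neg_one_smul, inner_neg_left, neg_pos]
      by_contra! hge
      obtain ⟨y, hy, hy0⟩ := hconn.intermediate_value hx₀ hx hcont ⟨hle, hge⟩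
      exact hne y hy hy0
  obtain ⟨s, hs, hpos⟩ := main
  have cN' : Continuous fun x => s • normalOf (r' x) := cN.const_smul s
  obtain ⟨w, hw, hw'⟩ := exists_smooth_transverse cN'
    fun x hx => smul_ne_zero hs (normalOf_ne_zero (H.inj x hx))
  exact ⟨_, w, cN', hw, fun x y => by rw [inner_smul_left, inner_normalOf_apply, mul_zero], hw', hpos⟩

end IsPillow

theorem continuous_smulRight_of {X E : Type*} [TopologicalSpace X] [NormedAddCommGroup E]
    [NormedSpace ℝ E] {a : X → E →L[ℝ] ℝ} {v : X → Space} (ha : Continuous a) (hv : Continuous v) :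
    Continuous fun x => (a x).smulRight (v x) :=
  ((ContinuousLinearMap.smulRightL ℝ E Space).continuous.comp ha).clm_apply hv

/-- The rescalings `x ↦ (r (u x) - r 0) / u` of a `C^1` map, extended continuously to `u = 0`. -/
def rescale (r' : Plane → Plane →L[ℝ] Space) (u : ℝ) (x : Plane) : Space :=
  ∫ s in (0 : ℝ)..1, r' (s • u • x) x

section Rescale

variable {r : Plane → Space} {r' : Plane → Plane →L[ℝ] Space}

theorem continuous_rescale (hc : Continuous r') :
    Continuous fun a : ℝ × Plane => rescale r' a.1 a.2 := by
  refine intervalIntegral.continuous_parametric_intervalIntegral_of_continuous' ?_ 0 1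
  simp only [Function.uncurry_def]
  fun_prop

/-- The fundamental theorem of calculus along the segment from `0` to `u • x`. -/
theorem smul_rescale (hr : ∀ x, HasFDerivAt r (r' x) x) (hc : Continuous r') (u : ℝ) (x : Plane) :
    u • rescale r' u x = r (u • x) - r 0 := by
  have h1 : ∀ s ∈ uIcc (0 : ℝ) 1, HasDerivAt (fun s : ℝ => r (s • u • x)) (u • r' (s • u • x) x) s := by
    intro s _
    have h2 : HasDerivAt (fun s : ℝ => s • u • x) (u • x) s := by
      simpa using (hasDerivAt_id s).smul_const (u • x)
    exact ((hr (s • u • x)).comp_hasDerivAt s h2).congr_deriv (map_smul _ _ _)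
  have h3 := intervalIntegral.integral_eq_sub_of_hasDerivAt h1
    (Continuous.intervalIntegrable (by fun_prop) _ _)
  rw [intervalIntegral.integral_smul] at h3
  simpa [rescale] using h3

theorem rescale_zero (x : Plane) : rescale r' 0 x = r' 0 x := by simp [rescale]

/-- The derivative has one formula for all `u`, including `u = 0`, so shrinking the disc to its
linearization is a homotopy through maps whose derivatives are values of `r'`. -/
theorem hasFDerivAt_rescale (hr : ∀ x, HasFDerivAt r (r' x) x) (hc : Continuous r') (u : ℝ)
    (x : Plane) : HasFDerivAt (rescale r' u) (r' (u • x)) x := by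
  by_cases hu : u = 0
  · subst hu
    have : rescale r' 0 = r' 0 := funext rescale_zero
    rw [this, zero_smul]
    exact (r' 0).hasFDerivAt
  · have h1 : rescale r' u = fun x => u⁻¹ • (r (u • x) - r 0) := by
      funext x
      rw [← smul_rescale hr hc, smul_smul, inv_mul_cancel₀ hu, one_smul]
    rw [h1]
    have h2 : HasFDerivAt (fun x : Plane => u • x) (u • ContinuousLinearMap.id ℝ Plane) x :=
      (hasFDerivAt_id x).const_smul u
    have h3 := (((hr (u • x)).comp x h2).sub_const (r 0)).const_smul u⁻¹
    refine h3.congr_fderiv ?_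
    ext1 d
    simp [hu]

end Rescale

namespace IsPillow

variable {r : Plane → Space} {r' : Plane → Plane →L[ℝ] Space} {h h' : ℝ → ℝ}

/-- The angle is scaled down by `1 - t` while the displacement along `w` is scaled up by `t`. After
removal of the rotation the derivative is `r' ∘ hor + e • B`. The normal `N` annihilates the first
term, so for `e > 0` kernel vectors also satisfy `⟪N, B d⟫ = 0`, an equation that still has content
at `e = 0`. -/
theorem homotopic_thickening (H : IsPillow r r' h h') {N w : Plane → Space} (cN : Continuous N)
    (hw : ContDiff ℝ ∞ w) (hNr : ∀ x y, inner ℝ (N x) (r' x y) = 0)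
    (hNw : ∀ x ∈ closedBall (0 : Plane) 1, 0 < inner ℝ (N x) (w x))
    (hNr' : ∀ x ∈ sphere (0 : Plane) 1, 0 < inner ℝ (N x) (infRot (r x))) :
    ∀ᶠ e in 𝓝[>] (0 : ℝ), RegularlyHomotopic (fun q => rotL (e * h (ver q)) (r (hor q)))
      (fun q => r (hor q) + (e * ver q) • w (hor q)) := by
  have c1 := H.continuous
  have c2 := H.continuous_height
  have c3 := H.cont'
  have c4 := H.cont_h'
  have c5 := hw.continuous
  have c6 : Continuous (fderiv ℝ w) := hw.continuous_fderiv (by simp)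
  let B : ℝ → ℝ → Space → Space →L[ℝ] Space := fun e t q =>
    t • (ver.smulRight (w (hor q)) + ver q • (fderiv ℝ w (hor q)).comp hor) +
    ((1 - t) * h' (ver q)) • ver.smulRight (infRot (r (hor q) + (e * t * ver q) • w (hor q)))
  have cB : Continuous fun a : ℝ × ℝ × Space => B a.1 a.2.1 a.2.2 := by
    have k1 := continuous_smulRight_of (X := ℝ × ℝ × Space) (a := fun _ => ver)
      (v := fun a => w (hor a.2.2)) (by fun_prop) (by fun_prop)
    have k2 := continuous_smulRight_of (X := ℝ × ℝ × Space) (a := fun _ => ver)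
      (v := fun a => infRot (r (hor a.2.2) + (a.1 * a.2.1 * ver a.2.2) • w (hor a.2.2)))
      (by fun_prop) (by fun_prop)
    have k3 : Continuous fun a : ℝ × ℝ × Space => (fderiv ℝ w (hor a.2.2)).comp hor := by fun_prop
    have k4 : Continuous fun a : ℝ × ℝ × Space => ver a.2.2 := by fun_prop
    have k5 : Continuous fun a : ℝ × ℝ × Space => (1 - a.2.1) * h' (ver a.2.2) := by fun_prop
    have k6 : Continuous fun a : ℝ × ℝ × Space => a.2.1 := by fun_prop
    exact (k6.smul (k1.add (k4.smul k3))).add (k5.smul k2)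
  have key := injOnTangents_of_small
    (M := fun e t q => (r' (hor q)).comp hor + e • B e t q)
    (l := fun e t q => (innerSL ℝ (N (hor q))).comp (B e t q))
    ((by fun_prop : Continuous fun a : ℝ × ℝ × Space => (r' (hor a.2.2)).comp hor).add
      (continuous_fst.smul cB))
    (((innerSL ℝ).continuous.comp
      (by fun_prop : Continuous fun a : ℝ × ℝ × Space => N (hor a.2.2))).clm_comp cB)
    ?_ ?_
  · filter_upwards [key, self_mem_nhdsWithin] with e he he0
    have := regularlyHomotopic_rotL (a := fun x => (e * (1 - x.1)) * h (ver x.2))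
      (a' := fun x => ((e * (1 - x.1)) * h' (ver x.2)) • ver)
      (s := fun x => r (hor x.2) + (e * x.1 * ver x.2) • w (hor x.2))
      (s' := fun x => (r' (hor x.2)).comp hor + ((e * x.1) • ver.smulRight (w (hor x.2)) +
        (e * x.1 * ver x.2) • (fderiv ℝ w (hor x.2)).comp hor))
      (fun t p => H.hasFDerivAt_height (e * (1 - t)) p)
      (fun t p => ?_) (by fun_prop) (by fun_prop) (by fun_prop) ?_
      (fun t ht q hq d hd h0 => ?_)
    · simpa [rotL_apply, rotZ_zero] using this
    · refine ((H.hasFDerivAt _).comp p hor.hasFDerivAt).add ?_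
      have h1 : HasFDerivAt (fun p : Space => e * t * ver p) ((e * t) • ver) p :=
        ver.hasFDerivAt.const_mul (e * t)
      have h2 : HasFDerivAt (fun p : Space => w (hor p)) ((fderiv ℝ w (hor p)).comp hor) p :=
        ((hw.differentiable (by simp)) _).hasFDerivAt.comp p hor.hasFDerivAt
      refine (h1.smul h2).congr_fderiv ?_
      ext1 d
      simp [smul_smul, add_comm]
    · have k1 := continuous_smulRight_of (X := ℝ × Space) (a := fun _ => ver)
        (v := fun a => w (hor a.2)) (by fun_prop) (by fun_prop)
      fun_prop
    · refine he t ht q hq d hd ?_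
      refine Eq.trans ?_ h0
      simp only [B, add_apply, smul_apply, ContinuousLinearMap.comp_apply,
        ContinuousLinearMap.smulRight_apply]
      simp only [smul_eq_mul]
      module
  · intro e he t q d h0
    have h1 := congrArg (fun v => inner ℝ (N (hor q)) v) h0
    simp only [add_apply, smul_apply, ContinuousLinearMap.comp_apply, inner_add_right, hNr,
      inner_smul_right, zero_add, inner_zero_right] at h1
    exact (mul_eq_zero.1 h1).resolve_left he.ne'
  -- At `e = 0` a kernel vector is vertical, and a nonzero vertical vector is tangent only on the
  -- equator. There the normal component of `B` is its height times a convex combination of two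
  -- positive numbers, since `w` and the rotation point to the same side.
  · intro t ht q hq d hd h0 hl
    have h1 : r' (hor q) (hor d) = 0 := by simpa using h0
    have h2 := (injective_iff_map_eq_zero _).1 (H.inj _ (norm_hor_le hq)) _ h1
    refine eq_zero_of_hor_ver h2 ?_
    by_contra hne
    rw [inner_eq_hor_add_ver, h2, inner_zero_right, zero_add] at hd
    have hz : ver q = 0 := (mul_eq_zero.1 hd).resolve_right hne
    have hx := hor_mem_sphere hq hz
    have h3 : ver d * (t * inner ℝ (N (hor q)) (w (hor q)) +
        (1 - t) * h' 0 * inner ℝ (N (hor q)) (infRot (r (hor q)))) = 0 := by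
      refine Eq.trans ?_ hl
      simp only [B, add_apply, smul_apply, ContinuousLinearMap.comp_apply, h2, hz, map_zero,
        ContinuousLinearMap.smulRight_apply, innerSL_apply_apply, inner_add_right,
        inner_smul_right, mul_zero, zero_mul, zero_smul, add_zero, smul_zero]
      ring
    have p1 := hNw _ (sphere_subset_closedBall hx)
    have p2 := mul_pos H.pos (hNr' _ hx)
    have p3 : 0 < t * inner ℝ (N (hor q)) (w (hor q)) +
        (1 - t) * h' 0 * inner ℝ (N (hor q)) (infRot (r (hor q))) := by
      rw [mul_assoc]
      rcases ht.1.eq_or_lt with rfl | h0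
      · simpa using p2
      · have := mul_nonneg (sub_nonneg.2 ht.2) p2.le
        have := mul_pos h0 p1
        linarith
    exact hne ((mul_eq_zero.1 h3).resolve_right p3.ne')

set_option maxHeartbeats 800000 in
-- With `u = 1 - t`, the disc is replaced by its rescaling and `w` is evaluated at `u • hor q`; the
-- constant `(1 - t) • r 0` makes the family start at the given thickening. The argument with the
-- normal functional applies, now without separating off the equator, because `w` is transverse over
-- the whole disc. Compactness up to `t = 1` gives one `e` for the entire contraction.
theorem thickening_homotopic (H : IsPillow r r' h h') {N w : Plane → Space} (cN : Continuous N)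
    (hw : ContDiff ℝ ∞ w) (hNr : ∀ x y, inner ℝ (N x) (r' x y) = 0)
    (hNw : ∀ x ∈ closedBall (0 : Plane) 1, 0 < inner ℝ (N x) (w x)) :
    ∀ᶠ e in 𝓝[>] (0 : ℝ), RegularlyHomotopic
      (fun q => r (hor q) + (e * ver q) • w (hor q))
      (fun q => r' 0 (hor q) + (e * ver q) • w 0) := by
  have c1 := H.continuous
  have c3 := H.cont'
  have c5 := hw.continuous
  have c6 : Continuous (fderiv ℝ w) := hw.continuous_fderiv (by simp)
  let B : ℝ → Space → Space →L[ℝ] Space := fun t q =>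
    ver.smulRight (w ((1 - t) • hor q)) +
      (ver q * (1 - t)) • (fderiv ℝ w ((1 - t) • hor q)).comp hor
  have cB : Continuous fun a : ℝ × Space => B a.1 a.2 := by
    have k1 := continuous_smulRight_of (X := ℝ × Space) (a := fun _ => ver)
      (v := fun a => w ((1 - a.1) • hor a.2)) (by fun_prop) (by fun_prop)
    have k3 : Continuous fun a : ℝ × Space => (fderiv ℝ w ((1 - a.1) • hor a.2)).comp hor := by
      fun_prop
    have k4 : Continuous fun a : ℝ × Space => ver a.2 * (1 - a.1) := by fun_prop
    exact k1.add (k4.smul k3)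
  have cB' : Continuous fun a : ℝ × ℝ × Space => B a.2.1 a.2.2 := cB.comp continuous_snd
  have mem : ∀ t ∈ Icc (0 : ℝ) 1, ∀ q ∈ sphere (0 : Space) 1,
      (1 - t) • hor q ∈ closedBall (0 : Plane) 1 := by
    intro t ht q hq
    have := mem_closedBall_zero_iff.1 (norm_hor_le hq)
    rw [mem_closedBall_zero_iff, norm_smul, Real.norm_of_nonneg (sub_nonneg.2 ht.2)]
    nlinarith [ht.1, norm_nonneg (hor q)]
  have key := injOnTangents_of_small
    (M := fun e t q => (r' ((1 - t) • hor q)).comp hor + e • B t q)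
    (l := fun e t q => (innerSL ℝ (N ((1 - t) • hor q))).comp (B t q))
    ((by fun_prop : Continuous fun a : ℝ × ℝ × Space =>
      (r' ((1 - a.2.1) • hor a.2.2)).comp hor).add (continuous_fst.smul cB'))
    (((innerSL ℝ).continuous.comp (by fun_prop : Continuous fun a : ℝ × ℝ × Space =>
      N ((1 - a.2.1) • hor a.2.2))).clm_comp cB')
    ?_ ?_
  · filter_upwards [key] with e he
    have cr := continuous_rescale c3
    have := regularlyHomotopic_rotL (a := fun _ => 0) (a' := fun _ => 0)
      (s := fun x => (1 - x.1) • r 0 + (rescale r' (1 - x.1) (hor x.2) +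
        (e * ver x.2) • w ((1 - x.1) • hor x.2)))
      (s' := fun x => (r' ((1 - x.1) • hor x.2)).comp hor + e • B x.1 x.2)
      (fun t p => hasFDerivAt_const _ _)
      (fun t p => ?_) (by fun_prop) (by fun_prop) ?_ ?_
      (fun t ht q hq d hd h0 => ?_)
    · have e1 : ∀ x, rescale r' 1 x = r x - r 0 := fun x => by
        simpa using smul_rescale H.hasFDerivAt c3 1 x
      have e2 : ∀ a b : Space, r 0 + (a - r 0 + b) = a + b := fun a b => by abel
      simpa [rotL_apply, rotZ_zero, rescale_zero, e1, e2] using this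
    · have h0 : HasFDerivAt (fun p : Space => rescale r' (1 - t) (hor p))
          ((r' ((1 - t) • hor p)).comp hor) p :=
        (hasFDerivAt_rescale H.hasFDerivAt c3 (1 - t) (hor p)).comp p hor.hasFDerivAt
      have h1 : HasFDerivAt (fun p : Space => e * ver p) (e • ver) p :=
        ver.hasFDerivAt.const_mul e
      have h3 : HasFDerivAt (fun p : Space => (1 - t) • hor p) ((1 - t) • hor) p :=
        hor.hasFDerivAt.const_smul (1 - t)
      have h2 : HasFDerivAt (fun p : Space => w ((1 - t) • hor p))
          ((fderiv ℝ w ((1 - t) • hor p)).comp ((1 - t) • hor)) p :=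
        HasFDerivAt.comp p ((hw.differentiable (by simp)) _).hasFDerivAt h3
      refine ((h0.add (h1.smul h2)).const_add ((1 - t) • r 0)).congr_fderiv ?_
      ext1 d
      simp only [B, add_apply, smul_apply, ContinuousLinearMap.comp_apply, map_smul,
        ContinuousLinearMap.smulRight_apply, smul_eq_mul]
      module
    · have k : Continuous fun x : ℝ × Space => rescale r' (1 - x.1) (hor x.2) :=
        cr.comp (by fun_prop : Continuous fun x : ℝ × Space => (1 - x.1, hor x.2))
      have k1 : Continuous fun x : ℝ × Space => e * ver x.2 := by fun_prop
      have k2 : Continuous fun x : ℝ × Space => w ((1 - x.1) • hor x.2) := by fun_prop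
      have k3 : Continuous fun x : ℝ × Space => (1 - x.1) • r 0 := by fun_prop
      exact k3.add (k.add (k1.smul k2))
    · have k : Continuous fun a : ℝ × Space => (r' ((1 - a.1) • hor a.2)).comp hor := by fun_prop
      exact k.add (cB.const_smul e)
    · refine he t ht q hq d hd ?_
      refine Eq.trans ?_ h0
      simp
  · intro e he t q d h0
    have h1 := congrArg (fun v => inner ℝ (N ((1 - t) • hor q)) v) h0
    simp only [add_apply, smul_apply, ContinuousLinearMap.comp_apply, inner_add_right, hNr,
      inner_smul_right, zero_add, inner_zero_right] at h1
    exact (mul_eq_zero.1 h1).resolve_left he.ne'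
  · intro t ht q hq d hd h0 hl
    have h1 : r' ((1 - t) • hor q) (hor d) = 0 := by simpa using h0
    have h2 := (injective_iff_map_eq_zero _).1 (H.inj _ (mem t ht q hq)) _ h1
    refine eq_zero_of_hor_ver h2 ?_
    have h3 : ver d * inner ℝ (N ((1 - t) • hor q)) (w ((1 - t) • hor q)) = 0 := by
      refine Eq.trans ?_ hl
      simp only [B, add_apply, smul_apply, ContinuousLinearMap.comp_apply, h2, map_zero,
        ContinuousLinearMap.smulRight_apply, innerSL_apply_apply,
        inner_smul_right, add_zero, smul_zero]
    exact (mul_eq_zero.1 h3).resolve_right (hNw _ (mem t ht q hq)).ne'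

/-- The sheared double of an immersed disc is regularly homotopic to an ellipsoid. -/
theorem exists_linear (H : IsPillow r r' h h') {a : ℝ} (ha : 0 < a) :
    ∃ L : Space →L[ℝ] Space, Function.Injective L ∧
      RegularlyHomotopic (fun q => rotL (a * h (ver q)) (r (hor q))) (fun q => L q) := by
  obtain ⟨N, w, cN, hw, hNr, hNw, hNr'⟩ := H.exists_normal
  -- One small `e` serves both deformations; `scale` first brings the given factor `a` down to it.
  obtain ⟨e, ⟨h1, h2⟩, he⟩ := (((H.homotopic_thickening cN hw hNr hNw hNr').and
    (H.thickening_homotopic cN hw hNr hNw)).and self_mem_nhdsWithin).exists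
  have he0 : 0 < e := he
  refine ⟨(r' 0).comp hor + e • ver.smulRight (w 0), ?_, ?_⟩
  · rw [injective_iff_map_eq_zero]
    intro d hd
    have mem : (0 : Plane) ∈ closedBall (0 : Plane) 1 := by simp
    have k1 : r' 0 (hor d) + (e * ver d) • w 0 = 0 := by
      rw [← hd]
      simp [smul_smul]
    have k2 := congrArg (fun v => inner ℝ (N 0) v) k1
    simp only [inner_add_right, hNr, inner_smul_right, zero_add, inner_zero_right] at k2
    have k3 : ver d = 0 :=
      (mul_eq_zero.1 ((mul_eq_zero.1 k2).resolve_right (hNw 0 mem).ne')).resolve_left he0.ne'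
    rw [k3, mul_zero, zero_smul, add_zero] at k1
    exact eq_zero_of_hor_ver ((injective_iff_map_eq_zero _).1 (H.inj 0 mem) _ k1) k3
  · have := ((H.scale ha he0).trans h1).trans h2
    convert this using 3 with q
    simp [smul_smul]

end IsPillow

/-! ### Reparametrizing the disc with prescribed radial derivative on the boundary. -/

/-- Rotation of the plane by a right angle. -/
def perp : Plane →L[ℝ] Plane :=
  LinearMap.toContinuousLinearMap
    { toFun := fun p => !₂[-p 1, p 0]
      map_add' := fun p q => by ext i; fin_cases i <;> simp; ring
      map_smul' := fun a p => by ext i; fin_cases i <;> simp }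

@[simp] theorem perp_apply (p : Plane) : perp p = !₂[-p 1, p 0] := rfl

theorem inner_perp_self (p : Plane) : inner ℝ p (perp p) = 0 := by
  simp [PiLp.inner_apply, Fin.sum_univ_two]; ring

theorem norm_perp (p : Plane) : ‖perp p‖ = ‖p‖ := by
  simp [EuclideanSpace.norm_eq, Fin.sum_univ_two, add_comm]

/-- Rotation of the plane. -/
def rotP (a : ℝ) : Plane →L[ℝ] Plane :=
  Real.cos a • ContinuousLinearMap.id ℝ Plane + Real.sin a • perp

theorem rotP_add (a b : ℝ) (p : Plane) : rotP (a + b) p = rotP a (rotP b p) := by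
  ext i
  fin_cases i <;> simp [rotP, Real.cos_add, Real.sin_add] <;> ring

theorem rotP_zero (p : Plane) : rotP 0 p = p := by simp [rotP]

theorem rotP_injective (a : ℝ) : Function.Injective (rotP a) := by
  intro p q h
  have := congrArg (rotP (-a)) h
  simpa [← rotP_add, rotP_zero] using this

theorem norm_rotP (a : ℝ) (p : Plane) : ‖rotP a p‖ = ‖p‖ := by
  rw [← sq_eq_sq₀ (norm_nonneg _) (norm_nonneg _), EuclideanSpace.norm_sq_eq,
    EuclideanSpace.norm_sq_eq]
  simp [rotP, Fin.sum_univ_two]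
  linear_combination (p 0 ^ 2 + p 1 ^ 2) * Real.sin_sq_add_cos_sq a

theorem norm_rotP_sub_le (a : ℝ) (p : Plane) : ‖rotP a p - p‖ ≤ |a| * ‖p‖ := by
  rw [← sq_le_sq₀ (norm_nonneg _) (by positivity), mul_pow, sq_abs, EuclideanSpace.norm_sq_eq,
    EuclideanSpace.norm_sq_eq]
  have h1 := Real.one_sub_sq_div_two_le_cos (x := a)
  have h2 : (2 - 2 * Real.cos a) * (p 0 ^ 2 + p 1 ^ 2) ≤ a ^ 2 * (p 0 ^ 2 + p 1 ^ 2) := by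
    apply mul_le_mul_of_nonneg_right _ (by positivity)
    linarith
  simp [rotP, Fin.sum_univ_two]
  nlinarith [Real.sin_sq_add_cos_sq a]

theorem hasDerivAt_rotP (a : ℝ) : HasDerivAt rotP ((rotP a).comp perp) a := by
  have h := ((Real.hasDerivAt_cos a).smul_const (ContinuousLinearMap.id ℝ Plane)).add
    ((Real.hasDerivAt_sin a).smul_const perp)
  refine h.congr_deriv ?_
  ext p i
  fin_cases i <;> simp [rotP] <;> ring

theorem hasFDerivAt_rotP_self {C : Plane → ℝ} {C' : Plane →L[ℝ] ℝ} {x : Plane}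
    (hC : HasFDerivAt C C' x) : HasFDerivAt (fun x => rotP (C x) x)
      ((rotP (C x)).comp (ContinuousLinearMap.id ℝ Plane + C'.smulRight (perp x))) x := by
  have h1 := (hasDerivAt_rotP (C x)).hasFDerivAt.comp x hC
  refine (h1.clm_apply (hasFDerivAt_id x)).congr_fderiv ?_
  ext1 d
  simp

theorem hasFDerivAt_exp_smul_self {A : Plane → ℝ} {A' : Plane →L[ℝ] ℝ} {x : Plane}
    (hA : HasFDerivAt A A' x) : HasFDerivAt (fun x => Real.exp (-A x) • x)
      (Real.exp (-A x) • (ContinuousLinearMap.id ℝ Plane - A'.smulRight x)) x := by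
  refine ((hA.neg.exp).smul (hasFDerivAt_id x)).congr_fderiv ?_
  ext1 d
  simp only [add_apply, smul_apply, ContinuousLinearMap.smulRight_apply, sub_apply, id,
    ContinuousLinearMap.id_apply, neg_apply, smul_eq_mul]
  module

/-- A radial rescaling of the disc by a factor at most one is injective. -/
theorem injOn_exp_smul {A : Plane → ℝ} {A' : Plane → Plane →L[ℝ] ℝ}
    (hA : ∀ x, HasFDerivAt A (A' x) x) (hA' : ∀ x ∈ closedBall (0 : Plane) 1, A' x x < 1) :
    InjOn (fun x => Real.exp (-A x) • x) (closedBall (0 : Plane) 1) := by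
  intro x hx y hy hxy
  simp only at hxy
  by_cases hx0 : x = 0
  · subst hx0
    rw [smul_zero, eq_comm, smul_eq_zero] at hxy
    exact (hxy.resolve_left (Real.exp_pos _).ne').symm
  have hn : 0 < ‖x‖ := norm_pos_iff.2 hx0
  set u : Plane := ‖x‖⁻¹ • x with hu
  have hu1 : ‖u‖ = 1 := by simp [hu, norm_smul, hn.ne']
  have hxu : x = ‖x‖ • u := by rw [hu, smul_smul, mul_inv_cancel₀ hn.ne', one_smul]
  have hyu : y = ‖y‖ • u := by
    have h1 : y = (Real.exp (A y - A x) * ‖x‖) • u := by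
      rw [mul_smul, ← hxu, sub_eq_add_neg, Real.exp_add, mul_smul, hxy, smul_smul, ← Real.exp_add]
      simp
    have h2 : ‖y‖ = Real.exp (A y - A x) * ‖x‖ := by
      rw [h1, norm_smul, hu1, mul_one, ← h1, Real.norm_of_nonneg (by positivity)]
    rw [h2]
    exact h1
  -- On each ray the radial function has derivative `exp (-A) * (1 - A' x x)` at `x = t • u`, which
  -- is positive by hypothesis.
  have mono : StrictMonoOn (fun t : ℝ => Real.exp (-A (t • u)) * t) (Icc 0 1) := by
    have hd : ∀ t : ℝ, HasDerivAt (fun t : ℝ => Real.exp (-A (t • u)) * t)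
        (Real.exp (-A (t • u)) * (1 - A' (t • u) (t • u))) t := by
      intro t
      have h1 : HasDerivAt (fun t : ℝ => t • u) u t := by
        simpa using (hasDerivAt_id t).smul_const u
      have h2 := (((hA (t • u)).comp_hasDerivAt t h1).neg.exp).mul (hasDerivAt_id t)
      refine h2.congr_deriv ?_
      simp
      ring
    refine strictMonoOn_of_deriv_pos (convex_Icc 0 1)
      (fun t _ => (hd t).continuousAt.continuousWithinAt) fun t ht => ?_
    rw [interior_Icc] at ht
    rw [(hd t).deriv]
    refine mul_pos (Real.exp_pos _) (sub_pos.2 (hA' _ ?_))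
    rw [mem_closedBall_zero_iff, norm_smul, hu1, mul_one, Real.norm_of_nonneg ht.1.le]
    exact ht.2.le
  have hu0 : u ≠ 0 := fun h => by rw [h, norm_zero] at hu1; exact zero_ne_one hu1
  have h3 : Real.exp (-A (‖x‖ • u)) * ‖x‖ = Real.exp (-A (‖y‖ • u)) * ‖y‖ := by
    apply smul_left_injective ℝ hu0
    simp only [mul_smul]
    rw [← hxu, ← hyu, hxy]
  have h4 := mono.injOn ⟨norm_nonneg _, mem_closedBall_zero_iff.1 hx⟩
    ⟨norm_nonneg _, mem_closedBall_zero_iff.1 hy⟩ h3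
  rw [hxu, hyu, h4]

/-- A `C^1` reparametrization of the closed disc that fixes the boundary pointwise and has a
prescribed radial derivative there. -/
theorem exists_reparam {a c : Plane → ℝ} (ha : ContDiff ℝ 1 a) (hc : ContDiff ℝ 1 c)
    (ha0 : ∀ x, 0 ≤ a x) :
    ∃ (G : Plane → Plane) (G' : Plane → Plane →L[ℝ] Plane), (∀ x, HasFDerivAt G (G' x) x) ∧
      Continuous G' ∧ BijOn G (closedBall 0 1) (closedBall 0 1) ∧ MapsTo G (ball 0 1) (ball 0 1) ∧
      (∀ x ∈ sphere (0 : Plane) 1, G x = x) ∧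
      (∀ x ∈ closedBall (0 : Plane) 1, Function.Injective (G' x)) ∧
      ∀ x ∈ sphere (0 : Plane) 1, G' x x = (1 + a x) • (x - c x • perp x) := by
  have hD : IsCompact (closedBall (0 : Plane) 1) := isCompact_closedBall _ _
  have cda := ha.continuous_fderiv one_ne_zero
  have cdc := hc.continuous_fderiv one_ne_zero
  have da := ha.differentiable one_ne_zero
  have dc := hc.differentiable one_ne_zero
  obtain ⟨K₁, hK₁⟩ := hD.exists_bound_of_continuousOn cda.continuousOn
  obtain ⟨K₂, hK₂⟩ := hD.exists_bound_of_continuousOn cdc.continuousOn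
  obtain ⟨n, hn⟩ := exists_nat_gt (max (max K₁ K₂) 1)
  have hn1 : (1 : ℝ) < n := (le_max_right _ _).trans_lt hn
  have hnK₁ : K₁ < n := ((le_max_left _ _).trans (le_max_left _ _)).trans_lt hn
  have hnK₂ : K₂ < n := ((le_max_right _ _).trans (le_max_left _ _)).trans_lt hn
  have hn0 : n ≠ 0 := by rintro rfl; norm_num at hn1
  -- This `k` vanishes on the unit circle with radial derivative `-1`, yet is at most `1 / (2 * n)`
  -- on the disc. For large `n` it therefore controls boundary derivatives while its products with
  -- the derivatives of `a` and `c` remain below `1`.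
  let k : Plane → ℝ := fun x => (1 - (‖x‖ ^ 2) ^ n) / (2 * n)
  let k' : Plane → Plane →L[ℝ] ℝ := fun x => (-(‖x‖ ^ 2) ^ (n - 1)) • innerSL ℝ x
  have hk : ∀ x, HasFDerivAt k (k' x) x := by
    intro x
    have h1 := ((((hasStrictFDerivAt_norm_sq x).hasFDerivAt.pow n).const_sub 1).mul_const
      ((2 * n : ℝ)⁻¹))
    refine h1.congr_fderiv ?_
    ext1 d
    simp [k']
    field_simp
  have ck' : Continuous k' := by
    have : Continuous fun x : Plane => innerSL ℝ x := (innerSL ℝ).continuous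
    fun_prop
  have ck : Continuous k := continuous_iff_continuousAt.2 fun x => (hk x).continuousAt
  have hk0 : ∀ x ∈ closedBall (0 : Plane) 1, 0 ≤ k x ∧ k x * n ≤ 1 / 2 := by
    intro x hx
    have h1 : ‖x‖ ^ 2 ≤ 1 := by
      have := mem_closedBall_zero_iff.1 hx
      nlinarith [norm_nonneg x]
    have h2 : (‖x‖ ^ 2) ^ n ≤ 1 := pow_le_one₀ (by positivity) h1
    have h3 : 0 ≤ (‖x‖ ^ 2) ^ n := by positivity
    refine ⟨div_nonneg (by linarith) (by positivity), ?_⟩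
    simp only [k]
    rw [div_mul_eq_mul_div, div_le_iff₀ (by positivity)]
    nlinarith
  have hk1 : ∀ x ∈ sphere (0 : Plane) 1, k x = 0 := by
    intro x hx
    simp [k, mem_sphere_zero_iff_norm.1 hx]
  have small : ∀ {K : ℝ}, K < n → ∀ x ∈ closedBall (0 : Plane) 1, k x * K < 1 := by
    intro K hK x hx
    have := hk0 x hx
    nlinarith
  let A : Plane → ℝ := fun x => k x * a x
  let A' : Plane → Plane →L[ℝ] ℝ := fun x => k x • fderiv ℝ a x + a x • k' x
  let C : Plane → ℝ := fun x => k x * c x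
  let C' : Plane → Plane →L[ℝ] ℝ := fun x => k x • fderiv ℝ c x + c x • k' x
  have hA : ∀ x, HasFDerivAt A (A' x) x := fun x => (hk x).mul (da x).hasFDerivAt
  have hC : ∀ x, HasFDerivAt C (C' x) x := fun x => (hk x).mul (dc x).hasFDerivAt
  have ca := ha.continuous
  have cc := hc.continuous
  have cA' : Continuous A' := by fun_prop
  have cC' : Continuous C' := by fun_prop
  have cA : Continuous A := by fun_prop
  have cC : Continuous C := by fun_prop
  have bound : ∀ {f : Plane → ℝ} {K : ℝ},
      (∀ x ∈ closedBall (0 : Plane) 1, ‖fderiv ℝ f x‖ ≤ K) → K < n →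
      ∀ x ∈ closedBall (0 : Plane) 1, ∀ d : Plane, ‖d‖ ≤ 1 → |k x * fderiv ℝ f x d| < 1 := by
    intro f K hK hKn x hx d hd
    have h1 := (fderiv ℝ f x).le_of_opNorm_le (hK x hx) d
    have h2 : K * ‖d‖ ≤ K := by
      have : 0 ≤ K := (norm_nonneg _).trans (hK x hx)
      nlinarith
    rw [abs_mul, abs_of_nonneg (hk0 x hx).1]
    exact (mul_le_mul_of_nonneg_left (h1.trans h2) (hk0 x hx).1).trans_lt (small hKn x hx)
  have hA1 : ∀ x ∈ closedBall (0 : Plane) 1, A' x x < 1 := by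
    intro x hx
    have h1 := (abs_lt.1 (bound hK₁ hnK₁ x hx x (mem_closedBall_zero_iff.1 hx))).2
    have h2 : 0 ≤ a x * ((‖x‖ ^ 2) ^ (n - 1) * ‖x‖ ^ 2) := mul_nonneg (ha0 x) (by positivity)
    have h3 : A' x x = k x * fderiv ℝ a x x - a x * ((‖x‖ ^ 2) ^ (n - 1) * ‖x‖ ^ 2) := by
      simp [A', k']
      ring
    rw [h3]
    linarith
  have hC1 : ∀ x ∈ closedBall (0 : Plane) 1, -1 < C' x (perp x) := by
    intro x hx
    have h1 := (abs_lt.1 (bound hK₂ hnK₂ x hx (perp x)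
      (by rw [norm_perp]; exact mem_closedBall_zero_iff.1 hx))).1
    have h3 : C' x (perp x) = k x * fderiv ℝ c x (perp x) := by
      simp only [C', k', add_apply, smul_apply, innerSL_apply_apply, inner_perp_self, smul_eq_mul,
        mul_zero, add_zero]
    rwa [h3]
  -- `R` moves points inwards along rays and `T` turns each circle point by the angle `C`. Both fix
  -- the boundary; there they contribute the factor `1 + a x` and the shear `-c x • perp x`.
  let R : Plane → Plane := fun x => Real.exp (-A x) • x
  let R' : Plane → Plane →L[ℝ] Plane := fun x =>
    Real.exp (-A x) • (ContinuousLinearMap.id ℝ Plane - (A' x).smulRight x)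
  let T : Plane → Plane := fun x => rotP (C x) x
  let T' : Plane → Plane →L[ℝ] Plane := fun x =>
    (rotP (C x)).comp (ContinuousLinearMap.id ℝ Plane + (C' x).smulRight (perp x))
  have hR : ∀ x, HasFDerivAt R (R' x) x := fun x => hasFDerivAt_exp_smul_self (hA x)
  have hT : ∀ x, HasFDerivAt T (T' x) x := fun x => hasFDerivAt_rotP_self (hC x)
  have hRn : ∀ x ∈ closedBall (0 : Plane) 1, ‖R x‖ ≤ ‖x‖ := by
    intro x hx
    have h1 : Real.exp (-A x) ≤ 1 :=
      Real.exp_le_one_iff.2 (neg_nonpos.2 (mul_nonneg (hk0 x hx).1 (ha0 x)))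
    simp only [R, norm_smul, Real.norm_of_nonneg (Real.exp_pos _).le]
    nlinarith [norm_nonneg x]
  have hTn : ∀ x, ‖T x‖ = ‖x‖ := fun x => norm_rotP _ _
  have hRD : MapsTo R (closedBall 0 1) (closedBall 0 1) := fun x hx =>
    mem_closedBall_zero_iff.2 ((hRn x hx).trans (mem_closedBall_zero_iff.1 hx))
  have hR1 : ∀ x ∈ sphere (0 : Plane) 1, R x = x := fun x hx => by simp [R, A, hk1 x hx]
  have hT1 : ∀ x ∈ sphere (0 : Plane) 1, T x = x := fun x hx => by
    simp [T, C, hk1 x hx, rotP_zero]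
  have hRinj : InjOn R (closedBall 0 1) := injOn_exp_smul hA hA1
  -- `T` preserves norms and `k` depends only on the norm, so two points with equal image satisfy
  -- `‖y - x‖ ≤ k x * K₂ * ‖y - x‖` with `k x * K₂ < 1`.
  have hTinj : InjOn T (closedBall 0 1) := by
    intro x hx y hy hxy
    have hn : ‖x‖ = ‖y‖ := by rw [← hTn x, hxy, hTn]
    have hkk : k x = k y := by simp only [k, hn]
    have h1 : y = rotP (C x - C y) x := by
      apply rotP_injective (C y)
      rw [← rotP_add, add_sub_cancel]
      exact hxy.symm
    have h2 : ‖y - x‖ ≤ |C x - C y| * ‖x‖ := by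
      conv_lhs => rw [h1]
      exact norm_rotP_sub_le _ _
    have h3 : |C x - C y| ≤ k x * (K₂ * ‖y - x‖) := by
      have h4 : C x - C y = k x * (c x - c y) := by simp only [C, ← hkk]; ring
      rw [h4, abs_mul, abs_of_nonneg (hk0 x hx).1, norm_sub_rev y x]
      refine mul_le_mul_of_nonneg_left ?_ (hk0 x hx).1
      exact (convex_closedBall (0 : Plane) 1).norm_image_sub_le_of_norm_fderiv_le
        (fun z _ => dc z) hK₂ hy hx
    have h5 : |C x - C y| * ‖x‖ ≤ |C x - C y| := by
      have := mem_closedBall_zero_iff.1 hx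
      nlinarith [abs_nonneg (C x - C y)]
    have h6 := small hnK₂ x hx
    have h7 : ‖y - x‖ ≤ (k x * K₂) * ‖y - x‖ := by
      rw [mul_assoc]; exact h2.trans (h5.trans h3)
    have h8 : ‖y - x‖ = 0 := by nlinarith [norm_nonneg (y - x)]
    exact (sub_eq_zero.1 (norm_eq_zero.1 h8)).symm
  have hR'inj : ∀ x ∈ closedBall (0 : Plane) 1, Function.Injective (R' x) := by
    intro x hx
    rw [injective_iff_map_eq_zero]
    intro d hd
    have h1 : d - A' x d • x = 0 := (smul_eq_zero.1 hd).resolve_left (Real.exp_pos _).ne'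
    have h2 := congrArg (A' x) h1
    rw [map_sub, map_smul, map_zero, smul_eq_mul] at h2
    have h3 : A' x d * (1 - A' x x) = 0 := by rw [← h2]; ring
    have h4 : A' x d = 0 := (mul_eq_zero.1 h3).resolve_right (sub_pos.2 (hA1 x hx)).ne'
    rwa [h4, zero_smul, sub_zero] at h1
  have hT'inj : ∀ x ∈ closedBall (0 : Plane) 1, Function.Injective (T' x) := by
    intro x hx
    refine (rotP_injective _).comp ?_
    change Function.Injective (ContinuousLinearMap.id ℝ Plane + (C' x).smulRight (perp x))
    rw [injective_iff_map_eq_zero]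
    intro d hd
    have h1 : d + C' x d • perp x = 0 := hd
    have h2 := congrArg (C' x) h1
    rw [map_add, map_smul, map_zero, smul_eq_mul] at h2
    have h3 : C' x d * (1 + C' x (perp x)) = 0 := by rw [← h2]; ring
    have h4 : C' x d = 0 := (mul_eq_zero.1 h3).resolve_right (by linarith [hC1 x hx])
    rwa [h4, zero_smul, add_zero] at h1
  have hG : ∀ x, HasFDerivAt (T ∘ R) ((T' (R x)).comp (R' x)) x := fun x =>
    (hT (R x)).comp x (hR x)
  have cR : Continuous R := by fun_prop
  have cR' : Continuous R' := by
    have : Continuous fun x => (A' x).smulRight x :=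
      ((ContinuousLinearMap.smulRightL ℝ Plane Plane).continuous.comp cA').clm_apply continuous_id
    fun_prop
  have cT' : Continuous T' := by
    have h1 : Continuous fun x => (C' x).smulRight (perp x) :=
      ((ContinuousLinearMap.smulRightL ℝ Plane Plane).continuous.comp cC').clm_apply perp.continuous
    have h2 : Continuous rotP :=
      continuous_iff_continuousAt.2 fun a => (hasDerivAt_rotP a).continuousAt
    exact (h2.comp cC).clm_comp (continuous_const.add h1)
  have cG' : Continuous fun x => (T' (R x)).comp (R' x) := (cT'.comp cR).clm_comp cR'
  have hGinj : ∀ x ∈ closedBall (0 : Plane) 1, Function.Injective ((T' (R x)).comp (R' x)) :=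
    fun x hx => (hT'inj _ (hRD hx)).comp (hR'inj x hx)
  have hGn : ∀ x ∈ closedBall (0 : Plane) 1, ‖(T ∘ R) x‖ ≤ ‖x‖ := fun x hx => by
    rw [Function.comp_apply, hTn]; exact hRn x hx
  have hGD : MapsTo (T ∘ R) (closedBall 0 1) (closedBall 0 1) := fun x hx =>
    mem_closedBall_zero_iff.2 ((hGn x hx).trans (mem_closedBall_zero_iff.1 hx))
  have hGB : MapsTo (T ∘ R) (ball 0 1) (ball 0 1) := fun x hx =>
    mem_ball_zero_iff.2 ((hGn x (ball_subset_closedBall hx)).trans_lt (mem_ball_zero_iff.1 hx))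
  have hG1 : ∀ x ∈ sphere (0 : Plane) 1, (T ∘ R) x = x := fun x hx => by
    rw [Function.comp_apply, hR1 x hx, hT1 x hx]
  have hGc : Continuous (T ∘ R) := continuous_iff_continuousAt.2 fun x => (hG x).continuousAt
  have hGC1 : ContDiff ℝ 1 (T ∘ R) := contDiff_one_iff_hasFDerivAt.2 ⟨_, cG', hG⟩
  have hopen : IsOpen ((T ∘ R) '' ball 0 1) := by
    rw [isOpen_iff_mem_nhds]
    rintro _ ⟨x, hx, rfl⟩
    let e : Plane ≃L[ℝ] Plane := (LinearEquiv.ofInjectiveEndo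
      ((T' (R x)).comp (R' x) : Plane →ₗ[ℝ] Plane)
      (hGinj x (ball_subset_closedBall hx))).toContinuousLinearEquiv
    have h6 : HasFDerivAt (T ∘ R) (e : Plane →L[ℝ] Plane) x := hG x
    rw [← (hGC1.contDiffAt.hasStrictFDerivAt' h6 one_ne_zero).map_nhds_eq_of_equiv]
    exact Filter.image_mem_map (isOpen_ball.mem_nhds hx)
  -- The image of the open ball is open, and it is relatively closed in the ball because boundary
  -- points are fixed; connectedness does the rest.
  have hsurj : ball (0 : Plane) 1 ⊆ (T ∘ R) '' ball 0 1 := by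
    refine (convex_ball (0 : Plane) 1).isPreconnected.subset_of_closure_inter_subset hopen
      ⟨(T ∘ R) 0, hGB (mem_ball_self one_pos), 0, mem_ball_self one_pos, rfl⟩ ?_
    rintro y ⟨hy, hyB⟩
    have h1 : closure ((T ∘ R) '' ball (0 : Plane) 1) ⊆ (T ∘ R) '' closedBall 0 1 :=
      closure_minimal (image_mono ball_subset_closedBall) (hD.image hGc).isClosed
    obtain ⟨x, hx, rfl⟩ := h1 hy
    rcases (mem_closedBall_zero_iff.1 hx).lt_or_eq with h | h
    · exact ⟨x, mem_ball_zero_iff.2 h, rfl⟩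
    · rw [hG1 x (mem_sphere_zero_iff_norm.2 h)] at hyB
      exact absurd (mem_ball_zero_iff.1 hyB) h.not_lt
  refine ⟨T ∘ R, fun x => (T' (R x)).comp (R' x), hG, cG', ⟨hGD, ?_, ?_⟩, hGB, hG1, hGinj, ?_⟩
  · exact hTinj.comp hRinj hRD
  · intro y hy
    rcases (mem_closedBall_zero_iff.1 hy).lt_or_eq with h | h
    · obtain ⟨x, hx, rfl⟩ := hsurj (mem_ball_zero_iff.2 h)
      exact ⟨x, ball_subset_closedBall hx, rfl⟩
    · exact ⟨y, hy, hG1 y (mem_sphere_zero_iff_norm.2 h)⟩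
  · intro x hx
    have hx1 := mem_sphere_zero_iff_norm.1 hx
    have e1 : R' x x = (1 + a x) • x := by
      simp [R', A', A, k', hk1 x hx, hx1, add_smul]
    have e2 : T' x x = x - c x • perp x := by
      simp only [T', C', C, k', hk1 x hx, ContinuousLinearMap.comp_apply, add_apply,
        ContinuousLinearMap.smulRight_apply, smul_apply, innerSL_apply_apply,
        real_inner_self_eq_norm_sq, hx1, zero_mul, rotP_zero, ContinuousLinearMap.id_apply]
      simp [sub_eq_add_neg]
    rw [ContinuousLinearMap.comp_apply, hR1 x hx, e1, map_smul, e2]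

/-! ### The spanning disc near the boundary torus. -/

/-- The squared distance from the core circle, whose level set `1` is the boundary torus of the
solid donut. -/
def coreDistSq (p : Space) : ℝ := (√(p 0 ^ 2 + p 1 ^ 2) - √2) ^ 2 + p 2 ^ 2

theorem one_lt_sqrt_two : (1 : ℝ) < √2 := Real.one_lt_sqrt_two

theorem screw_eq (ψ : ℝ) (u : ℝ × ℝ) : screw ψ u =
    !₂[Real.cos ψ * (√2 + (Real.cos (ψ / 2) * u.1 - Real.sin (ψ / 2) * u.2)),
      Real.sin ψ * (√2 + (Real.cos (ψ / 2) * u.1 - Real.sin (ψ / 2) * u.2)),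
      Real.sin (ψ / 2) * u.1 + Real.cos (ψ / 2) * u.2] := by
  ext i
  fin_cases i <;> simp [screw, rotZ]

theorem abs_le_one_of_sq_add_sq {a b : ℝ} (h : a ^ 2 + b ^ 2 ≤ 1) : |a| ≤ 1 := by
  rw [← sq_le_one_iff_abs_le_one]; nlinarith [sq_nonneg b]

/-- The distance to the `z`-axis of a point of the solid donut. -/
theorem sqrt_polar {X : ℝ} (hX : 0 < X) (ψ : ℝ) :
    √((Real.cos ψ * X) ^ 2 + (Real.sin ψ * X) ^ 2) = X := by
  have : (Real.cos ψ * X) ^ 2 + (Real.sin ψ * X) ^ 2 = X ^ 2 := by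
    linear_combination X ^ 2 * Real.sin_sq_add_cos_sq ψ
  rw [this, Real.sqrt_sq hX.le]

theorem mem_knotZero_facts {p : Space} (hp : p ∈ knotZero) :
    0 < p 0 ^ 2 + p 1 ^ 2 ∧ coreDistSq p = 1 := by
  have main : ∀ (ψ s : ℝ), s ^ 2 = 1 → 0 < (screw ψ (s, 0)) 0 ^ 2 + (screw ψ (s, 0)) 1 ^ 2 ∧
      coreDistSq (screw ψ (s, 0)) = 1 := by
    intro ψ s hs
    have h2 : |Real.cos (ψ / 2) * s| ≤ 1 := by
      apply abs_le_one_of_sq_add_sq (b := Real.sin (ψ / 2) * s)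
      rw [mul_pow, mul_pow, hs]
      linarith [Real.sin_sq_add_cos_sq (ψ / 2)]
    have hX : 0 < √2 + Real.cos (ψ / 2) * s := by
      linarith [(abs_le.1 h2).1, one_lt_sqrt_two]
    constructor
    · have : (screw ψ (s, 0)) 0 ^ 2 + (screw ψ (s, 0)) 1 ^ 2 = (√2 + Real.cos (ψ / 2) * s) ^ 2 := by
        simp [screw_eq]
        linear_combination (√2 + Real.cos (ψ / 2) * s) ^ 2 * Real.sin_sq_add_cos_sq ψ
      rw [this]
      positivity
    · simp only [coreDistSq, screw_eq]
      simp only [mul_zero, sub_zero, add_zero, Matrix.cons_val_zero,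
        Matrix.cons_val_one, Matrix.cons_val]
      rw [sqrt_polar hX]
      linear_combination s ^ 2 * Real.sin_sq_add_cos_sq (ψ / 2) + hs
  obtain ⟨ψ, rfl | rfl⟩ := hp
  · exact main ψ 1 (by norm_num)
  · exact main ψ (-1) (by norm_num)

theorem norm_sq_torusNormal {p : Space} (hp : 0 < p 0 ^ 2 + p 1 ^ 2) :
    ‖torusNormal p‖ ^ 2 = coreDistSq p := by
  have hs : √(p 0 ^ 2 + p 1 ^ 2) ≠ 0 := (Real.sqrt_pos.2 hp).ne'
  rw [EuclideanSpace.norm_sq_eq]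
  simp only [Fin.sum_univ_three, torusNormal, coreDistSq]
  set s := √(p 0 ^ 2 + p 1 ^ 2) with hsdef
  have hs2 : s ^ 2 = p 0 ^ 2 + p 1 ^ 2 := Real.sq_sqrt hp.le
  simp
  field_simp
  linear_combination (s ^ 2 - 2 * s * √2 + √2 ^ 2) * (-1) * hs2

/-- The torus normal is half the gradient of `coreDistSq`, so the normal behaviour of the disc can
be read off from this function. -/
theorem hasFDerivAt_coreDistSq {p : Space} (hp : 0 < p 0 ^ 2 + p 1 ^ 2) :
    HasFDerivAt coreDistSq (2 • innerSL ℝ (torusNormal p)) p := by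
  have hs : √(p 0 ^ 2 + p 1 ^ 2) ≠ 0 := (Real.sqrt_pos.2 hp).ne'
  have hi : ∀ i : Fin 3, HasFDerivAt (fun p : Space => p i) (EuclideanSpace.proj i : Space →L[ℝ] ℝ) p :=
    fun i => (EuclideanSpace.proj i : Space →L[ℝ] ℝ).hasFDerivAt
  have h1 := ((((((hi 0).pow 2).add ((hi 1).pow 2)).sqrt hp.ne').sub_const (√2)).pow 2).add
    ((hi 2).pow 2)
  refine h1.congr_fderiv ?_
  ext1 d
  simp [torusNormal, PiLp.inner_apply, Fin.sum_univ_three]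
  field_simp
  ring

theorem contDiffAt_torusNormal {n : ℕ∞ω} {p : Space} (hp : 0 < p 0 ^ 2 + p 1 ^ 2) :
    ContDiffAt ℝ n torusNormal p := by
  have hs : √(p 0 ^ 2 + p 1 ^ 2) ≠ 0 := (Real.sqrt_pos.2 hp).ne'
  have hi : ∀ i : Fin 3, ContDiffAt ℝ n (fun p : Space => p i) p :=
    fun i => (EuclideanSpace.proj i : Space →L[ℝ] ℝ).contDiff.contDiffAt
  have h1 : ContDiffAt ℝ n (fun p : Space => √(p 0 ^ 2 + p 1 ^ 2)) p :=
    (((hi 0).pow 2).add ((hi 1).pow 2)).sqrt hp.ne'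
  have h2 : ContDiffAt ℝ n (fun p : Space => p - axisProj p) p :=
    contDiffAt_id.sub axisProj.contDiff.contDiffAt
  have h3 : torusNormal = fun p => p - (√2 / √(p 0 ^ 2 + p 1 ^ 2)) • (p - axisProj p) := by
    funext p
    have : p - axisProj p = !₂[p 0, p 1, 0] := by ext i; fin_cases i <;> simp
    rw [torusNormal, this]
  rw [h3]
  exact contDiffAt_id.sub ((contDiffAt_const.div h1 hs).smul h2)

/-- Data on the boundary circle are extended constantly along rays, which is singular at the origin;
a radial cutoff removes the singularity and preserves nonnegativity. -/
theorem exists_plane_extension {f : Plane → ℝ} (hf : ContDiffOn ℝ 1 f {0}ᶜ) :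
    ∃ F : Plane → ℝ, ContDiff ℝ 1 F ∧ (∀ x ∈ sphere (0 : Plane) 1, F x = f x) ∧
      ((∀ x ≠ 0, 0 ≤ f x) → ∀ x, 0 ≤ F x) := by
  let χ : ContDiffBump (1 : ℝ) := ⟨1 / 4, 1 / 2, by norm_num, by norm_num⟩
  have hχ : ContDiff ℝ 1 fun p : Plane => χ (‖p‖ ^ 2) := χ.contDiff.comp (contDiff_norm_sq ℝ)
  have hz : ∀ p : Plane, ‖p‖ ^ 2 ≤ 1 / 2 → χ (‖p‖ ^ 2) = 0 := by
    intro p hp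
    apply χ.zero_of_le_dist
    change 1 / 2 ≤ _
    rw [Real.dist_eq, abs_sub_comm]
    exact le_trans (by linarith) (le_abs_self _)
  refine ⟨fun p => χ (‖p‖ ^ 2) * f p, ?_, fun x hx => ?_, fun h x => ?_⟩
  · rw [contDiff_iff_contDiffAt]
    intro p
    by_cases hp : p = 0
    · have : (fun p => χ (‖p‖ ^ 2) * f p) =ᶠ[𝓝 p] fun _ => 0 := by
        have : ball (0 : Plane) (1 / 2) ∈ 𝓝 p := by rw [hp]; exact ball_mem_nhds _ (by norm_num)
        filter_upwards [this] with x hx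
        rw [mem_ball_zero_iff] at hx
        rw [hz x (by nlinarith [norm_nonneg x]), zero_mul]
      exact contDiffAt_const.congr_of_eventuallyEq this
    · exact hχ.contDiffAt.mul (hf.contDiffAt (isOpen_compl_singleton.mem_nhds hp))
  · have : χ (‖x‖ ^ 2) = 1 := by
      rw [mem_sphere_zero_iff_norm.1 hx, one_pow]
      exact χ.one_of_mem_closedBall (mem_closedBall_self χ.rIn_pos.le)
    simp only [this, one_mul]
  · by_cases hx : x = 0
    · simp only [hx]
      rw [hz 0 (by norm_num), zero_mul]
    · exact mul_nonneg χ.nonneg (h x hx)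

theorem uniqueDiffOn_disc : UniqueDiffOn ℝ (closedBall (0 : Plane) 1) :=
  uniqueDiffOn_convex (convex_closedBall _ _)
    ⟨0, by rw [interior_closedBall _ one_ne_zero]; exact mem_ball_self one_pos⟩

theorem contDiffOn_unit {n : ℕ∞ω} : ContDiffOn ℝ n (fun x : Plane => ‖x‖⁻¹ • x) {0}ᶜ := by
  intro x hx
  exact (((contDiffAt_norm ℝ hx).inv (norm_ne_zero_iff.2 hx)).smul contDiffAt_id).contDiffWithinAt

theorem unit_mem_sphere {x : Plane} (hx : x ≠ 0) : ‖x‖⁻¹ • x ∈ sphere (0 : Plane) 1 := by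
  rw [mem_sphere_zero_iff_norm, norm_smul, norm_inv, norm_norm,
    inv_mul_cancel₀ (norm_ne_zero_iff.2 hx)]

theorem unit_of_mem_sphere {x : Plane} (hx : x ∈ sphere (0 : Plane) 1) : ‖x‖⁻¹ • x = x := by
  rw [mem_sphere_zero_iff_norm.1 hx, inv_one, one_smul]

theorem plane_decomp {x : Plane} (hx : x ∈ sphere (0 : Plane) 1) (v : Plane) :
    v = inner ℝ x v • x + inner ℝ (perp x) v • perp x := by
  have h := mem_sphere_zero_iff_norm.1 hx
  rw [EuclideanSpace.norm_eq, Real.sqrt_eq_one] at h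
  simp only [Fin.sum_univ_two, Real.norm_eq_abs, sq_abs] at h
  ext i
  fin_cases i
  · simp [PiLp.inner_apply, Fin.sum_univ_two]
    linear_combination (-v 0) * h
  · simp [PiLp.inner_apply, Fin.sum_univ_two]
    linear_combination (-v 1) * h

namespace IsSpanningDisc

variable {ρ : Plane → Space}

theorem hasFDerivWithinAt (hρ : IsSpanningDisc ρ) {x : Plane} (hx : x ∈ closedBall (0 : Plane) 1) :
    HasFDerivWithinAt ρ (fderivWithin ℝ ρ (closedBall 0 1) x) (closedBall 0 1) x :=
  ((hρ.contDiffOn.differentiableOn (by simp)) x hx).hasFDerivWithinAt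

theorem knot_facts (hρ : IsSpanningDisc ρ) {x : Plane} (hx : x ∈ sphere (0 : Plane) 1) :
    0 < ρ x 0 ^ 2 + ρ x 1 ^ 2 ∧ coreDistSq (ρ x) = 1 :=
  mem_knotZero_facts (hρ.bijOn_boundary.mapsTo hx)

theorem hasDerivAt_circle (x : Plane) : HasDerivAt (fun t : ℝ => rotP t x) (perp x) 0 := by
  have := (hasDerivAt_rotP 0).clm_apply (hasDerivAt_const 0 x)
  simpa [rotP_zero] using this

theorem hasDerivAt_boundary (hρ : IsSpanningDisc ρ) {x : Plane} (hx : x ∈ sphere (0 : Plane) 1) :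
    HasDerivAt (fun t : ℝ => ρ (rotP t x)) (fderivWithin ℝ ρ (closedBall 0 1) x (perp x)) 0 := by
  have h0 : rotP 0 x = x := rotP_zero x
  have h1 := hρ.hasFDerivWithinAt (sphere_subset_closedBall hx)
  have h2 := (hasDerivAt_circle x).hasDerivWithinAt (s := univ)
  have h3 := HasFDerivWithinAt.comp_hasDerivWithinAt (f := fun t : ℝ => rotP t x) (0 : ℝ)
    (by rw [h0]; exact h1) h2 (fun t _ => by
      rw [mem_closedBall_zero_iff, norm_rotP, mem_sphere_zero_iff_norm.1 hx])
  exact hasDerivWithinAt_univ.1 h3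

theorem inner_normal_tangent (hρ : IsSpanningDisc ρ) {x : Plane} (hx : x ∈ sphere (0 : Plane) 1) :
    inner ℝ (torusNormal (ρ x)) (fderivWithin ℝ ρ (closedBall 0 1) x (perp x)) = 0 := by
  have h0 : rotP 0 x = x := rotP_zero x
  have h1 := hasFDerivAt_coreDistSq (hρ.knot_facts hx).1
  have h2 := HasFDerivAt.comp_hasDerivAt (f := fun t : ℝ => ρ (rotP t x)) (0 : ℝ)
    (by rw [h0]; exact h1) (hρ.hasDerivAt_boundary hx)
  have h3 : (coreDistSq ∘ fun t : ℝ => ρ (rotP t x)) = fun _ => 1 := by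
    funext t
    refine (hρ.knot_facts ?_).2
    rw [mem_sphere_zero_iff_norm, norm_rotP, mem_sphere_zero_iff_norm.1 hx]
  rw [h3] at h2
  have h4 := h2.unique (hasDerivAt_const (0 : ℝ) (1 : ℝ))
  simpa using h4

/-- Moving inwards from the boundary of the disc leads to points outside the interior of the donut,
where `coreDistSq` is at least its boundary value `1`. -/
theorem inner_normal_radial_nonpos (hρ : IsSpanningDisc ρ) {x : Plane}
    (hx : x ∈ sphere (0 : Plane) 1) :
    inner ℝ (torusNormal (ρ x)) (fderivWithin ℝ ρ (closedBall 0 1) x x) ≤ 0 := by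
  have hn := mem_sphere_zero_iff_norm.1 hx
  have hg : HasDerivAt (fun t : ℝ => (1 - t) • x) (-x) 0 := by
    simpa using ((hasDerivAt_id (0 : ℝ)).const_sub 1).smul_const x
  have h0 : (1 - (0 : ℝ)) • x = x := by simp
  have h1 := hρ.hasFDerivWithinAt (sphere_subset_closedBall hx)
  have h2 := HasFDerivWithinAt.comp_hasDerivWithinAt (f := fun t : ℝ => (1 - t) • x) (0 : ℝ)
    (by rw [h0]; exact h1) (hg.hasDerivWithinAt (s := Icc 0 1)) (fun t ht => by
      rw [mem_closedBall_zero_iff, norm_smul, hn, mul_one, Real.norm_of_nonneg (by linarith [ht.2])]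
      linarith [ht.1])
  have h3 := HasFDerivAt.comp_hasDerivWithinAt (0 : ℝ)
    (by
      rw [Function.comp_apply, h0]
      exact hasFDerivAt_coreDistSq (hρ.knot_facts hx).1) h2
  obtain ⟨δ, hδ, hout⟩ := hρ.outside
  have key : ∀ t ∈ Icc (0 : ℝ) 1, t < δ → 1 ≤ coreDistSq (ρ ((1 - t) • x)) := by
    intro t ht htδ
    by_contra! hlt
    have hm : (1 - t) • x ∈ closedBall (0 : Plane) 1 := by
      rw [mem_closedBall_zero_iff, norm_smul, hn, mul_one, Real.norm_of_nonneg (by linarith [ht.2])]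
      linarith [ht.1]
    refine hout _ hm ?_ ?_
    · rw [norm_smul, hn, mul_one, Real.norm_of_nonneg (by linarith [ht.2])]
      linarith
    · have hc : Continuous coreDistSq := by unfold coreDistSq; fun_prop
      refine interior_maximal (t := {p | coreDistSq p < 1}) ?_ (isOpen_lt hc continuous_const) hlt
      intro p hp
      exact le_of_lt (α := ℝ) hp
  by_contra! hpos
  have hneg : (2 • innerSL ℝ (torusNormal (ρ x))) (fderivWithin ℝ ρ (closedBall 0 1) x (-x)) < 0 := by
    simpa using hpos
  have h4 := hasDerivWithinAt_iff_tendsto_slope.1 h3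
  have h5 : ∀ᶠ t in 𝓝[Icc (0 : ℝ) 1 \ {0}] 0, slope (coreDistSq ∘ ρ ∘ fun t : ℝ => (1 - t) • x) 0 t < 0 :=
    h4.eventually (gt_mem_nhds hneg)
  have h6 : ∀ᶠ t in 𝓝[>] (0 : ℝ), slope (coreDistSq ∘ ρ ∘ fun t : ℝ => (1 - t) • x) 0 t < 0 := by
    have : 𝓝[>] (0 : ℝ) ≤ 𝓝[Icc (0 : ℝ) 1 \ {0}] 0 := by
      rw [← nhdsWithin_Ioo_eq_nhdsGT (zero_lt_one : (0 : ℝ) < 1)]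
      exact nhdsWithin_mono _ fun t ht => ⟨⟨ht.1.le, ht.2.le⟩, ht.1.ne'⟩
    exact this h5
  have h7 : ∀ᶠ t in 𝓝[>] (0 : ℝ), t ∈ Ioo (0 : ℝ) (min δ 1) :=
    Ioo_mem_nhdsGT (lt_min hδ one_pos)
  obtain ⟨t, ht, ht'⟩ := (h6.and h7).exists
  have h8 := key t ⟨ht'.1.le, (ht'.2.trans_le (min_le_right _ _)).le⟩
    (ht'.2.trans_le (min_le_left _ _))
  rw [slope_def_field] at ht
  simp only [Function.comp_apply, sub_zero, one_smul, (hρ.knot_facts hx).2] at ht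
  have : 0 ≤ (coreDistSq (ρ ((1 - t) • x)) - 1) / t := div_nonneg (by linarith) ht'.1.le
  linarith

/-- The `1`-jet of the disc along its boundary. -/
theorem boundary_jet (hρ : IsSpanningDisc ρ) {x : Plane} (hx : x ∈ sphere (0 : Plane) 1)
    {L : Plane →L[ℝ] Space} (hL : L = fderivWithin ℝ ρ (closedBall 0 1) x) :
    inner ℝ (torusNormal (ρ x)) (L x) < 0 ∧ L (perp x) ≠ 0 ∧
    L (x - (inner ℝ (L x) (L (perp x)) / ‖L (perp x)‖ ^ 2) • perp x) =
      (inner ℝ (torusNormal (ρ x)) (L x)) • torusNormal (ρ x) := by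
  have hNT := hρ.inner_normal_tangent hx
  have hNR := hρ.inner_normal_radial_nonpos hx
  have hinj := hρ.injective_fderivWithin x (sphere_subset_closedBall hx)
  obtain ⟨v, hv⟩ := hρ.orthogonal x hx
  rw [← hL] at hNT hNR hinj hv
  have hNN : inner ℝ (torusNormal (ρ x)) (torusNormal (ρ x)) = (1 : ℝ) := by
    rw [real_inner_self_eq_norm_sq, norm_sq_torusNormal (hρ.knot_facts hx).1, (hρ.knot_facts hx).2]
  set N := torusNormal (ρ x) with hN
  have hT0 : L (perp x) ≠ 0 := by
    intro h
    have := (injective_iff_map_eq_zero L).1 hinj _ h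
    rw [← norm_eq_zero, norm_perp, mem_sphere_zero_iff_norm.1 hx] at this
    exact one_ne_zero this
  have hTT : ‖L (perp x)‖ ^ 2 ≠ 0 := by
    have := norm_ne_zero_iff.2 hT0
    positivity
  set p := inner ℝ x v
  set q := inner ℝ (perp x) v
  -- Orthogonality puts `N` in the tangent plane. Pairing this expansion with `N` shows that the
  -- radial derivative has a nonzero normal component, and pairing with the boundary tangent shows
  -- that `c` is exactly the shear needed to make the radial direction normal.
  have hNv : N = p • L x + q • L (perp x) := by
    rw [← map_smul, ← map_smul, ← map_add, ← plane_decomp hx v, hv]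
  have h1 : p * inner ℝ N (L x) = 1 := by
    rw [← hNN]
    conv_rhs => rw [hNv, inner_add_right, inner_smul_right, inner_smul_right]
    rw [← hNv, hNT]
    ring
  have h2 : p * inner ℝ (L x) (L (perp x)) + q * ‖L (perp x)‖ ^ 2 = 0 := by
    rw [← real_inner_self_eq_norm_sq, ← real_inner_smul_left, ← real_inner_smul_left,
      ← inner_add_left, ← hNv, hNT]
  have hne : inner ℝ N (L x) ≠ 0 := fun h => by rw [h, mul_zero] at h1; exact zero_ne_one h1
  refine ⟨lt_of_le_of_ne hNR hne, hT0, ?_⟩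
  set c := inner ℝ (L x) (L (perp x)) / ‖L (perp x)‖ ^ 2 with hc
  have h3 : q = -(p * c) := by
    rw [hc]; field_simp; linarith
  have h4 : inner ℝ N (L x) * p = 1 := by rw [mul_comm]; exact h1
  have h5 : inner ℝ N (L x) * -(p * c) = -c := by rw [mul_neg, ← mul_assoc, h4, one_mul]
  generalize inner ℝ N (L x) = s at h4 h5
  rw [map_sub, map_smul, hNv, h3, smul_add, smul_smul, smul_smul, h4, h5, one_smul, neg_smul,
    sub_eq_add_neg]

/-- After a reparametrization, the disc leaves the torus with constant normal speed. -/
theorem exists_normalized (hρ : IsSpanningDisc ρ) :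
    ∃ (G : Plane → Plane) (r' : Plane → Plane →L[ℝ] Space) (lam : ℝ), 0 < lam ∧
      ContinuousOn G (closedBall 0 1) ∧ BijOn G (closedBall 0 1) (closedBall 0 1) ∧
      MapsTo G (ball 0 1) (ball 0 1) ∧ (∀ x ∈ sphere (0 : Plane) 1, G x = x) ∧
      (∀ x ∈ closedBall (0 : Plane) 1, HasFDerivWithinAt (ρ ∘ G) (r' x) (closedBall 0 1) x) ∧
      ContinuousOn r' (closedBall 0 1) ∧
      (∀ x ∈ closedBall (0 : Plane) 1, Function.Injective (r' x)) ∧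
      ∀ x ∈ sphere (0 : Plane) 1, r' x x = -(lam • torusNormal (ρ x)) := by
  set D := closedBall (0 : Plane) 1 with hD
  let L : Plane → Plane →L[ℝ] Space := fderivWithin ℝ ρ D
  let u : Plane → Plane := fun x => ‖x‖⁻¹ • x
  have hu : ContDiffOn ℝ 1 u {0}ᶜ := contDiffOn_unit
  have hus : ∀ x ∈ ({0}ᶜ : Set Plane), u x ∈ sphere (0 : Plane) 1 := fun x hx => unit_mem_sphere hx
  have huD : MapsTo u {0}ᶜ D := fun x hx => sphere_subset_closedBall (hus x hx)
  have hL1 : ContDiffOn ℝ 1 L D :=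
    (hρ.contDiffOn.of_le (m := 2) ENat.LEInfty.out).fderivWithin uniqueDiffOn_disc
      one_add_one_eq_two.le
  have hLu : ContDiffOn ℝ 1 (fun x => L (u x)) {0}ᶜ := hL1.comp hu huD
  have hρu : ContDiffOn ℝ 1 (fun x => ρ (u x)) {0}ᶜ :=
    (hρ.contDiffOn.of_le (by simp)).comp hu huD
  have hNu : ContDiffOn ℝ 1 (fun x => torusNormal (ρ (u x))) {0}ᶜ := fun x hx =>
    ContDiffAt.comp_contDiffWithinAt (g := torusNormal) (f := fun x => ρ (u x)) x
      (contDiffAt_torusNormal (hρ.knot_facts (hus x hx)).1) (hρu x hx)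
  -- `b` is the normal speed at which the disc leaves the torus, extended constantly along rays.
  let b : Plane → ℝ := fun x => -inner ℝ (torusNormal (ρ (u x))) (L (u x) (u x))
  have hb : ContDiffOn ℝ 1 b {0}ᶜ := (hNu.inner ℝ (hLu.clm_apply hu)).neg
  have hb0 : ∀ x ∈ ({0}ᶜ : Set Plane), 0 < b x := fun x hx =>
    neg_pos.2 (hρ.boundary_jet (hus x hx) rfl).1
  have hpu : ContDiffOn ℝ 1 (fun x => L (u x) (perp (u x))) {0}ᶜ :=
    hLu.clm_apply (perp.contDiff.comp_contDiffOn hu)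
  let c₀ : Plane → ℝ := fun x => inner ℝ (L (u x) (u x)) (L (u x) (perp (u x))) /
    ‖L (u x) (perp (u x))‖ ^ 2
  have hc₀ : ContDiffOn ℝ 1 c₀ {0}ᶜ :=
    ((hLu.clm_apply hu).inner ℝ hpu).div (hpu.norm_sq ℝ) fun x hx =>
      pow_ne_zero 2 (norm_ne_zero_iff.2 (hρ.boundary_jet (hus x hx) rfl).2.1)
  have hsub : sphere (0 : Plane) 1 ⊆ {0}ᶜ := fun x hx =>
    norm_ne_zero_iff.1 (by rw [mem_sphere_zero_iff_norm.1 hx]; exact one_ne_zero)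
  obtain ⟨K, hK⟩ := (isCompact_sphere (0 : Plane) 1).exists_bound_of_continuousOn
    (hb.continuousOn.mono hsub)
  -- Only speeding up is allowed, as `exists_reparam` needs `0 ≤ a`; hence a constant that dominates
  -- `b`, and the factor `1 + a = lam / b` on the boundary.
  set lam : ℝ := max K 1 with hlam
  have hlam0 : 0 < lam := lt_of_lt_of_le one_pos (le_max_right _ _)
  have huu : ∀ x ∈ sphere (0 : Plane) 1, u x = x := fun x hx => unit_of_mem_sphere hx
  have hblam : ∀ x ∈ ({0}ᶜ : Set Plane), b x ≤ lam := by
    intro x hx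
    have h1 : b x = b (u x) := by simp only [b, huu _ (hus x hx)]
    rw [h1]
    exact (le_abs_self _).trans ((hK _ (hus x hx)).trans (le_max_left _ _))
  have ha₀ : ContDiffOn ℝ 1 (fun x => lam / b x - 1) {0}ᶜ :=
    (contDiffOn_const.div hb fun x hx => (hb0 x hx).ne').sub contDiffOn_const
  obtain ⟨a, ha, haS, hapos⟩ := exists_plane_extension ha₀
  obtain ⟨c, hc, hcS, -⟩ := exists_plane_extension hc₀
  have hann : ∀ x, 0 ≤ a x := hapos fun x hx => by
    rw [sub_nonneg, one_le_div (hb0 x hx)]; exact hblam x hx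
  obtain ⟨G, G', hG, cG', hGbij, hGball, hGS, hGinj, hGrad⟩ := exists_reparam ha hc hann
  have hGc : Continuous G := continuous_iff_continuousAt.2 fun x => (hG x).continuousAt
  refine ⟨G, fun x => (L (G x)).comp (G' x), lam, hlam0, hGc.continuousOn, hGbij, hGball, hGS,
    fun x hx => ?_, ?_, fun x hx => ?_, fun x hx => ?_⟩
  · exact (hρ.hasFDerivWithinAt (hGbij.mapsTo hx)).comp x (hG x).hasFDerivWithinAt hGbij.mapsTo
  · exact (hL1.continuousOn.comp hGc.continuousOn hGbij.mapsTo).clm_comp cG'.continuousOn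
  · exact (hρ.injective_fderivWithin _ (hGbij.mapsTo hx)).comp (hGinj x hx)
  · have hj := (hρ.boundary_jet hx (L := L x) rfl).2.2
    have hb1 := hb0 x (hsub hx)
    have e1 : b x = -inner ℝ (torusNormal (ρ x)) (L x x) := by simp only [b, huu x hx]
    have e2 : c x = inner ℝ (L x x) (L x (perp x)) / ‖L x (perp x)‖ ^ 2 := by
      rw [hcS x hx]; simp only [c₀, huu x hx]
    rw [ContinuousLinearMap.comp_apply, hGS x hx, hGrad x hx, map_smul, e2, hj, haS x hx, smul_smul,
      ← neg_smul, ← neg_neg (inner ℝ (torusNormal (ρ x)) (L x x)), ← e1]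
    congr 1
    field_simp
    ring

end IsSpanningDisc

/-! ### The profile of the annulus -/

/-- The derivative of the clamped cubic `clampCubic`. -/
def clampCubic' (t : ℝ) : ℝ := 3 / 2 * max 0 (1 - t ^ 2)

/-- The `C^1` function that is `(3 t - t ^ 3) / 2` on `[-1, 1]` and is constant outside. -/
def clampCubic (t : ℝ) : ℝ := ∫ s in (0 : ℝ)..t, clampCubic' s

theorem continuous_clampCubic' : Continuous clampCubic' := by unfold clampCubic'; fun_prop

theorem hasDerivAt_clampCubic (t : ℝ) : HasDerivAt clampCubic (clampCubic' t) t :=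
  intervalIntegral.integral_hasDerivAt_right (continuous_clampCubic'.intervalIntegrable _ _)
    (continuous_clampCubic'.stronglyMeasurableAtFilter _ _) continuous_clampCubic'.continuousAt

theorem clampCubic'_of_abs_lt {t : ℝ} (ht : |t| < 1) : 0 < clampCubic' t := by
  have : t ^ 2 < 1 := by rw [sq_lt_one_iff_abs_lt_one]; exact ht
  have := lt_max_of_lt_right (b := 0) (sub_pos.2 this)
  unfold clampCubic'
  positivity

theorem clampCubic'_of_one_le_abs {t : ℝ} (ht : 1 ≤ |t|) : clampCubic' t = 0 := by
  have : 1 ≤ t ^ 2 := by rw [one_le_sq_iff_one_le_abs]; exact ht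
  rw [clampCubic', max_eq_left (by linarith), mul_zero]

theorem clampCubic_of_abs_le {t : ℝ} (ht : |t| ≤ 1) : clampCubic t = (3 * t - t ^ 3) / 2 := by
  have h1 : ∀ s ∈ uIcc 0 t, clampCubic' s = 3 / 2 * (1 - s ^ 2) := by
    intro s hs
    have h2 : |s| ≤ |t| := by simpa using abs_sub_left_of_mem_uIcc hs
    have h3 : s ^ 2 ≤ 1 := by rw [sq_le_one_iff_abs_le_one]; exact h2.trans ht
    rw [clampCubic', max_eq_right (by linarith)]
  have h4 : ∀ s ∈ uIcc 0 t, HasDerivAt (fun s : ℝ => (3 * s - s ^ 3) / 2) (3 / 2 * (1 - s ^ 2)) s := by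
    intro s _
    refine ((((hasDerivAt_id s).const_mul 3).sub ((hasDerivAt_id s).pow 3)).div_const 2).congr_deriv ?_
    simp
    ring
  rw [clampCubic, intervalIntegral.integral_congr h1,
    intervalIntegral.integral_eq_sub_of_hasDerivAt h4
      (Continuous.intervalIntegrable (by fun_prop) _ _)]
  simp

theorem clampCubic_of_one_le {t : ℝ} (ht : 1 ≤ t) : clampCubic t = 1 := by
  have h1 : ∀ s ∈ uIcc 1 t, clampCubic' s = 0 := by
    intro s hs
    rw [uIcc_of_le ht] at hs
    exact clampCubic'_of_one_le_abs (hs.1.trans (le_abs_self _))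
  have h2 : clampCubic 1 = 1 := by rw [clampCubic_of_abs_le (by simp)]; norm_num
  have h3 : clampCubic t = clampCubic 1 + ∫ s in (1 : ℝ)..t, clampCubic' s :=
    (intervalIntegral.integral_add_adjacent_intervals
      (continuous_clampCubic'.intervalIntegrable _ _)
      (continuous_clampCubic'.intervalIntegrable _ _)).symm
  rw [h3, h2, intervalIntegral.integral_congr h1]
  simp

theorem clampCubic_neg (t : ℝ) : clampCubic (-t) = -clampCubic t := by
  have h : ∀ s, clampCubic' (-s) = clampCubic' s := fun s => by simp [clampCubic']
  have := intervalIntegral.integral_comp_neg (a := 0) (b := t) clampCubic'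
  simp only [h, neg_zero] at this
  rw [clampCubic, clampCubic, this, intervalIntegral.integral_symm]

theorem clampCubic_of_le_neg_one {t : ℝ} (ht : t ≤ -1) : clampCubic t = -1 := by
  rw [← neg_neg t, clampCubic_neg, clampCubic_of_one_le (by linarith)]

theorem continuous_clampCubic : Continuous clampCubic :=
  continuous_iff_continuousAt.2 fun t => (hasDerivAt_clampCubic t).continuousAt

/-- The cubic is chosen so that `1 - s ^ 2` has double zeros at the ends. Its square root is then
smooth in `t ^ 2` up to the ends, which makes the profile smooth where the neck meets the torus. -/
theorem one_sub_clampCubic_sq {t : ℝ} (ht : |t| ≤ 1) :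
    1 - clampCubic t ^ 2 = ((1 - t ^ 2) * √(4 - t ^ 2) / 2) ^ 2 := by
  have h3 : t ^ 2 ≤ 1 := by rw [sq_le_one_iff_abs_le_one]; exact ht
  have h4 := Real.sq_sqrt (show 0 ≤ 4 - t ^ 2 by linarith)
  rw [clampCubic_of_abs_le ht]
  linear_combination -(1 - t ^ 2) ^ 2 / 4 * h4

theorem abs_clampCubic_le (t : ℝ) : |clampCubic t| ≤ 1 := by
  rcases le_or_gt |t| 1 with h | h
  · rw [← sq_le_one_iff_abs_le_one]
    nlinarith [one_sub_clampCubic_sq h, sq_nonneg ((1 - t ^ 2) * √(4 - t ^ 2) / 2)]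
  · rcases lt_abs.1 h with h | h
    · rw [clampCubic_of_one_le h.le]; simp
    · rw [clampCubic_of_le_neg_one (by linarith)]; simp

theorem clampCubic_injOn : InjOn clampCubic (Icc (-1) 1) := by
  have : StrictMonoOn clampCubic (Icc (-1) 1) := by
    refine strictMonoOn_of_deriv_pos (convex_Icc _ _) continuous_clampCubic.continuousOn ?_
    intro t ht
    rw [interior_Icc] at ht
    rw [(hasDerivAt_clampCubic t).deriv]
    exact clampCubic'_of_abs_lt (abs_lt.2 ht)
  exact this.injOn

/-- Half of the angle by which the profile is rotated at a given height. -/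
def tilt (φ z₀ z : ℝ) : ℝ := Real.arcsin (Real.sin φ * clampCubic (z / z₀))

/-- The derivative of `tilt`. -/
def tilt' (φ z₀ z : ℝ) : ℝ :=
  (√(1 - (Real.sin φ * clampCubic (z / z₀)) ^ 2))⁻¹ * (Real.sin φ * (clampCubic' (z / z₀) / z₀))

section Tilt

variable {φ z₀ : ℝ}

theorem sin_mem (hφ : φ ∈ Ioo 0 (Real.pi / 2)) : Real.sin φ ∈ Ioo (0 : ℝ) 1 := by
  have h1 := Real.sin_pos_of_pos_of_lt_pi hφ.1 (by linarith [hφ.2, Real.pi_pos])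
  have h2 := Real.cos_pos_of_mem_Ioo ⟨by linarith [hφ.1, Real.pi_pos], hφ.2⟩
  exact ⟨h1, by nlinarith [Real.sin_sq_add_cos_sq φ]⟩

theorem cos_pos' (hφ : φ ∈ Ioo 0 (Real.pi / 2)) : 0 < Real.cos φ :=
  Real.cos_pos_of_mem_Ioo ⟨by linarith [hφ.1, Real.pi_pos], hφ.2⟩

theorem abs_sin_mul_lt (hφ : φ ∈ Ioo 0 (Real.pi / 2)) (t : ℝ) :
    |Real.sin φ * clampCubic t| < 1 := by
  have h := sin_mem hφ
  rw [abs_mul, abs_of_pos h.1]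
  nlinarith [abs_clampCubic_le t, h.1, h.2, abs_nonneg (clampCubic t)]

theorem hasDerivAt_tilt (hφ : φ ∈ Ioo 0 (Real.pi / 2)) (z : ℝ) :
    HasDerivAt (tilt φ z₀) (tilt' φ z₀ z) z := by
  have h1 : HasDerivAt (fun z => Real.sin φ * clampCubic (z / z₀))
      (Real.sin φ * (clampCubic' (z / z₀) / z₀)) z := by
    have := ((hasDerivAt_clampCubic (z / z₀)).comp z ((hasDerivAt_id z).div_const z₀)).const_mul
      (Real.sin φ)
    exact this.congr_deriv (by simp [div_eq_mul_inv])
  have h2 := abs_lt.1 (abs_sin_mul_lt hφ (z / z₀))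
  have h3 := (Real.hasDerivAt_arcsin h2.1.ne' h2.2.ne).comp z h1
  exact h3.congr_deriv (by rw [tilt', one_div])

theorem continuous_tilt' (hφ : φ ∈ Ioo 0 (Real.pi / 2)) : Continuous (tilt' φ z₀) := by
  have c1 := continuous_clampCubic
  have c2 := continuous_clampCubic'
  unfold tilt'
  refine Continuous.mul (Continuous.inv₀ (by fun_prop) fun z => ?_) (by fun_prop)
  have := (sq_lt_one_iff_abs_lt_one _).2 (abs_sin_mul_lt hφ (z / z₀))
  exact (Real.sqrt_pos.2 (by linarith)).ne'

theorem tilt'_pos (hφ : φ ∈ Ioo 0 (Real.pi / 2)) (hz₀ : 0 < z₀) {z : ℝ} (hz : |z| < z₀) :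
    0 < tilt' φ z₀ z := by
  have h1 := (sq_lt_one_iff_abs_lt_one _).2 (abs_sin_mul_lt hφ (z / z₀))
  have h2 : 0 < √(1 - (Real.sin φ * clampCubic (z / z₀)) ^ 2) := Real.sqrt_pos.2 (by linarith)
  have h3 := clampCubic'_of_abs_lt (t := z / z₀) (by
    rw [abs_div, abs_of_pos hz₀, div_lt_one hz₀]; exact hz)
  have h4 := (sin_mem hφ).1
  unfold tilt'
  positivity

theorem tilt'_eq_zero (hz₀ : 0 < z₀) {z : ℝ} (hz : z₀ ≤ |z|) : tilt' φ z₀ z = 0 := by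
  rw [tilt', clampCubic'_of_one_le_abs (t := z / z₀) (by
    rw [abs_div, abs_of_pos hz₀, one_le_div hz₀]; exact hz)]
  simp

theorem tilt_of_le (hφ : φ ∈ Ioo 0 (Real.pi / 2)) (hz₀ : 0 < z₀) {z : ℝ} (hz : z₀ ≤ z) :
    tilt φ z₀ z = φ := by
  rw [tilt, clampCubic_of_one_le ((one_le_div hz₀).2 hz), mul_one,
    Real.arcsin_sin (by linarith [hφ.1, Real.pi_pos]) hφ.2.le]

theorem tilt_neg (z : ℝ) : tilt φ z₀ (-z) = -tilt φ z₀ z := by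
  rw [tilt, neg_div, clampCubic_neg, mul_neg, Real.arcsin_neg, tilt]

theorem sin_tilt (hφ : φ ∈ Ioo 0 (Real.pi / 2)) (z : ℝ) :
    Real.sin (tilt φ z₀ z) = Real.sin φ * clampCubic (z / z₀) := by
  have h2 := abs_lt.1 (abs_sin_mul_lt hφ (z / z₀))
  exact Real.sin_arcsin h2.1.le h2.2.le

theorem abs_tilt_lt (hφ : φ ∈ Ioo 0 (Real.pi / 2)) (z : ℝ) : |tilt φ z₀ z| < Real.pi / 2 := by
  have h2 := abs_lt.1 (abs_sin_mul_lt hφ (z / z₀))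
  exact abs_lt.2 ⟨Real.neg_pi_div_two_lt_arcsin.2 h2.1, Real.arcsin_lt_pi_div_two.2 h2.2⟩

end Tilt

/-- The signed distance along the profile curve. -/
def profArg (τ w : ℝ) : ℝ := τ * ((1 - w) * √(4 - w) / 2)

/-- The distance of the profile curve from the core circle. -/
def prof (τ w : ℝ) : ℝ := √(1 + profArg τ w ^ 2) - profArg τ w

/-- The derivative of `prof`. -/
def prof' (τ w : ℝ) : ℝ :=
  (profArg τ w / √(1 + profArg τ w ^ 2) - 1) *
    (τ * (-√(4 - w) / 2 - (1 - w) / (4 * √(4 - w))))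

section Prof

variable {τ : ℝ}

theorem hasDerivAt_prof {w : ℝ} (hw : w < 4) : HasDerivAt (prof τ) (prof' τ w) w := by
  have h4 : 0 < √(4 - w) := Real.sqrt_pos.2 (by linarith)
  have h1 : HasDerivAt (profArg τ) (τ * (-√(4 - w) / 2 - (1 - w) / (4 * √(4 - w)))) w := by
    have h2 := ((((hasDerivAt_id w).const_sub 1).mul
      (((hasDerivAt_id w).const_sub 4).sqrt (by simp; linarith))).div_const 2).const_mul τ
    refine h2.congr_deriv ?_
    simp only [id]
    field_simp
    ring
  have h3 : (0 : ℝ) < 1 + profArg τ w ^ 2 := by positivity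
  have h5 := (((h1.pow 2).const_add 1).sqrt h3.ne').sub h1
  refine h5.congr_deriv ?_
  have h6 : 0 < √(1 + profArg τ w ^ 2) := Real.sqrt_pos.2 h3
  rw [prof']
  simp only [Nat.cast_ofNat, Nat.add_one_sub_one, pow_one, Pi.pow_apply]
  field_simp

theorem contDiffAt_prof {n : ℕ∞ω} {w : ℝ} (hw : w < 4) : ContDiffAt ℝ n (prof τ) w := by
  have h1 : ContDiffAt ℝ n (profArg τ) w := by
    unfold profArg
    have h2 : ContDiffAt ℝ n (fun w : ℝ => √(4 - w)) w :=
      (contDiffAt_const.sub contDiffAt_id).sqrt (by simp; linarith)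
    exact contDiffAt_const.mul (((contDiffAt_const.sub contDiffAt_id).mul h2).div_const 2)
  have h3 : (0 : ℝ) < 1 + profArg τ w ^ 2 := by positivity
  exact ((contDiffAt_const.add (h1.pow 2)).sqrt h3.ne').sub h1

theorem prof_pos (w : ℝ) : 0 < prof τ w := by
  rw [prof, sub_pos]
  apply Real.lt_sqrt_of_sq_lt
  linarith

theorem profArg_nonneg (hτ : 0 < τ) {w : ℝ} (hw : w ≤ 1) : 0 ≤ profArg τ w :=
  mul_nonneg hτ.le (div_nonneg (mul_nonneg (by linarith) (Real.sqrt_nonneg _)) two_pos.le)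

theorem prof_le_one (hτ : 0 < τ) {w : ℝ} (hw : w ≤ 1) : prof τ w ≤ 1 := by
  have h := profArg_nonneg hτ hw
  rw [prof, sub_le_iff_le_add, Real.sqrt_le_left (by linarith)]
  nlinarith

theorem prof_one : prof τ 1 = 1 := by simp [prof, profArg]

theorem prof'_pos (hτ : 0 < τ) {w : ℝ} (hw : w ≤ 1) : 0 < prof' τ w := by
  have h4 : 0 < √(4 - w) := Real.sqrt_pos.2 (by linarith)
  have h6 : 0 < √(1 + profArg τ w ^ 2) := Real.sqrt_pos.2 (by positivity)
  have h7 : profArg τ w / √(1 + profArg τ w ^ 2) < 1 := by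
    rw [div_lt_one h6]
    apply Real.lt_sqrt_of_sq_lt
    linarith
  have h8 : 0 ≤ (1 - w) / (4 * √(4 - w)) := div_nonneg (by linarith) (by positivity)
  apply mul_pos_of_neg_of_neg (by linarith)
  apply mul_neg_of_pos_of_neg hτ
  linarith

theorem prof'_one : prof' τ 1 = τ * √3 / 2 := by
  have : (4 : ℝ) - 1 = 3 := by norm_num
  simp [prof', profArg, this]
  ring

theorem prof_sq_add_one (w : ℝ) : prof τ w ^ 2 + 1 = 2 * prof τ w * √(1 + profArg τ w ^ 2) := by
  have := Real.sq_sqrt (show 0 ≤ 1 + profArg τ w ^ 2 by positivity)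
  rw [prof]
  linear_combination -this

/-- The profile is the arc that is orthogonal to the unit circle. -/
theorem prof_mem_arc {φ z₀ z : ℝ} (hφ : φ ∈ Ioo 0 (Real.pi / 2)) (hz : |z / z₀| ≤ 1) :
    (prof (Real.tan φ) ((z / z₀) ^ 2) ^ 2 + 1) * Real.cos φ =
      2 * prof (Real.tan φ) ((z / z₀) ^ 2) * Real.cos (tilt φ z₀ z) := by
  have hc := cos_pos' hφ
  -- Solving the arc equation for the distance `b` gives `b = √(1 + P ^ 2) - P` with `√(1 + P ^ 2) =
  -- cos (tilt) / cos φ`. Substituting `sin (tilt) = sin φ * s` yields `P ^ 2 = tan φ ^ 2 * (1 - s ^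
  -- 2)`, which is `profArg` squared.
  have h1 : √(1 + profArg (Real.tan φ) ((z / z₀) ^ 2) ^ 2) * Real.cos φ =
      Real.cos (tilt φ z₀ z) := by
    have h2 := abs_lt.1 (abs_tilt_lt (z₀ := z₀) hφ z)
    have h3 := Real.cos_pos_of_mem_Ioo (x := tilt φ z₀ z) ⟨by linarith [h2.1], h2.2⟩
    rw [← sq_eq_sq₀ (by positivity) h3.le, mul_pow, Real.sq_sqrt (by positivity), Real.cos_sq'
      (tilt φ z₀ z), sin_tilt hφ, profArg, mul_pow, ← one_sub_clampCubic_sq hz, add_mul, mul_right_comm,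
      ← mul_pow, Real.tan_mul_cos hc.ne']
    linear_combination Real.sin_sq_add_cos_sq φ
  rw [prof_sq_add_one, mul_assoc, h1]

end Prof

/-! ### The strip inside the solid donut -/

/-- The position of a point relative to the core circle, in the meridian half plane. -/
def coreVec (p : Space) : Plane := !₂[√(p 0 ^ 2 + p 1 ^ 2) - √2, p 2]

/-- The strip swept out by the points of the horizontal radius under the screw motion. -/
def strip (e : Plane) (b : ℝ) : Space :=
  !₂[(√2 + b * e 0) * (e 0 ^ 2 - e 1 ^ 2), (√2 + b * e 0) * (2 * e 0 * e 1), b * e 1]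

theorem norm_sq_coreVec (p : Space) : ‖coreVec p‖ ^ 2 = coreDistSq p := by
  rw [EuclideanSpace.norm_sq_eq]
  simp [coreVec, coreDistSq, Fin.sum_univ_two]

theorem contDiffAt_coreVec {n : ℕ∞ω} {p : Space} (hp : 0 < p 0 ^ 2 + p 1 ^ 2) :
    ContDiffAt ℝ n coreVec p := by
  have hi : ∀ i : Fin 3, ContDiffAt ℝ n (fun p : Space => p i) p :=
    fun i => (EuclideanSpace.proj i : Space →L[ℝ] ℝ).contDiff.contDiffAt
  have h1 : ContDiffAt ℝ n (fun p : Space => √(p 0 ^ 2 + p 1 ^ 2)) p :=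
    (((hi 0).pow 2).add ((hi 1).pow 2)).sqrt hp.ne'
  rw [contDiffAt_euclidean]
  intro i
  fin_cases i
  · exact h1.sub contDiffAt_const
  · exact hi 2

theorem contDiff_strip {n : ℕ∞ω} : ContDiff ℝ n fun a : Plane × ℝ => strip a.1 a.2 := by
  have hi : ∀ i : Fin 2, ContDiff ℝ n (fun a : Plane × ℝ => a.1 i) :=
    fun i => (EuclideanSpace.proj i : Plane →L[ℝ] ℝ).contDiff.comp contDiff_fst
  have h0 := hi 0
  have h1 := hi 1
  rw [contDiff_euclidean]
  intro i
  fin_cases i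
  · exact (contDiff_const.add (contDiff_snd.mul h0)).mul ((h0.pow 2).sub (h1.pow 2))
  · exact (contDiff_const.add (contDiff_snd.mul h0)).mul ((contDiff_const.mul h0).mul h1)
  · exact contDiff_snd.mul h1

theorem coreVec_rotZ (a : ℝ) (p : Space) : coreVec (rotZ a p) = coreVec p := by
  have : (rotZ a p) 0 ^ 2 + (rotZ a p) 1 ^ 2 = p 0 ^ 2 + p 1 ^ 2 := by
    simp [rotZ]
    linear_combination (p 0 ^ 2 + p 1 ^ 2) * Real.sin_sq_add_cos_sq a
  rw [coreVec, this, coreVec]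
  simp [rotZ]

/-- `coreVec` is constant along the orbits of the rotation, so transversality to the rotation field
can be tested after projecting to the meridian half plane. -/
theorem fderiv_coreVec_infRot {p : Space} (hp : 0 < p 0 ^ 2 + p 1 ^ 2) :
    fderiv ℝ coreVec p (infRot p) = 0 := by
  have h1 : HasDerivAt (fun t : ℝ => rotZ t p) (infRot p) 0 := by
    have := (hasDerivAt_rotL 0).clm_apply (hasDerivAt_const 0 p)
    simpa [rotL_apply, rotZ_zero] using this
  have h2 : HasFDerivAt coreVec (fderiv ℝ coreVec p) (rotZ 0 p) := by
    rw [rotZ_zero]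
    exact ((contDiffAt_coreVec (n := 1) hp).differentiableAt one_ne_zero).hasFDerivAt
  have h3 := HasFDerivAt.comp_hasDerivAt (0 : ℝ) h2 h1
  have h4 : (coreVec ∘ fun t : ℝ => rotZ t p) = fun _ => coreVec p :=
    funext fun t => coreVec_rotZ t p
  rw [h4] at h3
  exact h3.unique (hasDerivAt_const _ _)

theorem unit_sq {e : Plane} (he : ‖e‖ = 1) : e 0 ^ 2 + e 1 ^ 2 = 1 := by
  rw [EuclideanSpace.norm_eq, Real.sqrt_eq_one] at he
  simpa [Fin.sum_univ_two] using he

theorem strip_radius_pos {e : Plane} (he : ‖e‖ = 1) {b : ℝ} (hb : 0 < b) (hb' : b ≤ 1) :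
    0 < √2 + b * e 0 := by
  have h1 : |e 0| ≤ 1 := abs_le_one_of_sq_add_sq (unit_sq he).le
  have := one_lt_sqrt_two
  nlinarith [(abs_le.1 h1).1]

theorem strip_hor_sq {e : Plane} (he : ‖e‖ = 1) (b : ℝ) :
    (strip e b) 0 ^ 2 + (strip e b) 1 ^ 2 = (√2 + b * e 0) ^ 2 := by
  have h := unit_sq he
  simp [strip]
  linear_combination (√2 + b * e 0) ^ 2 * (e 0 ^ 2 + e 1 ^ 2 + 1) * h

theorem strip_hor_pos {e : Plane} (he : ‖e‖ = 1) {b : ℝ} (hb : 0 < b) (hb' : b ≤ 1) :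
    0 < (strip e b) 0 ^ 2 + (strip e b) 1 ^ 2 := by
  have := strip_radius_pos he hb hb'
  rw [strip_hor_sq he]
  positivity

theorem coreVec_strip {e : Plane} (he : ‖e‖ = 1) {b : ℝ} (hr : 0 < √2 + b * e 0) :
    coreVec (strip e b) = b • e := by
  rw [coreVec, strip_hor_sq he, Real.sqrt_sq hr.le]
  ext i
  fin_cases i <;> simp [strip]

/-- The double-angle formulas express the motion polynomially in the meridian direction `e`, which
is single-valued on the knot although `ψ` is not. -/
theorem screw_eq_strip (ψ b : ℝ) :
    screw ψ (b, 0) = strip !₂[Real.cos (ψ / 2), Real.sin (ψ / 2)] b := by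
  have h1 : Real.cos ψ = Real.cos (ψ / 2) ^ 2 - Real.sin (ψ / 2) ^ 2 := by
    rw [← Real.cos_two_mul', mul_div_cancel₀ _ two_ne_zero]
  have h2 : Real.sin ψ = 2 * Real.sin (ψ / 2) * Real.cos (ψ / 2) := by
    rw [← Real.sin_two_mul, mul_div_cancel₀ _ two_ne_zero]
  rw [screw_eq]
  ext i
  fin_cases i
  · simp [strip, h1]; ring
  · simp [strip, h2]; ring
  · simp [strip]; ring

theorem norm_cos_sin (a : ℝ) : ‖(!₂[Real.cos a, Real.sin a] : Plane)‖ = 1 := by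
  rw [EuclideanSpace.norm_eq, Real.sqrt_eq_one]
  simp [Fin.sum_univ_two]

theorem screw_add_two_pi (ψ : ℝ) (u : ℝ × ℝ) : screw (ψ + 2 * Real.pi) u = screw ψ (-u.1, -u.2) := by
  have h : (ψ + 2 * Real.pi) / 2 = ψ / 2 + Real.pi := by ring
  rw [screw_eq, screw_eq, h, Real.cos_add_pi, Real.sin_add_pi, Real.cos_add_two_pi,
    Real.sin_add_two_pi]
  ext i
  fin_cases i <;> simp

/-- Revolving by `2 * o` is advancing the screw by `2 * o` and turning the disc back by half that
angle. This turns points of the horizontal radius into points of the arcs, and so identifies the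
annulus with rotated copies of the strip. -/
theorem rotZ_screw (o ψ b : ℝ) : rotZ (2 * o) (screw ψ (b, 0)) =
    screw (ψ + 2 * o) (b * Real.cos o, -(b * Real.sin o)) := by
  have h : (ψ + 2 * o) / 2 = ψ / 2 + o := by ring
  have h1 : Real.cos ((ψ + 2 * o) / 2) * (b * Real.cos o) -
      Real.sin ((ψ + 2 * o) / 2) * -(b * Real.sin o) = Real.cos (ψ / 2) * b := by
    rw [h, Real.cos_add, Real.sin_add]
    linear_combination (Real.cos (ψ / 2) * b) * Real.sin_sq_add_cos_sq o
  have h2 : Real.sin ((ψ + 2 * o) / 2) * (b * Real.cos o) +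
      Real.cos ((ψ + 2 * o) / 2) * -(b * Real.sin o) = Real.sin (ψ / 2) * b := by
    rw [h, Real.cos_add, Real.sin_add]
    linear_combination (Real.sin (ψ / 2) * b) * Real.sin_sq_add_cos_sq o
  rw [screw_eq (ψ + 2 * o)]
  simp only [h1, h2]
  rw [screw_eq]
  ext i
  fin_cases i
  · simp [rotZ, Real.cos_add]; ring
  · simp [rotZ, Real.sin_add]; ring
  · simp [rotZ]

/-- The points of the knot, in terms of the meridian angle. -/
theorem exists_of_mem_knotZero {p : Space} (hp : p ∈ knotZero) : ∃ ψ, p = screw ψ (1, 0) := by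
  obtain ⟨ψ, h | h⟩ := hp
  · exact ⟨ψ, h⟩
  · refine ⟨ψ + 2 * Real.pi, ?_⟩
    rw [screw_add_two_pi, h, neg_zero]

theorem coreVec_screw (ψ : ℝ) : coreVec (screw ψ (1, 0)) = !₂[Real.cos (ψ / 2), Real.sin (ψ / 2)] := by
  rw [screw_eq_strip, coreVec_strip (norm_cos_sin _)
    (strip_radius_pos (norm_cos_sin _) one_pos le_rfl), one_smul]

theorem strip_coreVec {p : Space} (hp : p ∈ knotZero) : strip (coreVec p) 1 = p := by
  obtain ⟨ψ, rfl⟩ := exists_of_mem_knotZero hp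
  rw [coreVec_screw, ← screw_eq_strip]

/-- The strip is ruled by segments in the direction of the normal of the torus. -/
theorem strip_eq_add {p : Space} (hp : p ∈ knotZero) (b : ℝ) :
    strip (coreVec p) b = p + (b - 1) • torusNormal p := by
  have h1 := strip_coreVec hp
  have he : ‖coreVec p‖ = 1 := by
    rw [← sq_eq_sq₀ (norm_nonneg _) one_pos.le, norm_sq_coreVec, (mem_knotZero_facts hp).2, one_pow]
  have hs : √(p 0 ^ 2 + p 1 ^ 2) = √2 + 1 * coreVec p 0 := by simp [coreVec]
  have hpos := strip_radius_pos he one_pos le_rfl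
  set e := coreVec p
  have hp0 : p 0 = (√2 + 1 * e 0) * (e 0 ^ 2 - e 1 ^ 2) := by
    conv_lhs => rw [← h1]
    simp [strip]
  have hp1 : p 1 = (√2 + 1 * e 0) * (2 * e 0 * e 1) := by
    conv_lhs => rw [← h1]
    simp [strip]
  have hp2 : p 2 = e 1 := by
    conv_lhs => rw [← h1]
    simp [strip]
  rw [torusNormal, hs]
  have hne := hpos.ne'
  ext i
  fin_cases i
  · simp [strip] at hne ⊢
    rw [hp0]
    field_simp
    ring
  · simp [strip] at hne ⊢
    rw [hp1]
    field_simp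
    ring
  · simp [strip]
    rw [hp2]
    ring

/-! ### Gluing along a circle -/

/-- The plane is the union of two closed sets. The derivative within each is the prescribed one,
vacuously off the set and by agreement of values and derivatives on the common circle. -/
theorem hasFDerivAt_glue {r₀ : ℝ} {a b : Plane → Space}
    {a' b' : Plane → Plane →L[ℝ] Space}
    (ha : ∀ x ∈ closedBall (0 : Plane) r₀, HasFDerivWithinAt a (a' x) (closedBall 0 r₀) x)
    (hb : ∀ x, r₀ ≤ ‖x‖ → HasFDerivAt b (b' x) x)
    (hab : ∀ x ∈ sphere (0 : Plane) r₀, a x = b x)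
    (hab' : ∀ x ∈ sphere (0 : Plane) r₀, a' x = b' x) (x : Plane) :
    HasFDerivAt (fun x => if ‖x‖ ≤ r₀ then a x else b x) (if ‖x‖ ≤ r₀ then a' x else b' x) x := by
  have e1 : ∀ x : Plane, r₀ ≤ ‖x‖ → (if ‖x‖ ≤ r₀ then a x else b x) = b x := by
    intro x hx
    split_ifs with h
    · exact hab x (mem_sphere_zero_iff_norm.2 (le_antisymm h hx))
    · rfl
  have e2 : r₀ ≤ ‖x‖ → (if ‖x‖ ≤ r₀ then a' x else b' x) = b' x := by
    intro hx
    split_ifs with h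
    · exact hab' x (mem_sphere_zero_iff_norm.2 (le_antisymm h hx))
    · rfl
  have h1 : HasFDerivWithinAt (fun x => if ‖x‖ ≤ r₀ then a x else b x)
      (if ‖x‖ ≤ r₀ then a' x else b' x) (closedBall 0 r₀) x := by
    by_cases hx : ‖x‖ ≤ r₀
    · rw [if_pos hx]
      refine (ha x (mem_closedBall_zero_iff.2 hx)).congr (fun y hy => ?_) ?_
      · exact if_pos (mem_closedBall_zero_iff.1 hy)
      · exact if_pos hx
    · refine HasFDerivWithinAt.of_notMem_closure ?_
      rwa [isClosed_closedBall.closure_eq, mem_closedBall_zero_iff]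
  have hcl : IsClosed {x : Plane | r₀ ≤ ‖x‖} := isClosed_le continuous_const continuous_norm
  have h2 : HasFDerivWithinAt (fun x => if ‖x‖ ≤ r₀ then a x else b x)
      (if ‖x‖ ≤ r₀ then a' x else b' x) {x | r₀ ≤ ‖x‖} x := by
    by_cases hx : r₀ ≤ ‖x‖
    · rw [e2 hx]
      exact (hb x hx).hasFDerivWithinAt.congr e1 (e1 x hx)
    · refine HasFDerivWithinAt.of_notMem_closure ?_
      rwa [hcl.closure_eq]
  have h3 := h1.union h2
  have : closedBall (0 : Plane) r₀ ∪ {x | r₀ ≤ ‖x‖} = univ := by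
    ext y
    simp [le_total]
  rw [this] at h3
  exact hasFDerivWithinAt_univ.1 h3

theorem continuous_glue {E : Type*} [TopologicalSpace E] {r₀ : ℝ} {a b : Plane → E}
    (ha : ContinuousOn a (closedBall 0 r₀)) (hb : ContinuousOn b {x | r₀ ≤ ‖x‖})
    (hab : ∀ x ∈ sphere (0 : Plane) r₀, a x = b x) :
    Continuous fun x => if ‖x‖ ≤ r₀ then a x else b x := by
  refine continuous_if_le continuous_norm continuous_const ?_ hb
    fun x hx => hab x (mem_sphere_zero_iff_norm.2 hx)
  convert ha using 1
  ext x
  simp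

theorem radial_decomp {x : Plane} (hx : x ≠ 0) (v : Plane) :
    v = (inner ℝ x v / ‖x‖ ^ 2) • x + (inner ℝ (perp x) v / ‖x‖ ^ 2) • perp x := by
  have h : x 0 ^ 2 + x 1 ^ 2 ≠ 0 := by
    have := norm_ne_zero_iff.2 hx
    have h2 := EuclideanSpace.norm_sq_eq x
    simp only [Fin.sum_univ_two, Real.norm_eq_abs, sq_abs] at h2
    rw [← h2]
    positivity
  rw [EuclideanSpace.norm_sq_eq]
  ext i
  fin_cases i
  · simp [PiLp.inner_apply, Fin.sum_univ_two]
    field_simp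
    ring
  · simp [PiLp.inner_apply, Fin.sum_univ_two]
    field_simp
    ring

theorem ext_radial {x : Plane} (hx : x ≠ 0) {A B : Plane →L[ℝ] Space} (h1 : A x = B x)
    (h2 : A (perp x) = B (perp x)) : A = B := by
  ext1 v
  rw [radial_decomp hx v]
  simp only [map_add, map_smul, h1, h2]

theorem hasDerivAt_comp_rotP {f : Plane → Space} {f' : Plane →L[ℝ] Space} {x : Plane}
    (h : HasFDerivWithinAt f f' (closedBall 0 ‖x‖) x) :
    HasDerivAt (fun t => f (rotP t x)) (f' (perp x)) 0 := by
  have h2 := (IsSpanningDisc.hasDerivAt_circle x).hasDerivWithinAt (s := univ)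
  have h3 := HasFDerivWithinAt.comp_hasDerivWithinAt (f := fun t : ℝ => rotP t x) (0 : ℝ)
    (by rw [rotP_zero]; exact h) h2 (fun t _ => by rw [mem_closedBall_zero_iff, norm_rotP])
  exact hasDerivWithinAt_univ.1 h3

/-! ### The strip that continues the disc -/

/-- The meridian direction of the point of the knot in the direction `x`. -/
def edir (ρ : Plane → Space) (x : Plane) : Plane := coreVec (ρ (‖x‖⁻¹ • x))

/-- The width function of the strip. -/
def width (τ z₀ : ℝ) (x : Plane) : ℝ := prof τ ((1 - ‖x‖ ^ 2) / z₀ ^ 2)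

/-- The strip between the knot and the curve inside the solid donut. -/
def outer (ρ : Plane → Space) (τ z₀ : ℝ) (x : Plane) : Space := strip (edir ρ x) (width τ z₀ x)

theorem unit_smul_pos {t : ℝ} (ht : 0 < t) (x : Plane) : ‖t • x‖⁻¹ • t • x = ‖x‖⁻¹ • x := by
  rw [norm_smul, Real.norm_of_nonneg ht.le, smul_smul, mul_inv, mul_right_comm,
    inv_mul_cancel₀ ht.ne', one_mul]

theorem width_smul (τ z₀ t : ℝ) (x : Plane) :
    width τ z₀ (t • x) = prof τ ((1 - t ^ 2 * ‖x‖ ^ 2) / z₀ ^ 2) := by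
  rw [width, norm_smul, mul_pow, Real.norm_eq_abs, sq_abs]

theorem hasFDerivAt_width {τ z₀ : ℝ} {x : Plane} (hw : (1 - ‖x‖ ^ 2) / z₀ ^ 2 < 4) :
    HasFDerivAt (width τ z₀)
      ((prof' τ ((1 - ‖x‖ ^ 2) / z₀ ^ 2) * (-2 / z₀ ^ 2)) • innerSL ℝ x) x := by
  have h1 : HasFDerivAt (fun x : Plane => (1 - ‖x‖ ^ 2) / z₀ ^ 2)
      ((-2 / z₀ ^ 2) • innerSL ℝ x) x := by
    have := ((hasFDerivAt_id x).norm_sq.const_sub 1).mul_const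
      ((z₀ ^ 2)⁻¹)
    refine (this.congr_fderiv ?_)
    ext1 d
    simp
    ring
  have := (hasDerivAt_prof (τ := τ) hw).comp_hasFDerivAt x h1
  refine this.congr_fderiv ?_
  rw [smul_smul]

section Outer

variable {ρ : Plane → Space} {τ z₀ r₀ : ℝ}

theorem contDiffOn_edir (hρ : IsSpanningDisc ρ) : ContDiffOn ℝ 1 (edir ρ) {0}ᶜ := by
  have h1 : ContDiffOn ℝ 1 (fun x : Plane => ρ (‖x‖⁻¹ • x)) {0}ᶜ :=
    (hρ.contDiffOn.of_le (by simp)).comp contDiffOn_unit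
      fun x hx => sphere_subset_closedBall (unit_mem_sphere hx)
  intro x hx
  exact ContDiffAt.comp_contDiffWithinAt (g := coreVec) x
    (contDiffAt_coreVec (hρ.knot_facts (unit_mem_sphere hx)).1) (h1 x hx)

theorem hasFDerivAt_edir (hρ : IsSpanningDisc ρ) {x : Plane} (hx : x ≠ 0) :
    HasFDerivAt (edir ρ) (fderiv ℝ (edir ρ) x) x :=
  (((contDiffOn_edir hρ).contDiffAt (isOpen_compl_singleton.mem_nhds hx)).differentiableAt
    one_ne_zero).hasFDerivAt

theorem norm_edir (hρ : IsSpanningDisc ρ) {x : Plane} (hx : x ≠ 0) : ‖edir ρ x‖ = 1 := by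
  rw [← sq_eq_sq₀ (norm_nonneg _) one_pos.le, edir, norm_sq_coreVec,
    (hρ.knot_facts (unit_mem_sphere hx)).2, one_pow]

theorem strip_edir (hρ : IsSpanningDisc ρ) {x : Plane} (hx : x ≠ 0) (b : ℝ) :
    strip (edir ρ x) b = ρ (‖x‖⁻¹ • x) + (b - 1) • torusNormal (ρ (‖x‖⁻¹ • x)) :=
  strip_eq_add (hρ.bijOn_boundary.mapsTo (unit_mem_sphere hx)) b

theorem strip_edir_one (hρ : IsSpanningDisc ρ) {x : Plane} (hx : x ≠ 0) :
    strip (edir ρ x) 1 = ρ (‖x‖⁻¹ • x) := by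
  rw [strip_edir hρ hx, sub_self, zero_smul, add_zero]

theorem inner_fderiv_edir (hρ : IsSpanningDisc ρ) {x : Plane} (hx : x ≠ 0) (d : Plane) :
    inner ℝ (edir ρ x) (fderiv ℝ (edir ρ) x d) = 0 := by
  have h1 := (hasFDerivAt_edir hρ hx).norm_sq
  have h2 : HasFDerivAt (fun x => ‖edir ρ x‖ ^ 2) (0 : Plane →L[ℝ] ℝ) x := by
    refine (hasFDerivAt_const (1 : ℝ) x).congr_of_eventuallyEq ?_
    filter_upwards [isOpen_compl_singleton.mem_nhds hx] with y hy
    rw [norm_edir hρ hy, one_pow]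
  have := congrArg (fun A : Plane →L[ℝ] ℝ => A d) (h1.unique h2)
  simpa using this

/-- The boundary curve is recovered from its meridian direction through `strip`. If the direction
stood still to first order, so would the boundary curve, contrary to the immersion property. -/
theorem fderiv_edir_perp_ne_zero (hρ : IsSpanningDisc ρ) {x : Plane} (hx : x ≠ 0) :
    fderiv ℝ (edir ρ) x (perp x) ≠ 0 := by
  intro h
  have hu := unit_mem_sphere hx
  have h1 : HasDerivAt (fun t => edir ρ (rotP t x)) (fderiv ℝ (edir ρ) x (perp x)) 0 := by
    have := IsSpanningDisc.hasDerivAt_circle x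
    exact HasFDerivAt.comp_hasDerivAt (0 : ℝ)
      (by rw [rotP_zero]; exact hasFDerivAt_edir hρ hx) this
  rw [h] at h1
  have h2 : HasDerivAt (fun t => strip (edir ρ (rotP t x)) 1) 0 0 := by
    have h3 := ((contDiff_strip (n := 1)).differentiable one_ne_zero
      (edir ρ (rotP 0 x), (1 : ℝ))).hasFDerivAt
    have h4 := h1.prodMk (hasDerivAt_const (0 : ℝ) (1 : ℝ))
    have h5 := HasFDerivAt.comp_hasDerivAt (f := fun t => (edir ρ (rotP t x), (1 : ℝ))) (0 : ℝ) h3 h4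
    have h6 : ((0 : Plane), (0 : ℝ)) = 0 := rfl
    rw [h6, map_zero] at h5
    exact h5
  have h3 : (fun t => strip (edir ρ (rotP t x)) 1) = fun t => ρ (rotP t (‖x‖⁻¹ • x)) := by
    funext t
    have : rotP t x ≠ 0 := by
      rw [← norm_ne_zero_iff, norm_rotP]
      exact norm_ne_zero_iff.2 hx
    rw [strip_edir_one hρ this, norm_rotP, map_smul]
  rw [h3] at h2
  have h4 := (hρ.hasDerivAt_boundary hu).unique h2
  have h5 := (injective_iff_map_eq_zero _).1
    (hρ.injective_fderivWithin _ (sphere_subset_closedBall hu)) _ h4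
  rw [← norm_eq_zero, norm_perp, mem_sphere_zero_iff_norm.1 hu] at h5
  exact one_ne_zero h5

theorem contDiffOn_outer (hρ : IsSpanningDisc ρ) :
    ContDiffOn ℝ 1 (outer ρ τ z₀) ({0}ᶜ ∩ {x | (1 - ‖x‖ ^ 2) / z₀ ^ 2 < 4}) := by
  have h1 : ContDiffOn ℝ 1 (width τ z₀) ({0}ᶜ ∩ {x | (1 - ‖x‖ ^ 2) / z₀ ^ 2 < 4}) := by
    intro x hx
    have h2 : ContDiff ℝ 1 fun x : Plane => (1 - ‖x‖ ^ 2) / z₀ ^ 2 :=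
      (contDiff_const.sub (contDiff_norm_sq ℝ)).div_const _
    exact (ContDiffAt.comp x (contDiffAt_prof hx.2) h2.contDiffAt).contDiffWithinAt
  exact contDiff_strip.comp_contDiffOn
    (((contDiffOn_edir hρ).mono inter_subset_left).prodMk h1)

theorem isOpen_outer_domain :
    IsOpen (({0}ᶜ : Set Plane) ∩ {x | (1 - ‖x‖ ^ 2) / z₀ ^ 2 < 4}) :=
  isOpen_compl_singleton.inter (isOpen_lt (by fun_prop) continuous_const)

theorem width_arg_le_one (hz₀ : 0 < z₀) (h1 : r₀ ^ 2 + z₀ ^ 2 = 1) (hr₀ : 0 < r₀)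
    {x : Plane} (hx : r₀ ≤ ‖x‖) : (1 - ‖x‖ ^ 2) / z₀ ^ 2 ≤ 1 := by
  rw [div_le_one (by positivity)]
  nlinarith

theorem width_pos (x : Plane) : 0 < width τ z₀ x := prof_pos _

theorem width_le_one (hτ : 0 < τ) (hz₀ : 0 < z₀) (h1 : r₀ ^ 2 + z₀ ^ 2 = 1) (hr₀ : 0 < r₀)
    {x : Plane} (hx : r₀ ≤ ‖x‖) : width τ z₀ x ≤ 1 :=
  prof_le_one hτ (width_arg_le_one hz₀ h1 hr₀ hx)

theorem mem_outer_domain (hz₀ : 0 < z₀) (h1 : r₀ ^ 2 + z₀ ^ 2 = 1) (hr₀ : 0 < r₀)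
    {x : Plane} (hx : r₀ ≤ ‖x‖) : x ∈ ({0}ᶜ : Set Plane) ∩ {x | (1 - ‖x‖ ^ 2) / z₀ ^ 2 < 4} := by
  refine ⟨norm_pos_iff.1 (hr₀.trans_le hx), ?_⟩
  have := width_arg_le_one hz₀ h1 hr₀ hx
  change (1 - ‖x‖ ^ 2) / z₀ ^ 2 < 4
  linarith

theorem hasFDerivAt_outer (hρ : IsSpanningDisc ρ) (hz₀ : 0 < z₀) (h1 : r₀ ^ 2 + z₀ ^ 2 = 1)
    (hr₀ : 0 < r₀) {x : Plane} (hx : r₀ ≤ ‖x‖) :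
    HasFDerivAt (outer ρ τ z₀) (fderiv ℝ (outer ρ τ z₀) x) x :=
  (((contDiffOn_outer hρ).contDiffAt (isOpen_outer_domain.mem_nhds
    (mem_outer_domain hz₀ h1 hr₀ hx))).differentiableAt one_ne_zero).hasFDerivAt

/-- The strip is an immersion transverse to the rotation. -/
theorem eq_zero_of_fderiv_outer (hρ : IsSpanningDisc ρ) (hτ : 0 < τ) (hz₀ : 0 < z₀)
    (h1 : r₀ ^ 2 + z₀ ^ 2 = 1) (hr₀ : 0 < r₀) {x : Plane} (hx : r₀ ≤ ‖x‖) {d : Plane} {μ : ℝ}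
    (h : fderiv ℝ (outer ρ τ z₀) x d = μ • infRot (outer ρ τ z₀ x)) : d = 0 := by
  have hx0 : x ≠ 0 := norm_pos_iff.1 (hr₀.trans_le hx)
  have he := norm_edir hρ hx0
  have hb := width_pos (τ := τ) (z₀ := z₀) x
  have hb' := width_le_one hτ hz₀ h1 hr₀ hx
  have hw := width_arg_le_one hz₀ h1 hr₀ hx
  have hout := hasFDerivAt_outer (τ := τ) hρ hz₀ h1 hr₀ hx
  have hpos : 0 < (outer ρ τ z₀ x) 0 ^ 2 + (outer ρ τ z₀ x) 1 ^ 2 := strip_hor_pos he hb hb'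
  have hwd := hasFDerivAt_width (τ := τ) (z₀ := z₀) (x := x) (by linarith)
  have hed := hasFDerivAt_edir hρ hx0
  have hc : HasFDerivAt coreVec (fderiv ℝ coreVec (outer ρ τ z₀ x)) (outer ρ τ z₀ x) :=
    ((contDiffAt_coreVec (n := 1) hpos).differentiableAt one_ne_zero).hasFDerivAt
  have h2 := hc.comp x hout
  have h3 : HasFDerivAt (coreVec ∘ outer ρ τ z₀)
      (width τ z₀ x • fderiv ℝ (edir ρ) x + ((prof' τ ((1 - ‖x‖ ^ 2) / z₀ ^ 2) *
        (-2 / z₀ ^ 2)) • innerSL ℝ x).smulRight (edir ρ x)) x := by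
    refine (hwd.smul hed).congr_of_eventuallyEq ?_
    have hcont : ContinuousAt (fun y => √2 + width τ z₀ y * edir ρ y 0) x := by
      have c1 := hwd.continuousAt
      have c2 := (EuclideanSpace.proj 0 : Plane →L[ℝ] ℝ).continuous.continuousAt.comp hed.continuousAt
      exact continuousAt_const.add (c1.mul c2)
    filter_upwards [isOpen_compl_singleton.mem_nhds hx0,
      hcont.eventually (lt_mem_nhds (strip_radius_pos he hb hb'))] with y hy hy'
    exact coreVec_strip (norm_edir hρ hy) hy'
  -- In the meridian half plane the strip is `width • edir` in polar form and the rotation term is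
  -- gone. The component along `edir` forces `d` to be tangential, as the width is strictly monotone
  -- in the radius; the remaining component then forces `d = 0`.
  have h4 := congrArg (fun A : Plane →L[ℝ] Plane => A d) (h2.unique h3)
  rw [ContinuousLinearMap.comp_apply, h, map_smul, fderiv_coreVec_infRot hpos, smul_zero] at h4
  simp only [add_apply, smul_apply,
    ContinuousLinearMap.smulRight_apply, innerSL_apply_apply, smul_eq_mul] at h4
  set c := prof' τ ((1 - ‖x‖ ^ 2) / z₀ ^ 2) * (-2 / z₀ ^ 2) with hcdef
  have hc0 : c ≠ 0 := by
    have := prof'_pos hτ hw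
    have h5 : -2 / z₀ ^ 2 ≠ 0 := div_ne_zero (by norm_num) (by positivity)
    exact mul_ne_zero this.ne' h5
  have h5 : c * inner ℝ x d = 0 := by
    have := congrArg (fun v => inner ℝ (edir ρ x) v) h4
    simp only [inner_zero_right, inner_add_right, inner_smul_right, inner_fderiv_edir hρ hx0,
      real_inner_self_eq_norm_sq, he] at this
    linarith
  rw [h5, zero_smul, add_zero] at h4
  have h6 : fderiv ℝ (edir ρ) x d = 0 := (smul_eq_zero.1 h4.symm).resolve_left hb.ne'
  have h7 : inner ℝ x d = 0 := (mul_eq_zero.1 h5).resolve_left hc0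
  have h8 := radial_decomp hx0 d
  rw [h7, zero_div, zero_smul, zero_add] at h8
  rw [h8, map_smul] at h6
  have h9 := (smul_eq_zero.1 h6).resolve_right (fderiv_edir_perp_ne_zero hρ hx0)
  rw [h8, h9, zero_smul]

theorem infRot_ne_zero {p : Space} (hp : 0 < p 0 ^ 2 + p 1 ^ 2) : infRot p ≠ 0 := by
  intro h
  have h0 := congrArg (fun v : Space => v 0) h
  have h1 := congrArg (fun v : Space => v 1) h
  simp at h0 h1
  simp [h0, h1] at hp

end Outer

/-! ### The disc continued by the strip -/

/-- `ρ ∘ G` is a reparametrization of the disc `ρ`, fixed on the boundary, that leaves the torus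
with constant normal speed `lam`. -/
structure IsNormalized (ρ : Plane → Space) (G : Plane → Plane) (r' : Plane → Plane →L[ℝ] Space)
    (lam : ℝ) : Prop where
  pos : 0 < lam
  cont : ContinuousOn G (closedBall 0 1)
  bij : BijOn G (closedBall 0 1) (closedBall 0 1)
  ball : MapsTo G (ball 0 1) (ball 0 1)
  fixed : ∀ x ∈ sphere (0 : Plane) 1, G x = x
  deriv : ∀ x ∈ closedBall (0 : Plane) 1, HasFDerivWithinAt (ρ ∘ G) (r' x) (closedBall 0 1) x
  cont' : ContinuousOn r' (closedBall 0 1)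
  inj : ∀ x ∈ closedBall (0 : Plane) 1, Function.Injective (r' x)
  radial : ∀ x ∈ sphere (0 : Plane) 1, r' x x = -(lam • torusNormal (ρ x))

theorem IsSpanningDisc.exists_isNormalized {ρ : Plane → Space} (hρ : IsSpanningDisc ρ) :
    ∃ G r' lam, IsNormalized ρ G r' lam := by
  obtain ⟨G, r', lam, h1, h2, h3, h4, h5, h6, h7, h8, h9⟩ := hρ.exists_normalized
  exact ⟨G, r', lam, h1, h2, h3, h4, h5, h6, h7, h8, h9⟩

/-- The parameters of the neck: the strip is parametrized by `r₀ ≤ ‖x‖ ≤ 1`, it is rotated at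
heights at most `z₀`, and its width leaves the boundary with the speed `lam`. -/
structure IsNeck (lam φ r₀ z₀ : ℝ) : Prop where
  angle : φ ∈ Ioo 0 (Real.pi / 2)
  pos_radius : 0 < r₀
  pos_height : 0 < z₀
  sum_sq : r₀ ^ 2 + z₀ ^ 2 = 1
  slope : lam * z₀ ^ 2 = √3 * Real.tan φ * r₀ ^ 2

/-- The two conditions are linear equations for `r₀ ^ 2` and `z₀ ^ 2`, with a positive solution. -/
theorem exists_isNeck {lam φ : ℝ} (hl : 0 < lam) (hφ : φ ∈ Ioo 0 (Real.pi / 2)) :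
    ∃ r₀ z₀, IsNeck lam φ r₀ z₀ := by
  have ht := Real.tan_pos_of_pos_of_lt_pi_div_two hφ.1 hφ.2
  have h3 : 0 < √3 * Real.tan φ := by positivity
  set k := √3 * Real.tan φ with hk
  refine ⟨√(lam / (lam + k)), √(k / (lam + k)), hφ, by positivity, by positivity, ?_, ?_⟩
  · rw [Real.sq_sqrt (by positivity), Real.sq_sqrt (by positivity)]
    field_simp
  · rw [Real.sq_sqrt (by positivity), Real.sq_sqrt (by positivity), ← hk]
    field_simp

/-- The disc `ρ ∘ G`, continued by the strip. -/
def pillowDisc (ρ : Plane → Space) (G : Plane → Plane) (τ r₀ z₀ : ℝ) (x : Plane) : Space :=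
  if ‖x‖ ≤ r₀ then ρ (G (r₀⁻¹ • x)) else outer ρ τ z₀ x

/-- The derivative of `pillowDisc`. -/
def pillowDisc' (ρ : Plane → Space) (r' : Plane → Plane →L[ℝ] Space) (τ r₀ z₀ : ℝ) (x : Plane) :
    Plane →L[ℝ] Space :=
  if ‖x‖ ≤ r₀ then r₀⁻¹ • r' (r₀⁻¹ • x) else fderiv ℝ (outer ρ τ z₀) x

section PillowDisc

variable {ρ : Plane → Space} {G : Plane → Plane} {r' : Plane → Plane →L[ℝ] Space}
  {lam φ r₀ z₀ : ℝ}

theorem IsNeck.tan_pos (H : IsNeck lam φ r₀ z₀) : 0 < Real.tan φ :=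
  Real.tan_pos_of_pos_of_lt_pi_div_two H.angle.1 H.angle.2

theorem IsNeck.inv_smul_mem (H : IsNeck lam φ r₀ z₀) {x : Plane} :
    r₀⁻¹ • x ∈ closedBall (0 : Plane) 1 ↔ x ∈ closedBall (0 : Plane) r₀ := by
  rw [mem_closedBall_zero_iff, mem_closedBall_zero_iff, norm_smul, norm_inv,
    Real.norm_of_nonneg H.pos_radius.le, inv_mul_le_one₀ H.pos_radius]

theorem inv_norm_smul_of_mem_sphere {x : Plane} (hx : x ∈ sphere (0 : Plane) r₀) :
    ‖x‖⁻¹ • x = r₀⁻¹ • x := by rw [mem_sphere_zero_iff_norm.1 hx]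

theorem IsNeck.ne_zero (H : IsNeck lam φ r₀ z₀) {x : Plane} (hx : r₀ ≤ ‖x‖) : x ≠ 0 :=
  norm_pos_iff.1 (H.pos_radius.trans_le hx)

theorem IsNeck.arg_eq (H : IsNeck lam φ r₀ z₀) {x : Plane} (hx : x ∈ sphere (0 : Plane) r₀) :
    (1 - ‖x‖ ^ 2) / z₀ ^ 2 = 1 := by
  have := H.pos_height
  rw [mem_sphere_zero_iff_norm.1 hx, div_eq_one_iff_eq (by positivity)]
  linarith [H.sum_sq]

theorem outer_eq_inner (hρ : IsSpanningDisc ρ) (hG : IsNormalized ρ G r' lam)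
    (H : IsNeck lam φ r₀ z₀) {x : Plane} (hx : x ∈ sphere (0 : Plane) r₀) :
    ρ (G (r₀⁻¹ • x)) = outer ρ (Real.tan φ) z₀ x := by
  have hx0 : x ≠ 0 := H.ne_zero (mem_sphere_zero_iff_norm.1 hx).ge
  rw [outer, width, H.arg_eq hx, prof_one, strip_edir_one hρ hx0, inv_norm_smul_of_mem_sphere hx, hG.fixed]
  rw [← inv_norm_smul_of_mem_sphere hx]
  exact unit_mem_sphere hx0

theorem hasFDerivWithinAt_inner (hG : IsNormalized ρ G r' lam)
    (H : IsNeck lam φ r₀ z₀) {x : Plane} (hx : x ∈ closedBall (0 : Plane) r₀) :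
    HasFDerivWithinAt (fun x => ρ (G (r₀⁻¹ • x))) (r₀⁻¹ • r' (r₀⁻¹ • x)) (closedBall 0 r₀) x := by
  have h1 : HasFDerivWithinAt (fun x : Plane => r₀⁻¹ • x) (r₀⁻¹ • ContinuousLinearMap.id ℝ Plane)
      (closedBall 0 r₀) x := (hasFDerivWithinAt_id x _).const_smul r₀⁻¹
  have h2 := (hG.deriv _ (H.inv_smul_mem.2 hx)).comp x h1 fun y hy => H.inv_smul_mem.2 hy
  refine h2.congr_fderiv ?_
  ext1 d
  simp

/-- Along a ray the strip runs along the torus normal, and the chain rule gives the speed `tan φ *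
√3 / 2 * (-2 * r₀ ^ 2 / z₀ ^ 2)`. The slope condition of the neck says that this is `-lam`. -/
theorem fderiv_outer_radial (hρ : IsSpanningDisc ρ) (H : IsNeck lam φ r₀ z₀) {x : Plane}
    (hx : x ∈ sphere (0 : Plane) r₀) :
    fderiv ℝ (outer ρ (Real.tan φ) z₀) x x = -(lam • torusNormal (ρ (r₀⁻¹ • x))) := by
  have hxn := mem_sphere_zero_iff_norm.1 hx
  have hx0 : x ≠ 0 := H.ne_zero hxn.ge
  have hz := H.pos_height
  have hout := hasFDerivAt_outer (τ := Real.tan φ) hρ H.pos_height H.sum_sq H.pos_radius hxn.ge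
  have h1 : HasDerivAt (fun t : ℝ => t • x) x 1 := by
    simpa using (hasDerivAt_id (1 : ℝ)).smul_const x
  have h2 := HasFDerivAt.comp_hasDerivAt (f := fun t : ℝ => t • x) (1 : ℝ)
    (by rw [one_smul]; exact hout) h1
  have ha : HasDerivAt (fun t : ℝ => (1 - t ^ 2 * r₀ ^ 2) / z₀ ^ 2) (-(2 * r₀ ^ 2) / z₀ ^ 2) 1 := by
    have := ((((hasDerivAt_pow 2 (1 : ℝ)).mul_const (r₀ ^ 2)).const_sub 1).div_const (z₀ ^ 2))
    refine this.congr_deriv ?_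
    simp
  have harg : (1 - (1 : ℝ) ^ 2 * r₀ ^ 2) / z₀ ^ 2 = 1 := by
    have := H.arg_eq hx
    rw [hxn] at this
    rw [one_pow, one_mul, this]
  have hp : HasDerivAt (prof (Real.tan φ)) (Real.tan φ * √3 / 2)
      ((1 - (1 : ℝ) ^ 2 * r₀ ^ 2) / z₀ ^ 2) := by
    rw [harg, ← prof'_one]
    exact hasDerivAt_prof (by norm_num)
  have h3 := (((hp.comp (1 : ℝ) ha).sub_const 1).smul_const
    (torusNormal (ρ (r₀⁻¹ • x)))).const_add (ρ (r₀⁻¹ • x))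
  have h4 : HasDerivAt (outer ρ (Real.tan φ) z₀ ∘ fun t : ℝ => t • x)
      ((Real.tan φ * √3 / 2 * (-(2 * r₀ ^ 2) / z₀ ^ 2)) • torusNormal (ρ (r₀⁻¹ • x))) 1 := by
    refine h3.congr_of_eventuallyEq ?_
    filter_upwards [lt_mem_nhds (zero_lt_one (α := ℝ))] with t ht
    have ht0 : t • x ≠ 0 := smul_ne_zero ht.ne' hx0
    simp only [Function.comp_apply]
    rw [outer, strip_edir hρ ht0, unit_smul_pos ht, inv_norm_smul_of_mem_sphere hx, width_smul, hxn]
  rw [h2.unique h4, ← neg_smul]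
  congr 1
  field_simp
  linarith [H.slope]

/-- Radially both derivatives are `-lam` times the torus normal; tangentially they agree because the
two maps coincide on the circle. -/
theorem fderiv_outer_eq_inner (hρ : IsSpanningDisc ρ) (hG : IsNormalized ρ G r' lam)
    (H : IsNeck lam φ r₀ z₀) {x : Plane} (hx : x ∈ sphere (0 : Plane) r₀) :
    r₀⁻¹ • r' (r₀⁻¹ • x) = fderiv ℝ (outer ρ (Real.tan φ) z₀) x := by
  have hxn := mem_sphere_zero_iff_norm.1 hx
  have hx0 : x ≠ 0 := H.ne_zero hxn.ge
  have hxu : r₀⁻¹ • x ∈ sphere (0 : Plane) 1 := by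
    rw [← inv_norm_smul_of_mem_sphere hx]; exact unit_mem_sphere hx0
  refine ext_radial hx0 ?_ ?_
  · rw [fderiv_outer_radial hρ H hx, smul_apply, ← map_smul, hG.radial _ hxu]
  · have h1 := hasDerivAt_comp_rotP (x := x) (by
      rw [hxn]; exact hasFDerivWithinAt_inner hG H (sphere_subset_closedBall hx))
    have h2 := hasDerivAt_comp_rotP (x := x) (hasFDerivAt_outer (τ := Real.tan φ) hρ H.pos_height
      H.sum_sq H.pos_radius hxn.ge).hasFDerivWithinAt
    have h3 : (fun t => ρ (G (r₀⁻¹ • rotP t x))) =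
        fun t => outer ρ (Real.tan φ) z₀ (rotP t x) := by
      funext t
      refine outer_eq_inner hρ hG H ?_
      rw [mem_sphere_zero_iff_norm, norm_rotP, hxn]
    rw [h3] at h1
    exact h1.unique h2

theorem hasFDerivAt_pillowDisc (hρ : IsSpanningDisc ρ) (hG : IsNormalized ρ G r' lam)
    (H : IsNeck lam φ r₀ z₀) (x : Plane) :
    HasFDerivAt (pillowDisc ρ G (Real.tan φ) r₀ z₀) (pillowDisc' ρ r' (Real.tan φ) r₀ z₀ x) x :=
  hasFDerivAt_glue (fun _ hx => hasFDerivWithinAt_inner hG H hx)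
    (fun _ hx => hasFDerivAt_outer hρ H.pos_height H.sum_sq H.pos_radius hx)
    (fun _ hx => outer_eq_inner hρ hG H hx) (fun _ hx => fderiv_outer_eq_inner hρ hG H hx) x

theorem continuous_pillowDisc' (hρ : IsSpanningDisc ρ) (hG : IsNormalized ρ G r' lam)
    (H : IsNeck lam φ r₀ z₀) : Continuous (pillowDisc' ρ r' (Real.tan φ) r₀ z₀) := by
  refine continuous_glue ?_ ?_ fun _ hx => fderiv_outer_eq_inner hρ hG H hx
  · have h : ContinuousOn (fun x : Plane => r' (r₀⁻¹ • x)) (closedBall 0 r₀) :=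
      hG.cont'.comp (by fun_prop) fun x hx => H.inv_smul_mem.2 hx
    exact h.const_smul r₀⁻¹
  · exact ((contDiffOn_outer hρ).continuousOn_fderiv_of_isOpen isOpen_outer_domain le_rfl).mono
      fun x hx => mem_outer_domain H.pos_height H.sum_sq H.pos_radius hx

theorem pillowDisc_of_ge (hρ : IsSpanningDisc ρ) (hG : IsNormalized ρ G r' lam)
    (H : IsNeck lam φ r₀ z₀) {x : Plane} (hx : r₀ ≤ ‖x‖) :
    pillowDisc ρ G (Real.tan φ) r₀ z₀ x = outer ρ (Real.tan φ) z₀ x := by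
  rw [pillowDisc]
  split_ifs with h
  · exact outer_eq_inner hρ hG H (mem_sphere_zero_iff_norm.2 (le_antisymm h hx))
  · rfl

theorem pillowDisc'_of_ge (hρ : IsSpanningDisc ρ) (hG : IsNormalized ρ G r' lam)
    (H : IsNeck lam φ r₀ z₀) {x : Plane} (hx : r₀ ≤ ‖x‖) :
    pillowDisc' ρ r' (Real.tan φ) r₀ z₀ x = fderiv ℝ (outer ρ (Real.tan φ) z₀) x := by
  rw [pillowDisc']
  split_ifs with h
  · exact fderiv_outer_eq_inner hρ hG H (mem_sphere_zero_iff_norm.2 (le_antisymm h hx))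
  · rfl

theorem IsNeck.radius_lt_one (H : IsNeck lam φ r₀ z₀) : r₀ < 1 := by
  nlinarith [H.pos_height, H.pos_radius, H.sum_sq]

/-- On the sphere, the disc `‖hor q‖ ≤ r₀` lies over the heights at least `z₀`. -/
theorem IsNeck.le_abs_ver_iff (H : IsNeck lam φ r₀ z₀) {q : Space}
    (hq : q ∈ sphere (0 : Space) 1) : z₀ ≤ |ver q| ↔ ‖hor q‖ ≤ r₀ := by
  have := norm_sq_eq_hor_add_ver q
  rw [mem_sphere_zero_iff_norm.1 hq] at this
  rw [← abs_of_pos H.pos_height, ← sq_le_sq, ← sq_le_sq₀ (norm_nonneg _) H.pos_radius.le]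
  constructor <;> intro h <;> linarith [H.sum_sq]

/-- Over the caps the tilt is constant and the disc is immersed. Over the neck the strip is
transverse to the rotation field, so the two terms of the shear condition must vanish separately.
The boundary of the pillow disc lies in the strip, which also gives the transversality there. -/
theorem isPillow_pillowDisc (hρ : IsSpanningDisc ρ) (hG : IsNormalized ρ G r' lam)
    (H : IsNeck lam φ r₀ z₀) :
    IsPillow (pillowDisc ρ G (Real.tan φ) r₀ z₀) (pillowDisc' ρ r' (Real.tan φ) r₀ z₀)
      (tilt φ z₀) (tilt' φ z₀) := by
  have key : ∀ x : Plane, r₀ ≤ ‖x‖ → ∀ (d : Plane) (μ : ℝ), pillowDisc' ρ r' (Real.tan φ) r₀ z₀ x d =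
      μ • infRot (pillowDisc ρ G (Real.tan φ) r₀ z₀ x) → d = 0 := by
    intro x hx d μ h
    rw [pillowDisc_of_ge hρ hG H hx, pillowDisc'_of_ge hρ hG H hx] at h
    exact eq_zero_of_fderiv_outer hρ H.tan_pos H.pos_height H.sum_sq H.pos_radius hx h
  have hinfRot : ∀ x : Plane, r₀ ≤ ‖x‖ → infRot (pillowDisc ρ G (Real.tan φ) r₀ z₀ x) ≠ 0 := by
    intro x hx
    rw [pillowDisc_of_ge hρ hG H hx]
    exact infRot_ne_zero (strip_hor_pos (norm_edir hρ (H.ne_zero hx)) (width_pos x)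
      (width_le_one H.tan_pos H.pos_height H.sum_sq H.pos_radius hx))
  have hinner : ∀ x : Plane, ‖x‖ ≤ r₀ → ∀ d, pillowDisc' ρ r' (Real.tan φ) r₀ z₀ x d = 0 →
      d = 0 := by
    intro x hx d h
    rw [pillowDisc', if_pos hx, smul_apply] at h
    exact (injective_iff_map_eq_zero _).1
      (hG.inj _ (H.inv_smul_mem.2 (mem_closedBall_zero_iff.2 hx))) _
      ((smul_eq_zero.1 h).resolve_left (inv_ne_zero H.pos_radius.ne'))
  refine ⟨hasFDerivAt_pillowDisc hρ hG H, continuous_pillowDisc' hρ hG H, hasDerivAt_tilt H.angle,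
    continuous_tilt' H.angle, fun x _ => ?_, fun e he q hq d hd h => ?_, fun x hx => ?_,
    tilt'_pos H.angle H.pos_height (by rw [abs_zero]; exact H.pos_height)⟩
  · rw [injective_iff_map_eq_zero]
    intro d h
    rcases le_total ‖x‖ r₀ with hx | hx
    · exact hinner x hx d h
    · exact key x hx d 0 (by rw [h, zero_smul])
  -- A tangent vector with zero horizontal part is zero unless `q` is on the equator; on the equator
  -- the positive derivative of the tilt forces the height of the vector to vanish.
  · have main : hor d = 0 → ver d = 0 ∨ ver q ≠ 0 → d = 0 := by
      intro h1 h2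
      refine eq_zero_of_hor_ver h1 (h2.elim id fun h3 => ?_)
      rw [inner_eq_hor_add_ver, h1, inner_zero_right, zero_add] at hd
      exact (mul_eq_zero.1 hd).resolve_left h3
    rcases le_or_gt ‖hor q‖ r₀ with hx | hx
    · have hz := (H.le_abs_ver_iff hq).2 hx
      rw [tilt'_eq_zero H.pos_height hz, mul_zero, zero_mul, zero_smul, add_zero] at h
      refine main (hinner _ hx _ h) (Or.inr fun h0 => ?_)
      rw [h0, abs_zero] at hz
      exact hz.not_gt H.pos_height
    · have hz : |ver q| < z₀ := by
        by_contra! hz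
        exact hx.not_ge ((H.le_abs_ver_iff hq).1 hz)
      have h1 : hor d = 0 := key _ hx.le _ (-(e * tilt' φ z₀ (ver q) * ver d)) (by
        rw [neg_smul]; exact eq_neg_of_add_eq_zero_left h)
      rw [h1, map_zero, zero_add] at h
      have h2 := (smul_eq_zero.1 h).resolve_right (hinfRot _ hx.le)
      have h3 := (tilt'_pos H.angle H.pos_height hz).ne'
      exact main h1 (Or.inl ((mul_eq_zero.1 h2).resolve_left (mul_ne_zero he.ne' h3)))
  · have hx' : r₀ ≤ ‖x‖ := by rw [mem_sphere_zero_iff_norm.1 hx]; exact H.radius_lt_one.le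
    rintro ⟨d, hd⟩
    have h0 := key x hx' d 1 (by rw [hd, one_smul])
    rw [h0, map_zero] at hd
    exact hinfRot x hx' hd.symm

end PillowDisc

/-! ### The explicit parametrization -/

theorem RegularlyHomotopic.isSphereImmersion {f g : Sphere2 → Space} (h : RegularlyHomotopic f g) :
    IsSphereImmersion 1 f := by
  obtain ⟨H, h0, -, h1, -⟩ := h
  exact h0 ▸ h1 0

/-- The point of `Space` with given horizontal part and height. -/
def liftPt (y : Plane) (z : ℝ) : Space := !₂[y 0, y 1, z]

@[simp] theorem hor_liftPt (y : Plane) (z : ℝ) : hor (liftPt y z) = y := by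
  ext i; fin_cases i <;> rfl

@[simp] theorem ver_liftPt (y : Plane) (z : ℝ) : ver (liftPt y z) = z := rfl

theorem liftPt_mem_sphere {y : Plane} {z : ℝ} :
    liftPt y z ∈ sphere (0 : Space) 1 ↔ ‖y‖ ^ 2 + z ^ 2 = 1 := by
  rw [mem_sphere_zero_iff_norm, ← sq_eq_sq₀ (norm_nonneg _) one_pos.le, norm_sq_eq_hor_add_ver,
    hor_liftPt, ver_liftPt, one_pow]

theorem ext_hor_ver {p q : Space} (h : hor p = hor q) (h' : ver p = ver q) : p = q := by
  rw [← sub_eq_zero]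
  exact eq_zero_of_hor_ver (by rw [map_sub, h, sub_self]) (by rw [map_sub, h', sub_self])

theorem continuous_liftPt : Continuous fun a : Plane × ℝ => liftPt a.1 a.2 := by
  unfold liftPt
  fun_prop

/-- The parametrization of the glued sphere by the pillow. -/
def pillowSphere (r : Plane → Space) (φ z₀ : ℝ) (q : Sphere2) : Space :=
  rotL (2 * tilt φ z₀ (ver q)) (r (hor q))

/-- The embedding of the disc as the upper (`s = 1`) or lower (`s = -1`) cap of the sphere. -/
def cap (Γ : Plane → Plane) (r₀ s : ℝ) (x : Plane) : Sphere2 :=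
  retract (liftPt (r₀ • Γ x) (s * √(1 - ‖r₀ • Γ x‖ ^ 2)))

section Cap

variable {G Γ : Plane → Plane} {lam φ r₀ z₀ s : ℝ}

theorem IsNeck.norm_smul_le (H : IsNeck lam φ r₀ z₀) {y : Plane} (hy : y ∈ closedBall (0 : Plane) 1) :
    ‖r₀ • y‖ ≤ r₀ := by
  rw [norm_smul, Real.norm_of_nonneg H.pos_radius.le]
  exact mul_le_of_le_one_right H.pos_radius.le (mem_closedBall_zero_iff.1 hy)

theorem IsNeck.coe_cap (H : IsNeck lam φ r₀ z₀) (hs : s ^ 2 = 1) {x : Plane}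
    (hx : Γ x ∈ closedBall (0 : Plane) 1) :
    (cap Γ r₀ s x : Space) = liftPt (r₀ • Γ x) (s * √(1 - ‖r₀ • Γ x‖ ^ 2)) := by
  have h1 := H.norm_smul_le hx
  have h2 : ‖r₀ • Γ x‖ ^ 2 ≤ 1 := by nlinarith [norm_nonneg (r₀ • Γ x), H.radius_lt_one]
  have hm : liftPt (r₀ • Γ x) (s * √(1 - ‖r₀ • Γ x‖ ^ 2)) ∈ sphere (0 : Space) 1 := by
    rw [liftPt_mem_sphere, mul_pow, hs, Real.sq_sqrt (by linarith)]
    ring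
  exact congrArg Subtype.val (retract_coe ⟨_, hm⟩)

theorem IsNeck.hor_cap (H : IsNeck lam φ r₀ z₀) (hs : s ^ 2 = 1) {x : Plane}
    (hx : Γ x ∈ closedBall (0 : Plane) 1) : hor (cap Γ r₀ s x) = r₀ • Γ x := by
  rw [H.coe_cap hs hx, hor_liftPt]

theorem IsNeck.ver_cap (H : IsNeck lam φ r₀ z₀) (hs : s ^ 2 = 1) {x : Plane}
    (hx : Γ x ∈ closedBall (0 : Plane) 1) : z₀ ≤ s * ver (cap Γ r₀ s x) := by
  have h1 := H.norm_smul_le hx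
  rw [H.coe_cap hs hx, ver_liftPt, ← mul_assoc, ← sq, hs, one_mul]
  apply Real.le_sqrt_of_sq_le
  nlinarith [norm_nonneg (r₀ • Γ x), H.sum_sq]

theorem IsNeck.continuousOn_cap (H : IsNeck lam φ r₀ z₀) (hs : s ^ 2 = 1)
    (hm : MapsTo Γ (closedBall 0 1) (closedBall 0 1)) (hc : ContinuousOn Γ (closedBall 0 1)) :
    ContinuousOn (cap Γ r₀ s) (closedBall 0 1) := by
  rw [Topology.IsInducing.subtypeVal.continuousOn_iff]
  have h1 : ContinuousOn (fun x => (r₀ • Γ x, s * √(1 - ‖r₀ • Γ x‖ ^ 2))) (closedBall 0 1) := by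
    fun_prop
  exact (continuous_liftPt.comp_continuousOn h1).congr fun x hx => H.coe_cap hs (hm hx)

theorem IsNeck.injOn_cap (H : IsNeck lam φ r₀ z₀) (hs : s ^ 2 = 1)
    (hm : MapsTo Γ (closedBall 0 1) (closedBall 0 1)) (hi : InjOn Γ (closedBall 0 1)) :
    InjOn (cap Γ r₀ s) (closedBall 0 1) := by
  intro x hx y hy h
  have h1 := congrArg (fun q : Sphere2 => hor q) h
  simp only [H.hor_cap hs (hm hx), H.hor_cap hs (hm hy)] at h1
  exact hi hx hy (smul_right_injective _ H.pos_radius.ne' h1)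

theorem IsNeck.mem_image_cap (H : IsNeck lam φ r₀ z₀) (hs : s ^ 2 = 1)
    (hm : MapsTo Γ (closedBall 0 1) (closedBall 0 1)) (hb : MapsTo Γ (ball 0 1) (ball 0 1))
    (hGm : MapsTo G (ball 0 1) (ball 0 1)) (hΓG : ∀ x ∈ ball (0 : Plane) 1, Γ (G x) = x)
    (q : Sphere2) : q ∈ cap Γ r₀ s '' ball 0 1 ↔ z₀ < s * ver q := by
  have hr := H.pos_radius
  constructor
  · rintro ⟨x, hx, rfl⟩
    have hx' := hm (ball_subset_closedBall hx)
    have h2 := mem_ball_zero_iff.1 (hb hx)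
    rw [H.coe_cap hs hx', ver_liftPt, ← mul_assoc, ← sq, hs, one_mul]
    apply Real.lt_sqrt_of_sq_lt
    have h3 : ‖r₀ • Γ x‖ < r₀ := by
      rw [norm_smul, Real.norm_of_nonneg hr.le]
      exact mul_lt_of_lt_one_right hr h2
    nlinarith [norm_nonneg (r₀ • Γ x), H.sum_sq]
  · intro hq
    have hn := norm_sq_eq_hor_add_ver q
    rw [norm_coe_sphere2] at hn
    have h0 : (s * ver q) ^ 2 = ver q ^ 2 := by rw [mul_pow, hs, one_mul]
    have hz := H.pos_height
    have h1 : ‖hor (q : Space)‖ < r₀ := by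
      rw [← sq_lt_sq₀ (norm_nonneg _) hr.le]
      nlinarith [H.sum_sq]
    have h2 : r₀⁻¹ • hor (q : Space) ∈ ball (0 : Plane) 1 := by
      rw [mem_ball_zero_iff, norm_smul, norm_inv, Real.norm_of_nonneg hr.le, inv_mul_lt_one₀ hr]
      exact h1
    refine ⟨G (r₀⁻¹ • hor (q : Space)), hGm h2, ?_⟩
    have h3 : r₀ • Γ (G (r₀⁻¹ • hor (q : Space))) = hor (q : Space) := by
      rw [hΓG _ h2, smul_smul, mul_inv_cancel₀ hr.ne', one_smul]
    ext1
    rw [H.coe_cap hs (by rw [hΓG _ h2]; exact ball_subset_closedBall h2), h3]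
    refine ext_hor_ver (hor_liftPt _ _) ?_
    have h4 : 1 - ‖hor (q : Space)‖ ^ 2 = (s * ver q) ^ 2 := by rw [h0]; linarith
    rw [ver_liftPt, h4, Real.sqrt_sq (hz.trans hq).le, ← mul_assoc, ← sq, hs, one_mul]

end Cap

section Neck

variable {ρ : Plane → Space} {G : Plane → Plane} {r' : Plane → Plane →L[ℝ] Space}
  {lam φ r₀ z₀ : ℝ}

theorem IsNeck.le_norm_hor (H : IsNeck lam φ r₀ z₀) {q : Space} (hq : q ∈ sphere (0 : Space) 1)
    (hz : |ver q| ≤ z₀) : r₀ ≤ ‖hor q‖ := by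
  have h := norm_sq_eq_hor_add_ver q
  rw [mem_sphere_zero_iff_norm.1 hq] at h
  rw [← sq_le_sq₀ H.pos_radius.le (norm_nonneg _)]
  have : ver q ^ 2 ≤ z₀ ^ 2 := by rwa [sq_le_sq, abs_of_pos H.pos_height]
  linarith [H.sum_sq]

theorem IsNeck.abs_div_le (H : IsNeck lam φ r₀ z₀) {z : ℝ} (hz : |z| ≤ z₀) : |z / z₀| ≤ 1 := by
  rw [abs_div, abs_of_pos H.pos_height]
  exact (div_le_one H.pos_height).2 hz

/-- The width of the neck at the height `z`. -/
def neckWidth (φ z₀ z : ℝ) : ℝ := prof (Real.tan φ) ((z / z₀) ^ 2)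

theorem IsNeck.neckWidth_le_one (H : IsNeck lam φ r₀ z₀) {z : ℝ} (hz : |z| ≤ z₀) :
    neckWidth φ z₀ z ≤ 1 :=
  prof_le_one H.tan_pos ((sq_le_one_iff_abs_le_one _).2 (H.abs_div_le hz))

theorem neckWidth_pos (φ z₀ z : ℝ) : 0 < neckWidth φ z₀ z := prof_pos _

/-- The neck of the pillow, in terms of the strip. -/
theorem pillowSphere_neck (hρ : IsSpanningDisc ρ) (hG : IsNormalized ρ G r' lam)
    (H : IsNeck lam φ r₀ z₀) {q : Sphere2} (hz : |ver q| ≤ z₀) :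
    pillowSphere (pillowDisc ρ G (Real.tan φ) r₀ z₀) φ z₀ q =
      rotZ (2 * tilt φ z₀ (ver q)) (strip (edir ρ (hor q)) (neckWidth φ z₀ (ver q))) := by
  have h1 := H.le_norm_hor q.2 hz
  have h := norm_sq_eq_hor_add_ver q
  rw [norm_coe_sphere2] at h
  have h2 : (1 - ‖hor (q : Space)‖ ^ 2) / z₀ ^ 2 = (ver q / z₀) ^ 2 := by
    rw [div_pow]
    congr 1
    linarith
  rw [pillowSphere, pillowDisc_of_ge hρ hG H h1, rotL_apply, outer, width, h2, neckWidth]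

theorem exists_edir_eq (hρ : IsSpanningDisc ρ) {x : Plane} (hx : x ≠ 0) :
    ∃ ψ, ρ (‖x‖⁻¹ • x) = screw ψ (1, 0) ∧
      edir ρ x = !₂[Real.cos (ψ / 2), Real.sin (ψ / 2)] := by
  obtain ⟨ψ, hψ⟩ := exists_of_mem_knotZero (hρ.bijOn_boundary.mapsTo (unit_mem_sphere hx))
  exact ⟨ψ, hψ, by rw [edir, hψ, coreVec_screw]⟩

theorem mapsTo_neck (hρ : IsSpanningDisc ρ) (hG : IsNormalized ρ G r' lam)
    (H : IsNeck lam φ r₀ z₀) :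
    MapsTo (pillowSphere (pillowDisc ρ G (Real.tan φ) r₀ z₀) φ z₀) {q | |ver q| ≤ z₀}
      (annulus φ) := by
  intro q hz
  have hz' : |ver q| ≤ z₀ := hz
  obtain ⟨ψ, -, hψ⟩ := exists_edir_eq hρ (H.ne_zero (H.le_norm_hor q.2 hz'))
  rw [pillowSphere_neck hρ hG H hz', hψ, ← screw_eq_strip, rotZ_screw]
  have hb := neckWidth_pos φ z₀ (ver q)
  have hb' := H.neckWidth_le_one hz'
  have harc := prof_mem_arc H.angle (H.abs_div_le hz')
  rw [← neckWidth] at harc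
  have h1 : (neckWidth φ z₀ (ver q) * Real.cos (tilt φ z₀ (ver q))) ^ 2 +
      (-(neckWidth φ z₀ (ver q) * Real.sin (tilt φ z₀ (ver q)))) ^ 2 =
      neckWidth φ z₀ (ver q) ^ 2 := by
    linear_combination neckWidth φ z₀ (ver q) ^ 2 * Real.sin_sq_add_cos_sq (tilt φ z₀ (ver q))
  refine ⟨_, _, Or.inl ⟨?_, ?_⟩, rfl⟩
  · rw [h1]
    nlinarith
  · change (_ ^ 2 + _ ^ 2 + 1) * _ = 2 * (_ : ℝ)
    rw [h1, harc]
    ring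

theorem eq_of_rotZ_eq {p : Space} (hp : 0 < p 0 ^ 2 + p 1 ^ 2) {a b : ℝ}
    (h : rotZ a p = rotZ b p) (hab : |a - b| < 2 * Real.pi) : a = b := by
  have h1 : rotZ (a - b) p = p := by
    rw [sub_eq_neg_add, rotZ_add, h, ← rotZ_add, neg_add_cancel, rotZ_zero]
  have h0 := congrArg (fun v : Space => v 0) h1
  have h2 := congrArg (fun v : Space => v 1) h1
  simp [rotZ] at h0 h2
  have h3 : Real.cos (a - b) * (p 0 ^ 2 + p 1 ^ 2) = p 0 ^ 2 + p 1 ^ 2 := by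
    linear_combination p 0 * h0 + p 1 * h2
  have h4 : Real.cos (a - b) = 1 := mul_right_cancel₀ hp.ne' (by rw [h3, one_mul])
  have h5 := (Real.cos_eq_one_iff_of_lt_of_lt (abs_lt.1 hab).1 (abs_lt.1 hab).2).1 h4
  linarith

/-- `coreVec` forgets the rotation and returns the width and the meridian direction. The rotation
angle then determines the tilt, hence the height, and the meridian direction determines the boundary
point because `ρ` is injective on the circle. -/
theorem injOn_neck (hρ : IsSpanningDisc ρ) (hG : IsNormalized ρ G r' lam)
    (H : IsNeck lam φ r₀ z₀) :
    InjOn (pillowSphere (pillowDisc ρ G (Real.tan φ) r₀ z₀) φ z₀) {q | |ver q| ≤ z₀} := by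
  intro q hq q' hq' h
  have hz : |ver q| ≤ z₀ := hq
  have hz' : |ver q'| ≤ z₀ := hq'
  have hx := H.ne_zero (H.le_norm_hor q.2 hz)
  have hx' := H.ne_zero (H.le_norm_hor q'.2 hz')
  rw [pillowSphere_neck hρ hG H hz, pillowSphere_neck hρ hG H hz'] at h
  have he := norm_edir hρ hx
  have he' := norm_edir hρ hx'
  have hb := neckWidth_pos φ z₀ (ver q)
  have hb' := neckWidth_pos φ z₀ (ver q')
  have hr := strip_radius_pos he hb (H.neckWidth_le_one hz)
  have hr' := strip_radius_pos he' hb' (H.neckWidth_le_one hz')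
  have h1 := congrArg coreVec h
  rw [coreVec_rotZ, coreVec_rotZ, coreVec_strip he hr, coreVec_strip he' hr'] at h1
  have h2 := congrArg norm h1
  rw [norm_smul, norm_smul, he, he', Real.norm_of_nonneg hb.le, Real.norm_of_nonneg hb'.le, mul_one,
    mul_one] at h2
  rw [h2] at h1
  have h3 : edir ρ (hor q) = edir ρ (hor q') := smul_right_injective _ hb'.ne' h1
  rw [h3, h2] at h
  have ht := abs_lt.1 (abs_tilt_lt (z₀ := z₀) H.angle (ver q))
  have ht' := abs_lt.1 (abs_tilt_lt (z₀ := z₀) H.angle (ver q'))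
  -- Tilts lie strictly between `-π / 2` and `π / 2`, so the doubled angles differ by less than a
  -- full turn.
  have h4 := eq_of_rotZ_eq (strip_hor_pos he' hb' (H.neckWidth_le_one hz')) h
    (abs_lt.2 ⟨by linarith [ht.1, ht'.2], by linarith [ht.2, ht'.1]⟩)
  have h5 : Real.sin φ * clampCubic (ver q / z₀) = Real.sin φ * clampCubic (ver q' / z₀) := by
    rw [← sin_tilt H.angle, ← sin_tilt H.angle, mul_left_cancel₀ two_ne_zero h4]
  have h6 : ver q = ver q' := by
    have := clampCubic_injOn (abs_le.1 (H.abs_div_le hz)) (abs_le.1 (H.abs_div_le hz'))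
      (mul_left_cancel₀ (sin_mem H.angle).1.ne' h5)
    exact (div_left_inj' H.pos_height.ne').1 this
  have h7 : ‖hor (q : Space)‖⁻¹ • hor (q : Space) = ‖hor (q' : Space)‖⁻¹ • hor (q' : Space) := by
    apply hρ.bijOn_boundary.injOn (unit_mem_sphere hx) (unit_mem_sphere hx')
    rw [← strip_edir_one hρ hx, h3, strip_edir_one hρ hx']
  have h8 : ‖hor (q : Space)‖ = ‖hor (q' : Space)‖ := by
    have n1 := norm_sq_eq_hor_add_ver q
    have n2 := norm_sq_eq_hor_add_ver q'
    rw [norm_coe_sphere2] at n1 n2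
    rw [← sq_eq_sq₀ (norm_nonneg _) (norm_nonneg _)]
    rw [h6] at n1
    linarith
  rw [h8] at h7
  ext1
  exact ext_hor_ver (smul_right_injective _ (inv_ne_zero (norm_ne_zero_iff.2 hx')) h7) h6

/-- The points of the arc, in terms of the tilt. -/
theorem IsNeck.exists_height (H : IsNeck lam φ r₀ z₀) {u : ℝ × ℝ} (hu : u ∈ arc φ) :
    ∃ z, |z| ≤ z₀ ∧ u = (neckWidth φ z₀ z * Real.cos (tilt φ z₀ z),
      -(neckWidth φ z₀ z * Real.sin (tilt φ z₀ z))) := by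
  obtain ⟨hu1, hu2⟩ := hu
  have hc := cos_pos' H.angle
  have hs := sin_mem H.angle
  have hu0 : 0 < u.1 := by
    have : 0 < (u.1 ^ 2 + u.2 ^ 2 + 1) * Real.cos φ := by positivity
    linarith
  set b := √(u.1 ^ 2 + u.2 ^ 2) with hb
  have hb2 : b ^ 2 = u.1 ^ 2 + u.2 ^ 2 := Real.sq_sqrt (by positivity)
  have hb0 : 0 < b := Real.sqrt_pos.2 (by positivity)
  have hb1 : b ≤ 1 := Real.sqrt_le_one.2 hu1
  -- From the arc equation and `b ^ 2 + 1 ≥ 2 * b`. It bounds the polar angle of `u` by `φ`, so that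
  -- some height has the matching tilt.
  have hcb : Real.cos φ ≤ u.1 / b := by
    rw [le_div_iff₀ hb0]
    rw [← hb2] at hu2
    nlinarith [mul_nonneg (sq_nonneg (b - 1)) hc.le]
  have hsb : (u.2 / b) ^ 2 = 1 - (u.1 / b) ^ 2 := by
    rw [div_pow, div_pow, hb2]
    field_simp
    ring
  set t := -(u.2 / b) / Real.sin φ with ht
  have ht1 : |t| ≤ 1 := by
    rw [← sq_le_one_iff_abs_le_one, ht, div_pow, neg_sq, hsb, div_le_one (by have := hs.1; positivity),
      Real.sin_sq]
    nlinarith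
  have h2 : clampCubic 1 = 1 := clampCubic_of_one_le le_rfl
  have h3 : clampCubic (-1) = -1 := clampCubic_of_le_neg_one le_rfl
  obtain ⟨v, hv, hvt⟩ := intermediate_value_Icc (show (-1 : ℝ) ≤ 1 by norm_num)
    continuous_clampCubic.continuousOn (show t ∈ Icc (clampCubic (-1)) (clampCubic 1) by
      rw [h2, h3]; exact abs_le.1 ht1)
  have hz : |v * z₀| ≤ z₀ := by
    rw [abs_mul, abs_of_pos H.pos_height]
    exact mul_le_of_le_one_left H.pos_height.le (abs_le.2 hv)
  have hvz : v * z₀ / z₀ = v := mul_div_cancel_right₀ _ H.pos_height.ne'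
  have hsin : Real.sin (tilt φ z₀ (v * z₀)) = -(u.2 / b) := by
    rw [sin_tilt H.angle, hvz, hvt, ht, mul_div_cancel₀ _ hs.1.ne']
  have hcos : Real.cos (tilt φ z₀ (v * z₀)) = u.1 / b := by
    have h4 := abs_lt.1 (abs_tilt_lt (z₀ := z₀) H.angle (v * z₀))
    have h5 := Real.cos_pos_of_mem_Ioo ⟨by linarith [h4.1], h4.2⟩
    rw [← sq_eq_sq₀ h5.le (by positivity), Real.cos_sq', hsin, neg_sq, hsb]
    ring
  have hw := prof_mem_arc H.angle (H.abs_div_le hz)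
  rw [← neckWidth, hcos] at hw
  have hw0 := neckWidth_pos φ z₀ (v * z₀)
  have hw1 := H.neckWidth_le_one hz
  have hwb : neckWidth φ z₀ (v * z₀) = b := by
    set w := neckWidth φ z₀ (v * z₀)
    -- For a fixed tilt the arc equation is quadratic in the radius, with reciprocal roots; since
    -- `w` and `b` are at most `1`, they coincide.
    have h6 : (w - b) * (w * b - 1) * Real.cos φ = 0 := by
      rw [mul_div_assoc', eq_div_iff hb0.ne'] at hw
      rw [← hb2] at hu2
      linear_combination hw - w * hu2
    rcases mul_eq_zero.1 ((mul_eq_zero.1 h6).resolve_right hc.ne') with h7 | h7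
    · linarith
    · nlinarith
  refine ⟨v * z₀, hz, ?_⟩
  rw [hwb, hsin, hcos, mul_neg, neg_neg, mul_div_cancel₀ _ hb0.ne', mul_div_cancel₀ _ hb0.ne']

theorem surjOn_neck (hρ : IsSpanningDisc ρ) (hG : IsNormalized ρ G r' lam)
    (H : IsNeck lam φ r₀ z₀) :
    SurjOn (pillowSphere (pillowDisc ρ G (Real.tan φ) r₀ z₀) φ z₀) {q | |ver q| ≤ z₀}
      (annulus φ) := by
  have key : ∀ ψ, ∀ u ∈ arc φ, ∃ q : Sphere2, |ver q| ≤ z₀ ∧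
      pillowSphere (pillowDisc ρ G (Real.tan φ) r₀ z₀) φ z₀ q = screw ψ u := by
    intro ψ u hu
    obtain ⟨z, hz, rfl⟩ := H.exists_height hu
    set o := tilt φ z₀ z with ho
    -- Starting at the parameter `ψ - 2 * o` compensates for the later rotation by `2 * o`.
    obtain ⟨x, hx, hxp⟩ := hρ.bijOn_boundary.surjOn
      (show screw (ψ - 2 * o) (1, 0) ∈ knotZero from ⟨_, Or.inl rfl⟩)
    have hz1 : 0 < 1 - z ^ 2 := by
      have : z ^ 2 ≤ z₀ ^ 2 := by rwa [sq_le_sq, abs_of_pos H.pos_height]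
      have := H.pos_radius
      nlinarith [H.sum_sq]
    have hs := Real.sqrt_pos.2 hz1
    have hq : liftPt (√(1 - z ^ 2) • x) z ∈ sphere (0 : Space) 1 := by
      rw [liftPt_mem_sphere, norm_smul, mem_sphere_zero_iff_norm.1 hx, mul_one,
        Real.norm_of_nonneg hs.le, Real.sq_sqrt hz1.le]
      ring
    have he : edir ρ (√(1 - z ^ 2) • x) = coreVec (screw (ψ - 2 * o) (1, 0)) := by
      rw [edir, unit_smul_pos hs, unit_of_mem_sphere hx, hxp]
    refine ⟨⟨_, hq⟩, hz, ?_⟩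
    rw [pillowSphere_neck hρ hG H (q := ⟨_, hq⟩) hz]
    simp only [hor_liftPt, ver_liftPt, he, coreVec_screw]
    rw [← screw_eq_strip, rotZ_screw, ← ho, sub_add_cancel]
  rintro p ⟨ψ, u, hu | hu, rfl⟩
  · exact key ψ u hu
  -- The second arc is the first one turned by `π` in the disc, which one full revolution of the
  -- screw brings about.
  · obtain ⟨h1, h2⟩ := hu
    have := key (ψ + 2 * Real.pi) (-u.1, -u.2) ⟨by simpa using h1, by
      rw [Real.cos_pi_sub] at h2
      simp
      linarith⟩
    rw [screw_add_two_pi, neg_neg, neg_neg] at this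
    exact this

theorem exists_isGlued (hρ : IsSpanningDisc ρ) (hφ : φ ∈ Ioo 0 (Real.pi / 2)) :
    ∃ (f : Sphere2 → Space) (c₁ c₂ : Plane → Sphere2) (L : Space →L[ℝ] Space),
      IsGlued (fun x => rotZ (2 * φ) (ρ x)) (fun x => rotZ (-(2 * φ)) (ρ x)) (annulus φ) f c₁ c₂ ∧
      Function.Injective L ∧ RegularlyHomotopic f fun q => L q := by
  obtain ⟨G, r', lam, hG⟩ := hρ.exists_isNormalized
  obtain ⟨r₀, z₀, H⟩ := exists_isNeck hG.pos hφ
  have hP := isPillow_pillowDisc hρ hG H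
  obtain ⟨L, hL, hfL⟩ := hP.exists_linear two_pos
  -- The pillow contains `ρ ∘ G`, whereas the caps must carry `ρ` itself; precomposing with the
  -- inverse of `G` undoes the reparametrization. Continuity of `Γ` suffices for the discs of the
  -- gluing.
  set Γ := Function.invFunOn G (closedBall 0 1) with hΓ
  have hinv : InvOn Γ G (closedBall 0 1) (closedBall 0 1) := hG.bij.invOn_invFunOn
  have hΓm : MapsTo Γ (closedBall 0 1) (closedBall 0 1) := hG.bij.surjOn.mapsTo_invFunOn
  have hΓi : InjOn Γ (closedBall 0 1) := hinv.2.injOn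
  have hΓc : ContinuousOn Γ (closedBall 0 1) :=
    continuousOn_of_comp_eq (isCompact_closedBall _ _) continuousOn_id hG.cont hG.bij.injOn hΓm
      fun x hx => hinv.2 hx
  have hΓb : MapsTo Γ (ball 0 1) (ball 0 1) := by
    intro x hx
    have h1 := hΓm (ball_subset_closedBall hx)
    by_contra h2
    have h3 : Γ x ∈ sphere (0 : Plane) 1 := by
      rw [mem_sphere_zero_iff_norm]
      rw [mem_closedBall_zero_iff] at h1
      rw [mem_ball_zero_iff, not_lt] at h2
      exact le_antisymm h1 h2
    have h4 := hinv.2 (ball_subset_closedBall hx)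
    rw [hG.fixed _ h3] at h4
    rw [h4] at h2
    exact h2 hx
  have hΓG : ∀ x ∈ ball (0 : Plane) 1, Γ (G x) = x := fun x hx => hinv.1 (ball_subset_closedBall hx)
  have h1 : (1 : ℝ) ^ 2 = 1 := one_pow 2
  have h2 : (-1 : ℝ) ^ 2 = 1 := by norm_num
  have hcap : ∀ s : ℝ, s ^ 2 = 1 → ∀ x ∈ closedBall (0 : Plane) 1,
      pillowDisc ρ G (Real.tan φ) r₀ z₀ (hor (cap Γ r₀ s x)) = ρ x := by
    intro s hs x hx
    rw [H.hor_cap hs (hΓm hx), pillowDisc, if_pos (H.norm_smul_le (hΓm hx)), smul_smul,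
      inv_mul_cancel₀ H.pos_radius.ne', one_smul, hinv.2 hx]
  have hset : (cap Γ r₀ 1 '' ball 0 1 ∪ cap Γ r₀ (-1) '' ball 0 1)ᶜ =
      {q : Sphere2 | |ver q| ≤ z₀} := by
    ext q
    rw [mem_compl_iff, mem_union, H.mem_image_cap h1 hΓm hΓb hG.ball hΓG,
      H.mem_image_cap h2 hΓm hΓb hG.ball hΓG, one_mul, neg_one_mul, ← lt_abs, not_lt]
    rfl
  refine ⟨pillowSphere (pillowDisc ρ G (Real.tan φ) r₀ z₀) φ z₀, cap Γ r₀ 1, cap Γ r₀ (-1), L,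
    ⟨hfL.isSphereImmersion, H.continuousOn_cap h1 hΓm hΓc, H.injOn_cap h1 hΓm hΓi,
      H.continuousOn_cap h2 hΓm hΓc, H.injOn_cap h2 hΓm hΓi, ?_, fun x hx => ?_, fun x hx => ?_, ?_⟩,
    hL, hfL⟩
  · rw [disjoint_left]
    rintro _ ⟨x, hx, rfl⟩ ⟨y, hy, hyx⟩
    have h3 := H.ver_cap h1 (hΓm hx)
    have h4 := H.ver_cap h2 (hΓm hy)
    rw [hyx] at h4
    linarith [H.pos_height]
  · have h3 := H.ver_cap h1 (hΓm hx)
    rw [one_mul] at h3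
    rw [pillowSphere, hcap 1 h1 x hx, tilt_of_le hφ H.pos_height h3, rotL_apply]
  · have h3 := H.ver_cap h2 (hΓm hx)
    rw [neg_one_mul] at h3
    rw [pillowSphere, hcap (-1) h2 x hx, ← neg_neg (ver _), tilt_neg,
      tilt_of_le hφ H.pos_height h3, rotL_apply, mul_neg]
  · rw [hset]
    exact ⟨mapsTo_neck hρ hG H, injOn_neck hρ hG H, surjOn_neck hρ hG H⟩

end Neck

/-! ### Symmetry in the angle and conclusion. -/

theorem annulus_neg (φ : ℝ) : annulus (-φ) = annulus φ := by
  simp [annulus, arc, Real.cos_pi_sub, sub_neg_eq_add, add_comm Real.pi, Real.cos_add_pi]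

theorem IsSphereS.neg {ρ : Plane → Space} {θ : ℝ} {f : Sphere2 → Space} (h : IsSphereS ρ θ f) :
    IsSphereS ρ (-θ) f := by
  obtain ⟨h0, c₁, c₂, h1, h2, h3, h4, h5, h6, h7, h8⟩ := h
  refine ⟨h0, c₂, c₁, h3, h4, h1, h2, h5.symm, h7, ?_, ?_⟩
  · rwa [neg_neg]
  · rwa [union_comm, neg_div, annulus_neg]

theorem isSphereS_neg_iff {ρ : Plane → Space} {θ : ℝ} {f : Sphere2 → Space} :
    IsSphereS ρ (-θ) f ↔ IsSphereS ρ θ f :=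
  ⟨fun h => by simpa using h.neg, IsSphereS.neg⟩

theorem isSphereS_iff_exists_isGlued {ρ : Plane → Space} {θ : ℝ} {f : Sphere2 → Space} :
    IsSphereS ρ θ f ↔ ∃ c₁ c₂, IsGlued (fun x => rotZ θ (ρ x)) (fun x => rotZ (-θ) (ρ x))
      (annulus (θ / 2)) f c₁ c₂ := by
  constructor
  · rintro ⟨h0, c₁, c₂, h1, h2, h3, h4, h5, h6, h7, h8⟩
    exact ⟨c₁, c₂, h0, h1, h2, h3, h4, h5, h6, h7, h8⟩
  · rintro ⟨c₁, c₂, h0, h1, h2, h3, h4, h5, h6, h7, h8⟩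
    exact ⟨h0, c₁, c₂, h1, h2, h3, h4, h5, h6, h7, h8⟩

theorem IsSpanningDisc.contDiffOn_rotZ {ρ : Plane → Space} (hρ : IsSpanningDisc ρ) (a : ℝ) :
    ContDiffOn ℝ 1 (fun x => rotZ a (ρ x)) (ball 0 1) := by
  simp only [← rotL_apply]
  exact (rotL a).contDiff.comp_contDiffOn
    ((hρ.contDiffOn.of_le (by simp)).mono ball_subset_closedBall)

theorem IsSpanningDisc.injective_fderiv_rotZ {ρ : Plane → Space} (hρ : IsSpanningDisc ρ) (a : ℝ)
    {x : Plane} (hx : x ∈ ball (0 : Plane) 1) :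
    Function.Injective (fderiv ℝ (fun x => rotZ a (ρ x)) x) := by
  have h1 : closedBall (0 : Plane) 1 ∈ 𝓝 x :=
    Filter.mem_of_superset (isOpen_ball.mem_nhds hx) ball_subset_closedBall
  have h2 := (hρ.hasFDerivWithinAt (ball_subset_closedBall hx)).hasFDerivAt h1
  simp only [← rotL_apply]
  have h3 : HasFDerivAt (fun x => rotL a (ρ x))
      ((rotL a).comp (fderivWithin ℝ ρ (closedBall 0 1) x)) x := (rotL a).hasFDerivAt.comp x h2
  rw [h3.fderiv]
  exact (rotL_injective a).comp (hρ.injective_fderivWithin x (ball_subset_closedBall hx))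

theorem injective_mfderiv_of_leftInverse {h k : Sphere2 → Sphere2}
    (hh : ContMDiff (𝓡 2) (𝓡 2) 1 h) (hk : ContMDiff (𝓡 2) (𝓡 2) 1 k) (hkh : ∀ q, k (h q) = q)
    (q : Sphere2) : Function.Injective (mfderiv (𝓡 2) (𝓡 2) h q) := by
  have h1 := mfderiv_comp q (hk.mdifferentiable one_ne_zero (h q)) (hh.mdifferentiable one_ne_zero q)
  have h2 : k ∘ h = id := funext hkh
  rw [h2, mfderiv_id] at h1
  refine Function.LeftInverse.injective (g := mfderiv (𝓡 2) (𝓡 2) k (h q)) fun v => ?_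
  exact (congrArg (fun A => A v) h1).symm

theorem exists_parametrization_and_embedding {ρ : Plane → Space} (hρ : IsSpanningDisc ρ) {θ : ℝ}
    (hθ : θ ∈ Ioo 0 Real.pi) :
    (∃ f : Sphere2 → Space, IsSphereS ρ θ f) ∧
    ∀ f : Sphere2 → Space, IsSphereS ρ θ f →
      ∃ g : Sphere2 → Space, IsSmoothSphereEmbedding g ∧ RegularlyHomotopic f g := by
  have h2 : 2 * (θ / 2) = θ := by ring
  obtain ⟨f₀, c₁, c₂, L, H₀, hL, hfL⟩ := exists_isGlued hρ (φ := θ / 2)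
    ⟨by linarith [hθ.1], by linarith [hθ.2]⟩
  rw [h2] at H₀
  refine ⟨⟨f₀, isSphereS_iff_exists_isGlued.2 ⟨c₁, c₂, H₀⟩⟩, fun f hf => ?_⟩
  obtain ⟨d₁, d₂, H⟩ := isSphereS_iff_exists_isGlued.1 hf
  obtain ⟨h, k, hh, hk, hkh, hfh⟩ := H.exists_diffeo H₀ (hρ.contDiffOn_rotZ θ)
    (fun x hx => hρ.injective_fderiv_rotZ θ hx) (hρ.contDiffOn_rotZ (-θ))
    (fun x hx => hρ.injective_fderiv_rotZ (-θ) hx)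
  obtain ⟨g, hg, hLg⟩ := exists_smoothSphereEmbedding hh hk hkh L hL
  refine ⟨g, hg, ?_⟩
  -- The deformation of the explicit sphere is transported by `h`; it ends at `L ∘ h`, which is then
  -- smoothed.
  have h3 := hfL.comp_right hh (injective_mfderiv_of_leftInverse hh hk hkh)
  have h4 : f₀ ∘ h = f := funext hfh
  rw [h4] at h3
  exact h3.trans hLg

end

theorem mainTheorem3 (ρ : Plane → Space) (hρ : IsSpanningDisc ρ)
    (θ : ℝ) (hθ : θ ∈ Set.Ioo (-Real.pi) Real.pi) (hθ0 : θ ≠ 0) :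
    (∃ f : Sphere2 → Space, IsSphereS ρ θ f) ∧
    ∀ f : Sphere2 → Space, IsSphereS ρ θ f →
      ∃ g : Sphere2 → Space, IsSmoothSphereEmbedding g ∧ RegularlyHomotopic f g := by
  -- Changing the sign of `θ` exchanges the two discs and leaves the annulus unchanged.
  rcases hθ0.lt_or_gt with h | h
  · have := exists_parametrization_and_embedding hρ (θ := -θ) ⟨by linarith, by linarith [hθ.1]⟩
    simpa only [isSphereS_neg_iff] using this
  · exact exists_parametrization_and_embedding hρ ⟨h, hθ.2⟩
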